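/- Let $\mathfrak g$ be of type $D_n^{(1)}$, $B_n^{(1)}$ or $A_{2n-1}^{(2)}$, with underlying classical type $X_n=D_n,B_n,C_n$, and let $r\ge 3$ be odd with $r\le n-2$, $r\le n-1$, $r\le n$ respectively; let $k,l\ge 1$. Put $I=\{0,1,\dots,n\}$ and $I_0=I\setminus\{0\}$. For crystals $B_1,B_2$ we use the convention $e_i(b_1\otimes b_2)=e_ib_1\otimes b_2$ if $\varphi_i(b_1)\ge\varepsilon_i(b_2)$ and $e_i(b_1\otimes b_2)=b_1\otimes e_ib_2$ otherwise. For a word $\boldsymbol a=a_1a_2\cdots a_m$ in $I$ put $e_{\boldsymbol a}=e_{a_m}\cdots e_{a_2}e_{a_1}$; in words, $i^m$ is the letter $i$ repeated $m$ times. Let $B^{r,k}$ be the Kirillov–Reshetikhin crystal: as an $X_n$-crystal it is $\bigoplus_\Lambda B(\Lambda)$, the sum over all $\Lambda$ obtained from $k\Lambda_r$ by removing vertical dominoes, realized by Kashiwara–Nakashima tableaux, and $e_0=\sigma e_1\sigma$, $f_0=\sigma f_1\sigma$, where $\sigma$ is the involution commuting with $e_i,f_i$ for $2\le i\le n$ that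 is given on $\{2,\dots,n\}$-highest elements by the involution $\mathfrak S$ on $\pm$-diagrams (above each column of inner height $i\equiv r-1 \pmod 2$ the numbers of $+$ and $-$ are interchanged; above the columns of inner height $i\equiv r\pmod 2$, $i<r$, the numbers of empty columns and of $\mp$ pairs are interchanged). Elements of $B^{1,l}$ are one-row tableaux of length $l$; $x_i$ and $\bar x_i$ denote the numbers of letters $i$ and $\bar i$ in $x\in B^{1,l}$, with $x_{n+1}=0$, and one-row tableaux are written as words of letters. Let $\mu=\sum_{i}\mu_i\Lambda_i$ be a dominant weight occurring in $B^{r,k}$, i.e. $\mu_i=0$ unless $1\le i\le r$ is odd, and $\sum_i\mu_i=k$; write $\mu$ also for the highest weight tableau of weight $\mu$ in $B^{r,k}$. Let $x\in B^{1,l}$ be such that $\mu\otimes x\in B^{r,k}\otimes B^{1,l}$ is $I_0$-highest, i.e. $e_i(\mu\otimes x)=0$ for all $i\in I_0$. In the following, sums with $j$ odd run over the odd $j$ in the range indicated. Define $$\alpha=k+x_1+\sum_{3\le j\le r,\ j\text{ odd}}\bar x_j,$$ $$s_{2i-1}=2k-\sum_{1\le j\le 2i-1,\ j\text{ odd}}\mu_j+x_1+x_{2i}+\sum_{3\le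 j\le 2i-1,\ j\text{ odd}}\bar x_j,\qquad s_{2i}=s_{2i-1}-x_{2i}\qquad(1\le i\le \tfrac{r+1}2),$$ $$\bar s_{2i}=\bar s_{2i-1}=\alpha-\sum_{2i+1\le j\le r,\ j\text{ odd}}\mu_j+\sum_{j=2i+1}^{r+1}x_j\qquad(1\le i\le\tfrac{r-1}2),$$ $$\bar{\bar s}_1=2k+l-\mu_1,\qquad \bar{\bar s}_{j}=2k-\sum_{1\le t\le 2i-1,\ t\text{ odd}}\mu_t\quad\text{for the other } j\in\{2i-1,2i\},\ 1\le i\le\tfrac{r-1}2,$$ $$\bar{\bar{\bar s}}_1=0,\quad \bar{\bar{\bar s}}_2=x_2+\bar x_1,\quad \bar{\bar{\bar s}}_{2i}=\bar{\bar{\bar s}}_{2i-1}=k-\sum_{2i+1\le j\le r,\ j\text{ odd}}\mu_j\qquad(2\le i\le\tfrac{r-1}2).$$ For $i\le n+1$ let $U_i(m)=i^m(i+1)^m\cdots n^m$ for types $D_n^{(1)},A_{2n-1}^{(2)}$ and $U_i(m)=i^m(i+1)^m\cdots(n-1)^m n^{2m}$ for type $B_n^{(1)}$ (empty for $i=n+1$);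 let $V_i(m)=(n-1)^m(n-2)^m\cdots i^m$ for types $B_n^{(1)},A_{2n-1}^{(2)}$ and $V_i(m)=(n-2)^m(n-3)^m\cdots i^m$ for type $D_n^{(1)}$ (empty when $i$ exceeds the first letter). Put $\boldsymbol b_1=\boldsymbol b_{1,1}\boldsymbol b_{1,2}$ with $$\boldsymbol b_{1,1}=2^{s_2}3^{s_3}\cdots r^{s_r}\;U_{r+1}(\alpha)\,V_r(\alpha)\;(r-1)^{\bar s_{r-1}}(r-2)^{\bar s_{r-2}}\cdots2^{\bar s_2},$$ $$\boldsymbol b_{1,2}=1^{\bar{\bar s}_1}2^{\bar{\bar s}_2}\cdots(r-1)^{\bar{\bar s}_{r-1}}\;U_r(k)\,V_r(k)\;(r-1)^{\bar{\bar{\bar s}}_{r-1}}\cdots2^{\bar{\bar{\bar s}}_2}1^{\bar{\bar{\bar s}}_1}.$$ Then $x_2+\bar x_1\le l$ and, in $B^{r,k}\otimes B^{1,l}$, $$e_{\boldsymbol b_1}\,e_0^{\,2k-\mu_1+x_1+x_2}(\mu\otimes x)=\bar\mu\otimes\bar3^{\,x_2+\bar x_1}1^{\,l-x_2-\bar x_1},$$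 where $\bar\mu=\sum_{3\le i\le r,\ i\text{ odd}}\mu_i\Lambda_i+\mu_1\Lambda_3$ (again denoting the highest weight tableau of this weight). -/

import Mathlib

/-! ### Crystals -/

/-- The data of a crystal whose nodes are labelled by natural numbers: the set of its elements inside
an ambient type, and the Kashiwara operators, `none` standing for the value `0`. -/
structure Crystal (β : Type) where
  elts : Set β
  e : ℕ → β → Option β
  f : ℕ → β → Option β

/-- `m`-fold iteration of a partial map. -/
def partialIter {β : Type} (g : β → Option β) : ℕ → β → Option β
  | 0, b => some b
  | m + 1, b => (g b).bind (partialIter g m)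

namespace Crystal

variable {β γ : Type}

/-- `ε_i(b) = max {m | e_i^m b ≠ 0}`. -/
noncomputable def eps (C : Crystal β) (i : ℕ) (b : β) : ℕ :=
  sSup {m | partialIter (C.e i) m b ≠ none}

/-- `φ_i(b) = max {m | f_i^m b ≠ 0}`. -/
noncomputable def phi (C : Crystal β) (i : ℕ) (b : β) : ℕ :=
  sSup {m | partialIter (C.f i) m b ≠ none}

/-- `e_a = e_{a_m} ⋯ e_{a_2} e_{a_1}` for a word `a = a_1 a_2 ⋯ a_m`: the first letter acts first. -/
def eWord (C : Crystal β) : List ℕ → β → Option β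
  | [], b => some b
  | i :: a, b => (C.e i b).bind (C.eWord a)

/-- The tensor product of two crystals. -/
noncomputable def tensor (C : Crystal β) (D : Crystal γ) : Crystal (β × γ) where
  elts := C.elts ×ˢ D.elts
  e i b :=
    if D.eps i b.2 ≤ C.phi i b.1 then (C.e i b.1).map (fun c => (c, b.2))
    else (D.e i b.2).map (fun c => (b.1, c))
  f i b :=
    if D.eps i b.2 < C.phi i b.1 then (C.f i b.1).map (fun c => (c, b.2))
    else (D.f i b.2).map (fun c => (b.1, c))

end Crystal

/-! ### The vector representation and words -/

/-- The affine types `D_n^{(1)}`, `B_n^{(1)}`, `A_{2n-1}^{(2)}`; the underlying classical types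
are `D_n`, `B_n`, `C_n`. -/
inductive KRType
  | typeD
  | typeB
  | typeA
  deriving DecidableEq

/-- Letters: `pos i` is `i`, `neg i` is `i` with a bar, `zero` is `0`. -/
inductive KRLetter
  | pos (i : ℕ)
  | zero
  | neg (i : ℕ)
  deriving DecidableEq

namespace KR

open KRLetter

/-- The letters of the vector representation `B(Λ_1)` of rank `n`. -/
def IsLetter (X : KRType) (n : ℕ) : KRLetter → Prop
  | pos i => 1 ≤ i ∧ i ≤ n
  | zero => X = KRType.typeB
  | neg i => 1 ≤ i ∧ i ≤ n

/-- `e_i` on `B(Λ_1)`, for `1 ≤ i ≤ n`. -/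
def eLetter (X : KRType) (n i : ℕ) (a : KRLetter) : Option KRLetter :=
  if 1 ≤ i ∧ i < n then
    if a = pos (i + 1) then some (pos i)
    else if a = neg i then some (neg (i + 1))
    else none
  else if i = n then
    match X with
    | KRType.typeA => if a = neg n then some (pos n) else none
    | KRType.typeB =>
        if a = neg n then some zero else if a = zero then some (pos n) else none
    | KRType.typeD =>
        if a = neg n then some (pos (n - 1))
        else if a = neg (n - 1) then some (pos n) else none
  else none

/-- `f_i` on `B(Λ_1)`, for `1 ≤ i ≤ n`. -/
def fLetter (X : KRType) (n i : ℕ) (a : KRLetter) : Option KRLetter :=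
  if 1 ≤ i ∧ i < n then
    if a = pos i then some (pos (i + 1))
    else if a = neg (i + 1) then some (neg i)
    else none
  else if i = n then
    match X with
    | KRType.typeA => if a = pos n then some (neg n) else none
    | KRType.typeB =>
        if a = pos n then some zero else if a = zero then some (neg n) else none
    | KRType.typeD =>
        if a = pos (n - 1) then some (neg n)
        else if a = pos n then some (neg (n - 1)) else none
  else none

/-- `ε_i` on `B(Λ_1)`; the `i`-strings of `B(Λ_1)` have length at most `2`. -/
def epsLetter (X : KRType) (n i : ℕ) (a : KRLetter) : ℕ :=
  match eLetter X n i a with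
  | none => 0
  | some b => if (eLetter X n i b).isSome then 2 else 1

/-- `φ_i` on `B(Λ_1)`. -/
def phiLetter (X : KRType) (n i : ℕ) (a : KRLetter) : ℕ :=
  match fLetter X n i a with
  | none => 0
  | some b => if (fLetter X n i b).isSome then 2 else 1

/-- `ε_i` on `B(Λ_1)^{⊗ N}`, by `ε_i(a ⊗ w) = ε_i(a) + max(ε_i(w) - φ_i(a), 0)`. -/
def epsWord (X : KRType) (n i : ℕ) : List KRLetter → ℕ
  | [] => 0
  | a :: w => epsLetter X n i a + (epsWord X n i w - phiLetter X n i a)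

/-- `e_i` on `B(Λ_1)^{⊗ N}`: the tensor product rule for `a ⊗ w`. -/
def eWd (X : KRType) (n i : ℕ) : List KRLetter → Option (List KRLetter)
  | [] => none
  | a :: w =>
    if epsWord X n i w ≤ phiLetter X n i a then (eLetter X n i a).map (fun b => b :: w)
    else (eWd X n i w).map (fun v => a :: v)

/-- `f_i` on `B(Λ_1)^{⊗ N}`: the tensor product rule for `a ⊗ w`. -/
def fWd (X : KRType) (n i : ℕ) : List KRLetter → Option (List KRLetter)
  | [] => none
  | a :: w =>
    if epsWord X n i w < phiLetter X n i a then (fLetter X n i a).map (fun b => b :: w)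
    else (fWd X n i w).map (fun v => a :: v)

/-! ### Tableaux and the classical crystals `B(Λ)` -/

/-- A tableau, stored as its Japanese reading word (columns from right to left, each from bottom to
top) together with the list of the column heights in the same order. -/
structure Tab where
  heights : List ℕ
  word : List KRLetter

/-- `e_i`, `i ≥ 1`, on tableaux. -/
def eTab (X : KRType) (n i : ℕ) (T : Tab) : Option Tab :=
  (eWd X n i T.word).map (fun w => ⟨T.heights, w⟩)

/-- `f_i`, `i ≥ 1`, on tableaux. -/
def fTab (X : KRType) (n i : ℕ) (T : Tab) : Option Tab :=
  (fWd X n i T.word).map (fun w => ⟨T.heights, w⟩)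

/-- The string `a, a + 1, …, b` of unbarred letters (empty if `b < a`). -/
def seg (a b : ℕ) : List KRLetter := (List.range' a (b + 1 - a)).map pos

/-- `IsWeight r k μ`: the weight `∑ μ_i Λ_i` is obtained from `k Λ_r` by removing vertical dominoes.
Its Young diagram has `μ_i` columns of height `i`; here `μ_0` counts the columns that
have become empty, so that there are `k` columns altogether. -/
def IsWeight (r k : ℕ) (μ : ℕ → ℕ) : Prop :=
  (∀ i, μ i ≠ 0 → i ≤ r ∧ i % 2 = r % 2) ∧ ∑ i ∈ Finset.range (r + 1), μ i = k

/-- The highest weight tableau of weight `∑_{i ≤ r} μ_i Λ_i`: all columns are `1 2 ⋯ h`. -/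
def highestTab (r : ℕ) (μ : ℕ → ℕ) : Tab where
  heights := (List.range (r + 1)).flatMap (fun i => List.replicate (μ i) i)
  word := ((List.range (r + 1)).flatMap (fun i => List.replicate (μ i) i)).flatMap (seg 1)

/-- Two tableaux joined by an arrow of the classical crystal graph. -/
def Arrow (X : KRType) (n : ℕ) (T T' : Tab) : Prop :=
  ∃ i, 1 ≤ i ∧ i ≤ n ∧ (eTab X n i T = some T' ∨ fTab X n i T = some T')

/-- The crystal `B(Λ)`, `Λ = ∑ μ_i Λ_i` without spin weights, realized in `B(Λ_1)^{⊗ N}` by the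
reading of Kashiwara--Nakashima tableaux: the connected component of the highest weight tableau. -/
def classical (X : KRType) (n r : ℕ) (μ : ℕ → ℕ) : Set Tab :=
  {T | Relation.ReflTransGen (Arrow X n) (highestTab r μ) T}

/-! ### `±`-diagrams -/

/-- What a column of the outer shape of a `±`-diagram contains: nothing, `+`, `-`, or both
(`-` above `+`). -/
inductive Sign
  | dot
  | plus
  | minus
  | both
  deriving DecidableEq

/-- A `±`-diagram all of whose outer columns have heights of the same parity, given by the numbers
`p_i^*` of the columns of outer height `i` that contain `*`. For such heights the horizontal strip
conditions amount to the columns of each outer height being ordered, from left to right, as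
empty, `+`, `-`, both; hence the numbers `p_i^*` are arbitrary and determine the diagram. -/
abbrev Diagram := ℕ → Sign → ℕ

/-- The `±`-diagrams whose outer shape is obtained from `k Λ_r` by removing vertical dominoes
(`p_0^·` counts the empty columns). In type `C_n` the inner shape has no column of height `n`. -/
def IsDiagram (X : KRType) (n r k : ℕ) (p : Diagram) : Prop :=
  (∀ i s, p i s ≠ 0 → i ≤ r ∧ i % 2 = r % 2) ∧
  (∀ s, s ≠ Sign.dot → p 0 s = 0) ∧
  p 1 Sign.both = 0 ∧
  (X = KRType.typeA → p n Sign.dot = 0) ∧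
  ∑ i ∈ Finset.range (r + 1), (p i Sign.dot + p i Sign.plus + p i Sign.minus + p i Sign.both) = k

/-- The columns of a `±`-diagram from left to right: outer height and contents. -/
def diagramColumns (r : ℕ) (p : Diagram) : List (ℕ × Sign) :=
  (List.range (r + 1)).reverse.flatMap (fun i =>
    List.replicate (p i Sign.dot) (i, Sign.dot) ++
    List.replicate (p i Sign.plus) (i, Sign.plus) ++
    List.replicate (p i Sign.minus) (i, Sign.minus) ++
    List.replicate (p i Sign.both) (i, Sign.both))

/-- The height of the `+` of a column, if there is one at a height different from `n`. -/
def plusHeight (n : ℕ) : ℕ × Sign → Option ℕ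
  | (i, Sign.plus) => if i = n then none else some i
  | (i, Sign.both) => some (i - 1)
  | _ => none

/-- A `1` with a bar, met while the `+` at heights `hs` are still to be used: it is changed to `h + 1`
with a bar by the next `+`, at height `h`. Returns the cell and the remaining heights. -/
def fillBar : List ℕ → List KRLetter × List ℕ
  | [] => ([neg 1], [])
  | h :: hs => ([neg (h + 1)], hs)

/-- A string `2 3 ⋯ (m + 1)` of `m` cells, met while the `+` at heights `hs` are still to be used: if it is
not empty, it is changed to `1 2 ⋯ h, h + 2, …, m + 1` by the next `+`, at height `h`. -/
def fillString (m : ℕ) (hs : List ℕ) : List KRLetter × List ℕ :=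
  if m = 0 then ([], hs)
  else match hs with
    | [] => (seg 2 (m + 1), [])
    | h :: hs => (seg 1 h ++ seg (h + 2) (m + 1), hs)

/-- The columns, from left to right and each from bottom to top, of the tableau of a `±`-diagram;
the columns are scanned from left to right and from top to bottom. -/
def fillColumns (n : ℕ) : List (ℕ × Sign) → List ℕ → List (List KRLetter)
  | [], _ => []
  | (i, s) :: cs, hs =>
    match s with
    | Sign.dot => (fillString i hs).1 :: fillColumns n cs (fillString i hs).2
    | Sign.plus =>
        if i = n then seg 1 n :: fillColumns n cs hs
        else (fillString i hs).1 :: fillColumns n cs (fillString i hs).2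
    | _ =>
        ((fillString (i - 1) (fillBar hs).2).1 ++ (fillBar hs).1) ::
          fillColumns n cs (fillString (i - 1) (fillBar hs).2).2

/-- The map `Φ` from `±`-diagrams to `{2, …, n}`-highest tableaux. -/
def diagramTab (n r : ℕ) (p : Diagram) : Tab :=
  let cols := (fillColumns n (diagramColumns r p)
    ((diagramColumns r p).filterMap (plusHeight n))).reverse
  ⟨cols.map List.length, cols.flatten⟩

/-- The involution `𝔖` on `±`-diagrams. A column with `+` and one with `-`, of inner
height `i - 1` and outer height `i`, are interchanged; above the columns of inner height `i < r`,
`i ≡ r` mod `2`, the numbers `p_i^·` of no sign and `p_{i+2}^{∓}` of both signs are interchanged. -/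
def swapDiagram (r : ℕ) (p : Diagram) : Diagram := fun i s =>
  match s with
  | Sign.dot => if i < r then p (i + 2) Sign.both else p i Sign.dot
  | Sign.plus => p i Sign.minus
  | Sign.minus => p i Sign.plus
  | Sign.both => if 2 ≤ i then p (i - 2) Sign.dot else 0

/-! ### The Kirillov--Reshetikhin crystal `B^{r,k}` -/

/-- The nodes `i, i + 1, …, n`. -/
def nodesUp (n i : ℕ) : List ℕ := List.range' i (n + 1 - i)

/-- The nodes `m, m - 1, …, i`, where `m = n - 2` for type `D` and `m = n - 1` otherwise. -/
def nodesDown (X : KRType) (n i : ℕ) : List ℕ :=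
  match X with
  | KRType.typeD => (List.range' i (n - 1 - i)).reverse
  | _ => (List.range' i (n - i)).reverse

/-- A reduced word for the longest element of the Weyl group of the nodes `2, …, n`: the words
`i, …, n, …, i` for `i = n, n - 1, …, 2`. Applying, in this order, each `e_j` as often as possible
brings any element to a `{2, …, n}`-highest element. -/
def raisingWord (X : KRType) (n : ℕ) : List ℕ :=
  (List.range' 2 (n - 1)).reverse.flatMap (fun i => nodesUp n i ++ nodesDown X n i)

open Classical in
/-- `σ = Φ ∘ 𝔖 ∘ Φ⁻¹` on `{2, …, n}`-highest elements. -/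
noncomputable def sigmaHighest (X : KRType) (n r k : ℕ) (T : Tab) : Option Tab :=
  if h : ∃ p, IsDiagram X n r k p ∧ diagramTab n r p = T then
    some (diagramTab n r (swapDiagram r h.choose))
  else none

/-- `f_{Rev(a)} ∘ Φ ∘ 𝔖 ∘ Φ⁻¹ ∘ e_a` for the word `a = j_1^{m_1} j_2^{m_2} ⋯` where `j_1, j_2, …`
is the given list and each exponent is the largest possible. -/
noncomputable def sigmaAlong (X : KRType) (n r k : ℕ) : List ℕ → Tab → Option Tab
  | [], T => sigmaHighest X n r k T
  | j :: js, T =>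
    ((partialIter (eTab X n j) (epsWord X n j T.word) T).bind (sigmaAlong X n r k js)).bind
      (partialIter (fTab X n j) (epsWord X n j T.word))

/-- The involution `σ` of `B^{r,k}` that corresponds to interchanging the nodes `0` and `1`. -/
noncomputable def sigma (X : KRType) (n r k : ℕ) (T : Tab) : Option Tab :=
  sigmaAlong X n r k (raisingWord X n) T

/-- The KR crystal `B^{r,k}`: the union of the `B(Λ)` for the `Λ` obtained from `k Λ_r` by removing
vertical dominoes, with `e_0 = σ e_1 σ` and `f_0 = σ f_1 σ`. -/
noncomputable def crystal (X : KRType) (n r k : ℕ) : Crystal Tab where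
  elts := {T | ∃ μ, IsWeight r k μ ∧ T ∈ classical X n r μ}
  e i T :=
    if i = 0 then ((sigma X n r k T).bind (eTab X n 1)).bind (sigma X n r k) else eTab X n i T
  f i T :=
    if i = 0 then ((sigma X n r k T).bind (fTab X n 1)).bind (sigma X n r k) else fTab X n i T

/-! ### The crystal `B^{1,l}` in coordinates -/

/-- Coordinates `x_i = x (pos i)`, `x_0 = x zero`, and `x (neg i)` for `x_i` with a bar. -/
abbrev Coord := KRLetter → ℕ

/-- The Japanese reading word `1̄ ⋯ 1̄ 2̄ ⋯ 2̄ ⋯ 2 ⋯ 2 1 ⋯ 1` of the one-row tableau with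
coordinates `x`. -/
def rowWord (n : ℕ) (x : Coord) : List KRLetter :=
  (List.range' 1 n).flatMap (fun i => List.replicate (x (neg i)) (neg i)) ++
  List.replicate (x zero) zero ++
  (List.range' 1 n).reverse.flatMap (fun i => List.replicate (x (pos i)) (pos i))

/-- The coordinates of a one-row tableau with the given reading word. -/
def coordOf (w : List KRLetter) : Coord := fun a => w.count a

/-- The coordinates of the elements of `B^{1,l}`. -/
def IsRow (X : KRType) (n l : ℕ) (x : Coord) : Prop :=
  (∀ a, x a ≠ 0 → IsLetter X n a) ∧
  ∑ i ∈ Finset.Icc 1 n, (x (pos i) + x (neg i)) + x zero = l ∧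
  x zero ≤ 1 ∧
  (X = KRType.typeD → x (pos n) = 0 ∨ x (neg n) = 0)

/-- Move one unit from coordinate `a` to coordinate `b`; `none` if `x a = 0`. -/
def moveUnit (x : Coord) (a b : KRLetter) : Option Coord :=
  if x a = 0 then none
  else some (fun c => if c = a then x c - 1 else if c = b then x c + 1 else x c)

/-- The KR crystal `B^{1,l}` in the coordinate representation. -/
def rowCrystal (X : KRType) (n l : ℕ) : Crystal Coord where
  elts := {x | IsRow X n l x}
  e i x :=
    if i = 0 then
      if x (neg 2) < x (pos 2) then moveUnit x (pos 2) (neg 1) else moveUnit x (pos 1) (neg 2)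
    else (eWd X n i (rowWord n x)).map coordOf
  f i x :=
    if i = 0 then
      if x (neg 2) ≤ x (pos 2) then moveUnit x (neg 1) (pos 2) else moveUnit x (neg 2) (pos 1)
    else (fWd X n i (rowWord n x)).map coordOf

/-! ### The explicit word -/

/-- `∑ g_j` over the odd `j` with `a ≤ j ≤ b`. -/
def oddSum (g : ℕ → ℕ) (a b : ℕ) : ℕ := ∑ j ∈ (Finset.Icc a b).filter (fun j => j % 2 = 1), g j

/-- `α = k + x_1 + x̄_3 + x̄_5 + ⋯ + x̄_r`. -/
def expAlpha (r k : ℕ) (x : Coord) : ℕ := k + x (pos 1) + oddSum (fun j => x (neg j)) 3 r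

/-- The exponents `s_j`: `s_{2i-1} = 2k - (μ_1 + μ_3 + ⋯ + μ_{2i-1}) + x_1 + x_{2i} +
(x̄_3 + x̄_5 + ⋯ + x̄_{2i-1})` and `s_{2i} = s_{2i-1} - x_{2i}`. -/
def expS (k : ℕ) (μ : ℕ → ℕ) (x : Coord) (j : ℕ) : ℕ :=
  if j % 2 = 1 then
    2 * k + x (pos 1) + x (pos (j + 1)) + oddSum (fun t => x (neg t)) 3 j - oddSum μ 1 j
  else
    2 * k + x (pos 1) + oddSum (fun t => x (neg t)) 3 (j - 1) - oddSum μ 1 (j - 1)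

/-- The exponents `s̄_{2i} = s̄_{2i-1} = α + (x_{2i+1} + ⋯ + x_{r+1}) - (μ_{2i+1} + μ_{2i+3} + ⋯ + μ_r)`;
for `j = 2i` and for `j = 2i - 1`, `i` is `(j + 1) / 2`. -/
def expS1 (r k : ℕ) (μ : ℕ → ℕ) (x : Coord) (j : ℕ) : ℕ :=
  expAlpha r k x + ∑ t ∈ Finset.Icc (2 * ((j + 1) / 2) + 1) (r + 1), x (pos t)
    - oddSum μ (2 * ((j + 1) / 2) + 1) r

/-- The exponents with two bars: `2k + l - μ_1` for `j = 1`, and otherwise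
`2k - (μ_1 + μ_3 + ⋯ + μ_{2i-1})` for `j = 2i` and for `j = 2i - 1`. -/
def expS2 (k l : ℕ) (μ : ℕ → ℕ) (j : ℕ) : ℕ :=
  if j = 1 then 2 * k + l - μ 1 else 2 * k - oddSum μ 1 (2 * ((j + 1) / 2) - 1)

/-- The exponents with three bars: `0` for `j = 1`, `x_2 + x̄_1` for `j = 2`, and otherwise
`k - (μ_{2i+1} + μ_{2i+3} + ⋯ + μ_r)` for `j = 2i` and for `j = 2i - 1`. -/
def expS3 (r k : ℕ) (μ : ℕ → ℕ) (x : Coord) (j : ℕ) : ℕ :=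
  if j = 1 then 0
  else if j = 2 then x (pos 2) + x (neg 1)
  else k - oddSum μ (2 * ((j + 1) / 2) + 1) r

/-- The word `j_1^{g(j_1)} j_2^{g(j_2)} ⋯`. -/
def powerWord (js : List ℕ) (g : ℕ → ℕ) : List ℕ := js.flatMap (fun j => List.replicate (g j) j)

/-- The word `i^m (i+1)^m ⋯ n^m`, with `n^{2m}` in place of `n^m` for type `B`. -/
def ascending (X : KRType) (n i m : ℕ) : List ℕ :=
  powerWord (nodesUp n i) (fun j => if X = KRType.typeB ∧ j = n then 2 * m else m)

/-- The word `(n-1)^m (n-2)^m ⋯ i^m`, starting with `(n-2)^m` for type `D`. -/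
def descending (X : KRType) (n i m : ℕ) : List ℕ := powerWord (nodesDown X n i) (fun _ => m)

/-- The word `b_{1,1}`. -/
def wordB11 (X : KRType) (n r k : ℕ) (μ : ℕ → ℕ) (x : Coord) : List ℕ :=
  powerWord (List.range' 2 (r - 1)) (expS k μ x) ++
  ascending X n (r + 1) (expAlpha r k x) ++ descending X n r (expAlpha r k x) ++
  powerWord (List.range' 2 (r - 2)).reverse (expS1 r k μ x)

/-- The word `b_{1,2}`. -/
def wordB12 (X : KRType) (n r k l : ℕ) (μ : ℕ → ℕ) (x : Coord) : List ℕ :=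
  powerWord (List.range' 1 (r - 1)) (expS2 k l μ) ++
  ascending X n r k ++ descending X n r k ++
  powerWord (List.range' 1 (r - 1)).reverse (expS3 r k μ x)

/-- The word `b_1 = b_{1,1} b_{1,2}`. -/
def wordB1 (X : KRType) (n r k l : ℕ) (μ : ℕ → ℕ) (x : Coord) : List ℕ :=
  wordB11 X n r k μ x ++ wordB12 X n r k l μ x

/-- `μ̄`: the columns of height `1` of `μ` are replaced by columns of height `3`. -/
def barWeight (μ : ℕ → ℕ) : ℕ → ℕ :=
  fun i => if i = 1 then 0 else if i = 3 then μ 3 + μ 1 else μ i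

/-- The coordinates of the row with `m` letters `3̄` and `l - m` letters `1`. -/
def targetRow (l m : ℕ) : Coord :=
  fun a => if a = neg 3 then m else if a = pos 1 then l - m else 0

/-- The range of `r` for which `B^{r,k}` is considered in rank `n`. -/
def InRange (X : KRType) (n r : ℕ) : Prop :=
  match X with
  | KRType.typeD => r + 2 ≤ n
  | KRType.typeB => r + 1 ≤ n
  | KRType.typeA => r ≤ n

end KR

/-!
The exponents of the word are such that each letter `i` acts as often as possible on one or both of
the tensor factors, so that the two factors can be followed separately: if `φ_i` of the left factor
vanishes, then `e_i` exhausts the right factor first and the left one afterwards (`tensor_iter`), and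
if `ε_i` of the right factor is at most `φ_i` of the left one, then only the left one moves
(`tensor_iter_left`).

For the row everything happens in coordinates. The condition that `μ ⊗ x` is highest bounds
the `ε_i(x)` by the multiplicities of `μ` (`row_bounds`); hence `x` has no letters `0`, no
`j` with a bar for `j` even or `j > r`, no letters above `r + 1`, and `x_j ≤ x̄_j` for `j ≥ 3` odd
(`HighestRow`). With this, `e_0` and then the nodes `2, …, n, …, 2` make of it a row of letters `2` and
`x_2 + x̄_1` letters `1` with a bar (`rowRaises_up`, `rowRaises_down`).

For the tableau the difficulty is the operator `e_0 = σ e_1 σ`. Let `G` be the heights at least `3`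
of the columns of `μ` and `m = μ_1`. The elements `e_1^j σ(μ)` and `e_0^j μ` are written down
for all `j`, as `sWord` and `rWord`. Both are raised to `{2, …, n}`-highest elements along the same path
`2, …, n, …, 2` with the same exponents (`raises_sWord`, `raises_rWord`), and there the two words are
the images under `Φ` of `±`-diagrams which are exchanged by `𝔖` (`sigmaHighest_sTop`,
`sigmaHighest_rTop`); since `Φ` is injective (`sigmaHighest_columnsTab`), the involution `σ` exchanges
the two elements (`sigma_sWord`, `sigma_rWord`). So `e_0^{2k-m} μ` is known (`exists_zeroString`). Along the path
`2, …, n, …, 2` all `φ_i` of the words which lead from it vanish; at the end there remain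
the columns `kWord` over the heights `G` and `m` times `3` (`raises_endTab`). In the second half of
the word, `e_1` and `e_2` bring all barred letters and holes of these columns to `3` one
by one (`iter_one`, `iter_two`), and the nodes `3, …, n, …, 3` take the barred letters through `n` into
the holes (`raises_columns`), which yields the highest weight tableau.

Words are read so that the columns come from right to left. That `e_i` can be applied to a word exactly
`m` times, with a given result, is recorded together with the value of `φ_i` by the predicate `Raise`,
which is compatible with concatenation.
-/

namespace KR

open KRLetter

/-! ### Signature rule on words -/

/-- `φ_i` on `B(Λ_1)^{⊗ N}`, by `φ_i(a ⊗ w) = φ_i(w) + max(φ_i(a) - ε_i(w), 0)`. -/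
def phiWord (X : KRType) (n i : ℕ) : List KRLetter → ℕ
  | [] => 0
  | a :: w => phiWord X n i w + (phiLetter X n i a - epsWord X n i w)

theorem partialIter_add {β : Type} (g : β → Option β) (s t : ℕ) (b : β) :
    partialIter g (s + t) b = (partialIter g s b).bind (partialIter g t) := by
  induction s generalizing b with
  | zero => simp [partialIter]
  | succ s ih =>
    rw [Nat.succ_add]
    cases h : g b with
    | none => simp [partialIter, h]
    | some c => simp [partialIter, h, ih]

theorem partialIter_succ' {β : Type} (g : β → Option β) (s : ℕ) (b : β) :
    partialIter g (s + 1) b = (partialIter g s b).bind g := by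
  rw [partialIter_add]
  congr 1
  funext c
  cases h : g c <;> simp [partialIter, h]

section Letters

variable {X : KRType} {n i : ℕ} {a b : KRLetter}

theorem fLetter_of_eLetter (hi : 1 ≤ i) (h : eLetter X n i a = some b) :
    fLetter X n i b = some a := by
  unfold eLetter at h
  unfold fLetter
  cases X <;> grind

theorem eLetter_of_fLetter (hi : 1 ≤ i) (h : fLetter X n i a = some b) :
    eLetter X n i b = some a := by
  unfold fLetter at h
  unfold eLetter
  cases X <;> grind

theorem epsLetter_eq_zero : epsLetter X n i a = 0 ↔ eLetter X n i a = none := by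
  unfold epsLetter
  cases h : eLetter X n i a with
  | none => simp
  | some b => simp only [reduceCtorEq, iff_false]; split_ifs <;> simp

theorem phiLetter_eq_zero : phiLetter X n i a = 0 ↔ fLetter X n i a = none := by
  unfold phiLetter
  cases h : fLetter X n i a with
  | none => simp
  | some b => simp only [reduceCtorEq, iff_false]; split_ifs <;> simp

/-- The `i`-strings of the vector representation have length at most two. -/
theorem eLetter_eLetter_eLetter (hi : 1 ≤ i) (h : eLetter X n i a = some b) {c : KRLetter}
    (h' : eLetter X n i b = some c) : eLetter X n i c = none := by
  unfold eLetter at *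
  cases X <;> grind

theorem fLetter_fLetter_fLetter (hi : 1 ≤ i) (h : fLetter X n i a = some b) {c : KRLetter}
    (h' : fLetter X n i b = some c) : fLetter X n i c = none := by
  unfold fLetter at *
  cases X <;> grind

theorem epsLetter_of_eLetter (hi : 1 ≤ i) (h : eLetter X n i a = some b) :
    epsLetter X n i a = epsLetter X n i b + 1 := by
  unfold epsLetter
  rw [h]
  cases h' : eLetter X n i b with
  | none => simp [h']
  | some c => simp [h', eLetter_eLetter_eLetter hi h h']

theorem phiLetter_of_fLetter (hi : 1 ≤ i) (h : fLetter X n i a = some b) :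
    phiLetter X n i a = phiLetter X n i b + 1 := by
  unfold phiLetter
  rw [h]
  cases h' : fLetter X n i b with
  | none => simp [h']
  | some c => simp [h', fLetter_fLetter_fLetter hi h h']

theorem phiLetter_of_eLetter (hi : 1 ≤ i) (h : eLetter X n i a = some b) :
    phiLetter X n i b = phiLetter X n i a + 1 :=
  phiLetter_of_fLetter hi (fLetter_of_eLetter hi h)

theorem epsLetter_of_fLetter (hi : 1 ≤ i) (h : fLetter X n i a = some b) :
    epsLetter X n i b = epsLetter X n i a + 1 :=
  epsLetter_of_eLetter hi (eLetter_of_fLetter hi h)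

end Letters

section Words

variable {X : KRType} {n i : ℕ}

theorem epsWord_append (u v : List KRLetter) :
    epsWord X n i (u ++ v) = epsWord X n i u + (epsWord X n i v - phiWord X n i u) := by
  induction u with
  | nil => simp [epsWord, phiWord]
  | cons a u ih => simp only [List.cons_append, epsWord, phiWord, ih]; omega

theorem phiWord_append (u v : List KRLetter) :
    phiWord X n i (u ++ v) = phiWord X n i v + (phiWord X n i u - epsWord X n i v) := by
  induction u with
  | nil => simp [phiWord]
  | cons a u ih => simp only [List.cons_append, phiWord, ih, epsWord_append]; omega

theorem eWd_of_epsWord {v : List KRLetter} (h : epsWord X n i v = 0) : eWd X n i v = none := by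
  induction v with
  | nil => rfl
  | cons a v ih =>
    simp only [epsWord] at h
    have h1 : epsLetter X n i a = 0 := by omega
    rw [epsLetter_eq_zero] at h1
    by_cases hc : epsWord X n i v ≤ phiLetter X n i a
    · simp [eWd, hc, h1]
    · omega

theorem eWd_append (u v : List KRLetter) :
    eWd X n i (u ++ v) =
      if epsWord X n i v ≤ phiWord X n i u then (eWd X n i u).map (fun w => w ++ v)
      else (eWd X n i v).map (fun w => u ++ w) := by
  induction u with
  | nil =>
    by_cases h : epsWord X n i v = 0
    · simp [phiWord, h, eWd_of_epsWord h, eWd]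
    · simp [phiWord, h]
  | cons a u ih =>
    have hp : phiWord X n i (a :: u) =
      phiWord X n i u + (phiLetter X n i a - epsWord X n i u) := rfl
    simp only [List.cons_append, eWd, epsWord_append, ih]
    by_cases h1 : epsWord X n i u ≤ phiLetter X n i a <;>
    by_cases h2 : epsWord X n i v ≤ phiWord X n i u <;>
    by_cases h3 : epsWord X n i v ≤ phiWord X n i (a :: u) <;>
    by_cases h4 : epsWord X n i u + (epsWord X n i v - phiWord X n i u) ≤ phiLetter X n i a <;>
    first
    | omega
    | simp [h1, h2, h3, h4, Option.map_map, Function.comp_def]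

theorem epsWord_eWd (hi : 1 ≤ i) {u v : List KRLetter} (h : eWd X n i u = some v) :
    epsWord X n i u = epsWord X n i v + 1 ∧ phiWord X n i v = phiWord X n i u + 1 ∧
      fWd X n i v = some u := by
  induction u generalizing v with
  | nil => simp [eWd] at h
  | cons a u ih =>
    simp only [eWd] at h
    split_ifs at h with hc
    · rw [Option.map_eq_some_iff] at h
      obtain ⟨b, hb, rfl⟩ := h
      have h1 := epsLetter_of_eLetter hi hb
      have h2 := phiLetter_of_eLetter hi hb
      have h3 := fLetter_of_eLetter hi hb
      refine ⟨by simp only [epsWord]; omega, by simp only [phiWord]; omega, ?_⟩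
      simp only [fWd]
      rw [if_pos (by omega), h3]
      rfl
    · rw [Option.map_eq_some_iff] at h
      obtain ⟨w, hw, rfl⟩ := h
      obtain ⟨h1, h2, h3⟩ := ih hw
      refine ⟨by simp only [epsWord]; omega, by simp only [phiWord]; omega, ?_⟩
      simp only [fWd]
      rw [if_neg (by omega), h3]
      rfl

theorem epsWord_fWd (hi : 1 ≤ i) {u v : List KRLetter} (h : fWd X n i u = some v) :
    epsWord X n i v = epsWord X n i u + 1 ∧ phiWord X n i u = phiWord X n i v + 1 := by
  induction u generalizing v with
  | nil => simp [fWd] at h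
  | cons a u ih =>
    simp only [fWd] at h
    split_ifs at h with hc
    · rw [Option.map_eq_some_iff] at h
      obtain ⟨b, hb, rfl⟩ := h
      have h1 := epsLetter_of_fLetter hi hb
      have h2 := phiLetter_of_fLetter hi hb
      exact ⟨by simp only [epsWord]; omega, by simp only [phiWord]; omega⟩
    · rw [Option.map_eq_some_iff] at h
      obtain ⟨w, hw, rfl⟩ := h
      obtain ⟨h1, h2⟩ := ih hw
      exact ⟨by simp only [epsWord]; omega, by simp only [phiWord]; omega⟩

theorem eWd_eq_none (hi : 1 ≤ i) (u : List KRLetter) :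
    eWd X n i u = none ↔ epsWord X n i u = 0 := by
  constructor
  · intro h
    induction u with
    | nil => rfl
    | cons a u ih =>
      simp only [eWd] at h
      split_ifs at h with hc
      · rw [Option.map_eq_none_iff, ← epsLetter_eq_zero] at h
        simp only [epsWord]; omega
      · rw [Option.map_eq_none_iff] at h
        have := ih h
        omega
  · intro h
    cases h' : eWd X n i u with
    | none => rfl
    | some v => have := (epsWord_eWd hi h').1; omega

theorem fWd_eq_none (hi : 1 ≤ i) (u : List KRLetter) :
    fWd X n i u = none ↔ phiWord X n i u = 0 := by
  constructor
  · intro h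
    induction u with
    | nil => rfl
    | cons a u ih =>
      simp only [fWd] at h
      split_ifs at h with hc
      · rw [Option.map_eq_none_iff, ← phiLetter_eq_zero] at h
        omega
      · rw [Option.map_eq_none_iff] at h
        have := ih h
        simp only [phiWord]
        omega
  · intro h
    cases h' : fWd X n i u with
    | none => rfl
    | some v => have := (epsWord_fWd hi h').2; omega

theorem partialIter_eWd (hi : 1 ≤ i) {m : ℕ} {u v : List KRLetter}
    (h : partialIter (eWd X n i) m u = some v) :
    epsWord X n i u = epsWord X n i v + m ∧ phiWord X n i v = phiWord X n i u + m ∧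
      partialIter (fWd X n i) m v = some u := by
  induction m generalizing u with
  | zero =>
    simp only [partialIter, Option.some.injEq] at h
    subst h
    simp [partialIter]
  | succ m ih =>
    simp only [partialIter, Option.bind_eq_some_iff] at h
    obtain ⟨w, hw, h⟩ := h
    obtain ⟨h1, h2, h3⟩ := ih h
    obtain ⟨h4, h5, h6⟩ := epsWord_eWd hi hw
    refine ⟨by omega, by omega, ?_⟩
    rw [partialIter_succ', h3]
    exact h6

/-- `e_i^m` on `u ⊗ v` acts on the right factor as long as `ε_i` of it exceeds `φ_i(u)`. -/
theorem partialIter_eWd_append_right (hi : 1 ≤ i) (u : List KRLetter) {m : ℕ}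
    {v v' : List KRLetter} (h : partialIter (eWd X n i) m v = some v')
    (hm : phiWord X n i u + m ≤ epsWord X n i v) :
    partialIter (eWd X n i) m (u ++ v) = some (u ++ v') := by
  induction m generalizing v with
  | zero => simp_all [partialIter]
  | succ m ih =>
    simp only [partialIter, Option.bind_eq_some_iff] at h ⊢
    obtain ⟨w, hw, h⟩ := h
    have := (epsWord_eWd hi hw).1
    refine ⟨u ++ w, ?_, ih h (by omega)⟩
    rw [eWd_append, if_neg (by omega), hw]
    rfl

/-- `e_i^m` on `u ⊗ v` acts on the left factor once `ε_i(v) ≤ φ_i(u)`. -/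
theorem partialIter_eWd_append_left (hi : 1 ≤ i) (v : List KRLetter) {m : ℕ}
    {u u' : List KRLetter} (h : partialIter (eWd X n i) m u = some u')
    (hm : epsWord X n i v ≤ phiWord X n i u) :
    partialIter (eWd X n i) m (u ++ v) = some (u' ++ v) := by
  induction m generalizing u with
  | zero => simp_all [partialIter]
  | succ m ih =>
    simp only [partialIter, Option.bind_eq_some_iff] at h ⊢
    obtain ⟨w, hw, h⟩ := h
    have := (epsWord_eWd hi hw).2.1
    refine ⟨w ++ v, ?_, ih h (by omega)⟩
    rw [eWd_append, if_pos (by omega), hw]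
    rfl

/-- `Raise X n i m p u v`: the word `v` is `e_i^m u` where `m = ε_i(u)` is the largest possible
exponent, and `p = φ_i(u)`. -/
structure Raise (X : KRType) (n i m p : ℕ) (u v : List KRLetter) : Prop where
  eps : epsWord X n i u = m
  phi : phiWord X n i u = p
  iter : partialIter (eWd X n i) m u = some v

theorem Raise.refl {p : ℕ} {u : List KRLetter} (h : epsWord X n i u = 0)
    (h' : phiWord X n i u = p) : Raise X n i 0 p u u :=
  ⟨h, h', rfl⟩

theorem Raise.nil : Raise X n i 0 0 [] [] := ⟨rfl, rfl, rfl⟩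

theorem Raise.eps_target {m p : ℕ} {u v : List KRLetter} (hi : 1 ≤ i)
    (h : Raise X n i m p u v) : epsWord X n i v = 0 := by
  have := (partialIter_eWd hi h.iter).1
  have := h.eps
  omega

/-- If `φ_i(u) = 0`, then the raisings of both factors are independent. -/
theorem Raise.append (hi : 1 ≤ i) {m m' p' : ℕ} {u u' v v' : List KRLetter}
    (h : Raise X n i m 0 u u') (h' : Raise X n i m' p' v v') :
    Raise X n i (m + m') p' (u ++ v) (u' ++ v') := by
  refine ⟨?_, ?_, ?_⟩
  · rw [epsWord_append, h.eps, h'.eps, h.phi]; omega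
  · rw [phiWord_append, h.phi, h'.phi]; omega
  · rw [Nat.add_comm, partialIter_add,
      partialIter_eWd_append_right hi u h'.iter (by rw [h.phi, h'.eps]; omega)]
    exact partialIter_eWd_append_left hi v' h.iter (by rw [h'.eps_target hi]; omega)

/-- A right factor all of whose arrows are bracketed with the left one is left unchanged. -/
theorem Raise.append_absorb (hi : 1 ≤ i) {m p q p' : ℕ} {u u' v : List KRLetter}
    (h : Raise X n i m p u u') (hv : epsWord X n i v = q) (hv' : phiWord X n i v = p')
    (hq : q ≤ p) : Raise X n i m (p' + (p - q)) (u ++ v) (u' ++ v) := by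
  refine ⟨?_, ?_, ?_⟩
  · rw [epsWord_append, h.eps, hv, h.phi]; omega
  · rw [phiWord_append, h.phi, hv, hv']
  · exact partialIter_eWd_append_left hi v h.iter (by rw [h.phi, hv]; exact hq)

theorem Raise.cast {m p m' p' : ℕ} {u v u' v' : List KRLetter} (h : Raise X n i m p u v)
    (hm : m = m') (hp : p = p') (hu : u = u') (hv : v = v') : Raise X n i m' p' u' v' := by
  subst hm hp hu hv; exact h

/-- A word none of whose letters is moved by `e_i` or `f_i`. -/
theorem inert_word {u : List KRLetter}
    (h : ∀ a ∈ u, epsLetter X n i a = 0 ∧ phiLetter X n i a = 0) :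
    epsWord X n i u = 0 ∧ phiWord X n i u = 0 := by
  induction u with
  | nil => exact ⟨rfl, rfl⟩
  | cons a u ih =>
    have h1 := h a (by simp)
    have h2 := ih (fun b hb => h b (by simp [hb]))
    simp only [epsWord, phiWord]
    omega

theorem epsWord_eq_zero_of_letters {u : List KRLetter}
    (h : ∀ a ∈ u, epsLetter X n i a = 0) : epsWord X n i u = 0 := by
  induction u with
  | nil => rfl
  | cons a u ih =>
    have h1 := h a (by simp)
    have h2 := ih (fun b hb => h b (by simp [hb]))
    simp only [epsWord]
    omega

theorem phiWord_eq_zero_of_letters {u : List KRLetter}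
    (h : ∀ a ∈ u, phiLetter X n i a = 0) : phiWord X n i u = 0 := by
  induction u with
  | nil => rfl
  | cons a u ih =>
    have h1 := h a (by simp)
    have h2 := ih (fun b hb => h b (by simp [hb]))
    simp only [phiWord]
    omega

theorem epsWord_singleton (a : KRLetter) : epsWord X n i [a] = epsLetter X n i a := by
  simp [epsWord]

theorem phiWord_singleton (a : KRLetter) : phiWord X n i [a] = phiLetter X n i a := by
  simp [phiWord, epsWord]

theorem Raise.letter {a b : KRLetter} (h : eLetter X n i a = some b)
    (h1 : epsLetter X n i a = 1) (h2 : phiLetter X n i a = 0) : Raise X n i 1 0 [a] [b] := by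
  refine ⟨by rw [epsWord_singleton, h1], by rw [phiWord_singleton, h2], ?_⟩
  simp [partialIter, eWd, epsWord, h]

end Words

/-! ### Letters -/

section LetterValues

variable {X : KRType} {n i : ℕ}

theorem eLetter_pos (h1 : 1 ≤ i) (h2 : i < n) (c : ℕ) :
    eLetter X n i (pos c) = if c = i + 1 then some (pos i) else none := by
  unfold eLetter; grind

theorem eLetter_neg (h1 : 1 ≤ i) (h2 : i < n) (c : ℕ) :
    eLetter X n i (neg c) = if c = i then some (neg (i + 1)) else none := by
  unfold eLetter; grind

theorem eLetter_zero (h1 : 1 ≤ i) (h2 : i < n) : eLetter X n i zero = none := by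
  unfold eLetter; grind

theorem fLetter_pos (h1 : 1 ≤ i) (h2 : i < n) (c : ℕ) :
    fLetter X n i (pos c) = if c = i then some (pos (i + 1)) else none := by
  unfold fLetter; grind

theorem fLetter_neg (h1 : 1 ≤ i) (h2 : i < n) (c : ℕ) :
    fLetter X n i (neg c) = if c = i + 1 then some (neg i) else none := by
  unfold fLetter; grind

theorem fLetter_zero (h1 : 1 ≤ i) (h2 : i < n) : fLetter X n i zero = none := by
  unfold fLetter; grind

/-- The values of `ε_i` and `φ_i` on the letters of absolute value at most `n` are those of
type `A`. This holds for `i < n`, and for `i = n` in type `C_n`. -/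
structure Standard (X : KRType) (n i : ℕ) : Prop where
  one_le : 1 ≤ i
  le : i ≤ n
  eps_pos : ∀ c ≤ n, epsLetter X n i (pos c) = if c = i + 1 then 1 else 0
  phi_pos : ∀ c ≤ n, phiLetter X n i (pos c) = if c = i then 1 else 0
  eps_neg : ∀ c ≤ n, epsLetter X n i (neg c) = if c = i then 1 else 0
  phi_neg : ∀ c ≤ n, phiLetter X n i (neg c) = if c = i + 1 then 1 else 0

theorem epsLetter_pos (h1 : 1 ≤ i) (h2 : i < n) (c : ℕ) :
    epsLetter X n i (pos c) = if c = i + 1 then 1 else 0 := by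
  unfold epsLetter
  rw [eLetter_pos h1 h2]
  by_cases hc : c = i + 1
  · simp [hc, eLetter_pos h1 h2]
  · simp [hc]

theorem epsLetter_neg (h1 : 1 ≤ i) (h2 : i < n) (c : ℕ) :
    epsLetter X n i (neg c) = if c = i then 1 else 0 := by
  unfold epsLetter
  rw [eLetter_neg h1 h2]
  by_cases hc : c = i
  · simp [hc, eLetter_neg h1 h2]
  · simp [hc]

theorem phiLetter_pos (h1 : 1 ≤ i) (h2 : i < n) (c : ℕ) :
    phiLetter X n i (pos c) = if c = i then 1 else 0 := by
  unfold phiLetter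
  rw [fLetter_pos h1 h2]
  by_cases hc : c = i
  · simp [hc, fLetter_pos h1 h2]
  · simp [hc]

theorem phiLetter_neg (h1 : 1 ≤ i) (h2 : i < n) (c : ℕ) :
    phiLetter X n i (neg c) = if c = i + 1 then 1 else 0 := by
  unfold phiLetter
  rw [fLetter_neg h1 h2]
  by_cases hc : c = i + 1
  · simp [hc, fLetter_neg h1 h2]
  · simp [hc]

theorem epsLetter_zero (h1 : 1 ≤ i) (h2 : i < n) : epsLetter X n i zero = 0 := by
  unfold epsLetter; rw [eLetter_zero h1 h2]

theorem phiLetter_zero (h1 : 1 ≤ i) (h2 : i < n) : phiLetter X n i zero = 0 := by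
  unfold phiLetter; rw [fLetter_zero h1 h2]

theorem standard_of_lt (h1 : 1 ≤ i) (h2 : i < n) : Standard X n i :=
  ⟨h1, h2.le, fun c _ => epsLetter_pos h1 h2 c, fun c _ => phiLetter_pos h1 h2 c,
    fun c _ => epsLetter_neg h1 h2 c, fun c _ => phiLetter_neg h1 h2 c⟩

theorem standard_typeA (h1 : 1 ≤ n) : Standard KRType.typeA n n := by
  refine ⟨h1, le_rfl, ?_, ?_, ?_, ?_⟩ <;> intro c hc
  · simp [epsLetter, eLetter]; omega
  · by_cases h : c = n <;> simp [phiLetter, fLetter, h]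
  · by_cases h : c = n <;> simp [epsLetter, eLetter, h]
  · simp [phiLetter, fLetter]; omega

/-- At the last node of types `B_n` and `D_n` the letters of small absolute value do not move. -/
theorem inert_last_B {c : ℕ} (hc : c < n) :
    (epsLetter KRType.typeB n n (pos c) = 0 ∧ phiLetter KRType.typeB n n (pos c) = 0) ∧
    epsLetter KRType.typeB n n (neg c) = 0 ∧ phiLetter KRType.typeB n n (neg c) = 0 := by
  have : c ≠ n := by omega
  simp [epsLetter, phiLetter, eLetter, fLetter, this]

theorem inert_last_D {c : ℕ} (hc : c + 1 < n) :
    (epsLetter KRType.typeD n n (pos c) = 0 ∧ phiLetter KRType.typeD n n (pos c) = 0) ∧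
    epsLetter KRType.typeD n n (neg c) = 0 ∧ phiLetter KRType.typeD n n (neg c) = 0 := by
  have h1 : c ≠ n := by omega
  have h2 : c ≠ n - 1 := by omega
  simp [epsLetter, phiLetter, eLetter, fLetter, h1, h2]

end LetterValues

/-! ### Columns -/

theorem seg_of_lt {a b : ℕ} (h : b < a) : seg a b = [] := by
  have : b + 1 - a = 0 := by omega
  simp [seg, this]

theorem seg_cons {a b : ℕ} (h : a ≤ b) : seg a b = pos a :: seg (a + 1) b := by
  have : b + 1 - a = (b + 1 - (a + 1)) + 1 := by omega
  simp [seg, this, List.range'_succ]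

theorem seg_append {a b c : ℕ} (h : a ≤ b + 1) (h' : b ≤ c) :
    seg a b ++ seg (b + 1) c = seg a c := by
  simp only [seg, ← List.map_append]
  congr 1
  have h1 : c + 1 - a = (b + 1 - a) + (c + 1 - (b + 1)) := by omega
  rw [h1, ← List.range'_append]
  congr 2
  omega

theorem seg_self (a : ℕ) : seg a a = [pos a] := by
  rw [seg_cons le_rfl, seg_of_lt (by omega)]

theorem mem_seg {a b : ℕ} {x : KRLetter} : x ∈ seg a b ↔ ∃ c, a ≤ c ∧ c ≤ b ∧ x = pos c := by
  simp only [seg, List.mem_map, List.mem_range'_1]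
  constructor
  · rintro ⟨c, h, rfl⟩; exact ⟨c, h.1, by omega, rfl⟩
  · rintro ⟨c, h1, h2, rfl⟩; exact ⟨c, ⟨h1, by omega⟩, rfl⟩

theorem length_seg (a b : ℕ) : (seg a b).length = b + 1 - a := by simp [seg]

/-- The string `c, …, g` with the letter `p` left out; `p` is called its hole. -/
def holeSeg (c p g : ℕ) : List KRLetter := seg c (p - 1) ++ seg (p + 1) g

/-- The column of height `g` with the unbarred letters `1, …, g` except `a`, and the barred
letter `b`. -/
def kCol (g a b : ℕ) : List KRLetter := holeSeg 1 a g ++ [neg b]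

/-- The reading word of the tableau whose columns, from left to right, have the heights `G`,
all columns being of the form `kCol`. The list `P` contains the values `b`, `a` of the first
column, then those of the second one, and so on; missing values are `1`. -/
def kWord : List ℕ → List ℕ → List KRLetter
  | [], _ => []
  | g :: G, P => kWord G (P.drop 2) ++ kCol g (P.getD 1 1) (P.getD 0 1)

/-- The reading word of the tableau with columns `c t`, where `t` runs, from left to right,
through the list. -/
def colWord {τ : Type} (c : τ → List KRLetter) : List τ → List KRLetter
  | [] => []
  | t :: F => colWord c F ++ c t

theorem colWord_append {τ : Type} (c : τ → List KRLetter) (F F' : List τ) :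
    colWord c (F ++ F') = colWord c F' ++ colWord c F := by
  induction F with
  | nil => simp [colWord]
  | cons t F ih => simp [colWord, ih]

theorem colWord_map {τ τ' : Type} (h : τ → τ') (c : τ' → List KRLetter) (F : List τ) :
    colWord c (F.map h) = colWord (fun t => c (h t)) F := by
  induction F with
  | nil => rfl
  | cons t F ih => simp [colWord, ih]

theorem colWord_congr {τ : Type} {c c' : τ → List KRLetter} {F : List τ}
    (h : ∀ t ∈ F, c t = c' t) : colWord c F = colWord c' F := by
  induction F with
  | nil => rfl
  | cons t F ih =>
    simp only [colWord]
    rw [h t (by simp), ih (fun s hs => h s (by simp [hs]))]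

theorem colWord_eq_flatten {τ : Type} (c : τ → List KRLetter) (F : List τ) :
    colWord c F = (F.map c).reverse.flatten := by
  induction F with
  | nil => rfl
  | cons t F ih => simp [colWord, ih]

section Signature

variable {X : KRType} {n i : ℕ}

theorem epsWord_seg (hs : Standard X n i) {a b : ℕ} (hb : b ≤ n) :
    epsWord X n i (seg a b) = (if a = i + 1 ∧ a ≤ b then 1 else 0) ∧
    phiWord X n i (seg a b) = if a ≤ i ∧ i = b then 1 else 0 := by
  by_cases h : a ≤ b
  · obtain ⟨d, hd⟩ : ∃ d, b = a + d := ⟨b - a, by omega⟩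
    induction d generalizing a with
    | zero =>
      obtain rfl : a = b := by omega
      rw [seg_self, epsWord_singleton, phiWord_singleton, hs.eps_pos a hb, hs.phi_pos a hb]
      constructor <;> split_ifs <;> omega
    | succ d ih =>
      obtain ⟨h1, h2⟩ := ih (a := a + 1) (by omega) (by omega)
      rw [seg_cons h]
      simp only [epsWord, phiWord, h1, h2, hs.eps_pos a (by omega), hs.phi_pos a (by omega)]
      constructor <;> split_ifs <;> omega
  · rw [seg_of_lt (by omega)]
    simp only [epsWord, phiWord]
    constructor <;> split_ifs <;> omega

theorem signature_holeSeg (hs : Standard X n i) {c p g : ℕ} (hc : c ≤ i)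
    (hp : p ≤ n + 1) (hg : g ≤ n) :
    epsWord X n i (holeSeg c p g) = (if p = i ∧ i < g then 1 else 0) ∧
    phiWord X n i (holeSeg c p g) = if i + 1 = p ∨ (p < i ∧ i = g) then 1 else 0 := by
  obtain ⟨h1, h2⟩ := epsWord_seg hs (a := c) (b := p - 1) (by omega)
  obtain ⟨h3, h4⟩ := epsWord_seg hs (a := p + 1) (b := g) hg
  have := hs.one_le
  rw [holeSeg, epsWord_append, phiWord_append, h1, h2, h3, h4]
  constructor <;> split_ifs <;> omega

theorem signature_neg (hs : Standard X n i) {b : ℕ} (hb : b ≤ n) :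
    epsWord X n i [neg b] = (if b = i then 1 else 0) ∧
    phiWord X n i [neg b] = if b = i + 1 then 1 else 0 := by
  rw [epsWord_singleton, phiWord_singleton, hs.eps_neg b hb, hs.phi_neg b hb]
  exact ⟨rfl, rfl⟩

theorem raise_seg (hi : 1 ≤ i) (hin : i < n) {b : ℕ} (hib : i < b) (hb : b ≤ n) :
    Raise X n i 1 0 (seg (i + 1) b) (pos i :: seg (i + 2) b) := by
  obtain ⟨h1, h2⟩ := epsWord_seg (standard_of_lt (X := X) hi hin) (a := i + 1) hb
  obtain ⟨h3, h4⟩ := epsWord_seg (standard_of_lt (X := X) hi hin) (a := i + 2) hb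
  refine ⟨by rw [h1, if_pos (by omega)], by rw [h2, if_neg (by omega)], ?_⟩
  have h5 : epsWord X n i (seg (i + 2) b) = 0 := by rw [h3, if_neg (by omega)]
  rw [seg_cons (by omega)]
  simp [partialIter, eWd, h5, eLetter_pos hi hin]

/-- `e_i` moves the hole of a string from `i` to `i + 1`. -/
theorem raise_holeSeg (hi : 1 ≤ i) (hin : i < n) {c g : ℕ} (hc : c ≤ i) (hig : i < g)
    (hg : g ≤ n) : Raise X n i 1 0 (holeSeg c i g) (holeSeg c (i + 1) g) := by
  obtain ⟨h1, h2⟩ := epsWord_seg (standard_of_lt (X := X) hi hin) (a := c) (b := i - 1) (by omega)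
  have h : Raise X n i 0 0 (seg c (i - 1)) (seg c (i - 1)) :=
    Raise.refl (by rw [h1, if_neg (by omega)]) (by rw [h2, if_neg (by omega)])
  refine (h.append hi (raise_seg hi hin hig hg)).cast (by omega) rfl rfl ?_
  rw [holeSeg, ← List.singleton_append, ← seg_self, ← List.append_assoc]
  congr 1
  have := seg_append (a := c) (b := i - 1) (c := i) (by omega) (by omega)
  rw [Nat.sub_add_cancel hi] at this
  exact this

theorem raise_neg (hi : 1 ≤ i) (hin : i < n) :
    Raise X n i 1 0 [neg i] [neg (i + 1)] := by
  refine Raise.letter ?_ ?_ ?_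
  · simp [eLetter_neg hi hin]
  · simp [epsLetter_neg hi hin]
  · rw [phiLetter_neg hi hin, if_neg (by omega)]

theorem signature_kCol (hs : Standard X n i) {g a b : ℕ} (ha' : a ≤ n + 1)
    (hg : g ≤ n) (hb : b ≤ n) :
    epsWord X n i (kCol g a b) = (if a = i ∧ i < g then 1 else 0) +
      ((if b = i then 1 else 0) - if i + 1 = a ∨ (a < i ∧ i = g) then 1 else 0) ∧
    phiWord X n i (kCol g a b) = (if b = i + 1 then 1 else 0) +
      ((if i + 1 = a ∨ (a < i ∧ i = g) then 1 else 0) - if b = i then 1 else 0) := by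
  obtain ⟨h1, h2⟩ := signature_holeSeg hs (c := 1) (p := a) (g := g) hs.one_le ha' hg
  obtain ⟨h3, h4⟩ := signature_neg hs (b := b) hb
  rw [kCol, epsWord_append, phiWord_append, h1, h2, h3, h4]
  exact ⟨rfl, rfl⟩

/-- If all values after those in `Q` equal `i`, and the ones in `Q` are larger, then `e_i` turns
the first of them into `i + 1`. -/
theorem kWord_move (hi : 1 ≤ i) (hin : i < n) {G : List ℕ} (hG : ∀ g ∈ G, i < g ∧ g ≤ n)
    {Q : List ℕ} (hQ : ∀ q ∈ Q, i < q ∧ q ≤ n) {s : ℕ} (hlen : Q.length + s ≤ 2 * G.length)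
    (h1 : i = 1 → Q.length + s = 2 * G.length) :
    epsWord X n i (kWord G (Q ++ List.replicate s i)) = s ∧
    phiWord X n i (kWord G (Q ++ List.replicate s i)) = Q.count (i + 1) ∧
    ∀ s', s = s' + 1 → eWd X n i (kWord G (Q ++ List.replicate s i)) =
      some (kWord G (Q ++ (i + 1) :: List.replicate s' i)) := by
  have hs := standard_of_lt (X := X) hi hin
  induction G generalizing Q s with
  | nil =>
    simp only [List.length_nil] at hlen
    have hQ0 : Q = [] := List.length_eq_zero_iff.mp (by omega)
    have hs0 : s = 0 := by omega
    subst hQ0 hs0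
    simp [kWord, epsWord, phiWord]
  | cons g G ih =>
    obtain ⟨hg, hgn⟩ := hG g (by simp)
    have hG' : ∀ g ∈ G, i < g ∧ g ≤ n := fun g hg => hG g (by simp [hg])
    simp only [List.length_cons] at hlen h1
    -- The leftmost column reads the first two values, and the remaining columns are read before it.
    -- If both values lie in `Q`, the letter moves further right; if one does, the hole of this column
    -- moves; if none does, its barred letter moves.
    match Q, hQ, s with
    | q1 :: q2 :: Q, hQ, s =>
      obtain ⟨a1, a2⟩ := hQ q1 (by simp)
      obtain ⟨b1, b2⟩ := hQ q2 (by simp)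
      simp only [List.length_cons] at hlen h1
      obtain ⟨e1, e2, e3⟩ := ih hG' (Q := Q) (s := s) (fun q hq => hQ q (by simp [hq]))
        (by omega) (fun h => by have := h1 h; omega)
      obtain ⟨k1, k2⟩ := signature_kCol hs (g := g) (a := q2) (b := q1) (by omega)
        hgn a2
      rw [if_neg (by omega), if_neg (by omega)] at k1
      simp only [Nat.zero_sub, Nat.add_zero] at k1
      simp only [List.cons_append, kWord, List.drop_succ_cons, List.drop_zero,
        List.getD_cons_succ, List.getD_cons_zero]
      refine ⟨?_, ?_, ?_⟩
      · rw [epsWord_append, e1, k1]; omega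
      · rw [phiWord_append, e2, k1, k2]
        simp only [List.count_cons, beq_iff_eq]
        split_ifs <;> omega
      · intro s' hs'
        rw [eWd_append, k1, if_pos (by omega), e3 s' hs']
        rfl
    | [q1], hQ, 0 =>
      obtain ⟨a1, a2⟩ := hQ q1 (by simp)
      simp only [List.length_cons, List.length_nil] at hlen h1
      obtain ⟨e1, e2, e3⟩ := ih hG' (Q := []) (s := 0) (by simp)
        (by simp) (fun h => by have := h1 h; omega)
      -- The values missing at the end are read as `1`, hence are left alone unless `i = 1`.
      have hi1 : i ≠ 1 := by intro h; have := h1 h; omega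
      obtain ⟨k1, k2⟩ := signature_kCol hs (g := g) (a := 1) (b := q1) (by omega)
        hgn a2
      simp only [List.nil_append, List.replicate_zero] at e1 e2
      simp only [List.cons_append, kWord, List.drop_succ_cons, List.drop_nil, List.nil_append,
        List.getD_cons_succ, List.getD_cons_zero, List.replicate_zero, List.getD_nil]
      refine ⟨?_, ?_, ?_⟩
      · rw [epsWord_append, e1, e2, k1]
        split_ifs <;> omega
      · rw [phiWord_append, e2, k1, k2]
        simp only [List.count_cons, beq_iff_eq, List.count_nil]
        split_ifs <;> omega
      · intro s' hs'; omega
    | [q1], hQ, s + 1 =>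
      obtain ⟨a1, a2⟩ := hQ q1 (by simp)
      simp only [List.length_cons, List.length_nil] at hlen h1
      obtain ⟨e1, e2, e3⟩ := ih hG' (Q := []) (s := s) (by simp)
        (by simp; omega) (fun h => by have := h1 h; simp; omega)
      obtain ⟨k1, k2⟩ := signature_kCol hs (g := g) (a := i) (b := q1) (by omega)
        hgn a2
      obtain ⟨n1, n2⟩ := signature_neg hs (b := q1) a2
      simp only [List.nil_append] at e1 e2
      rw [if_pos (by omega), if_neg (by omega)] at k1
      simp only [List.cons_append, kWord, List.drop_succ_cons, List.drop_zero, List.nil_append,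
        List.getD_cons_succ, List.getD_cons_zero, List.replicate_succ]
      refine ⟨?_, ?_, ?_⟩
      · rw [epsWord_append, e1, e2, k1]
        simp only [List.count_nil]
        omega
      · rw [phiWord_append, e2, k1, k2]
        simp only [List.count_cons, beq_iff_eq, List.count_nil]
        split_ifs <;> omega
      · intro s' hs'
        obtain rfl : s = s' := by omega
        rw [eWd_append, k1, e2, if_neg (by simp)]
        simp only [kCol]
        have h := (raise_holeSeg (X := X) hi hin hi hg hgn).iter
        simp only [partialIter, Option.bind_fun_some] at h
        rw [eWd_append, n1, if_pos (by rw [if_neg (by omega)]; omega), h]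
        rfl
    | [], hQ, 0 =>
      simp only [List.length_nil] at hlen h1
      obtain ⟨e1, e2, e3⟩ := ih hG' (Q := []) (s := 0) (by simp)
        (by simp) (fun h => by have := h1 h; omega)
      have hi1 : i ≠ 1 := by intro h; have := h1 h; omega
      obtain ⟨k1, k2⟩ := signature_kCol hs (g := g) (a := 1) (b := 1) (by omega)
        hgn (by omega)
      simp only [List.nil_append, List.replicate_zero] at e1 e2
      simp only [kWord, List.drop_nil, List.nil_append, List.replicate_zero, List.getD_nil]
      refine ⟨?_, ?_, ?_⟩
      · rw [epsWord_append, e1, e2, k1]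
        split_ifs <;> omega
      · rw [phiWord_append, e2, k1, k2]
        simp only [List.count_nil]
        split_ifs <;> omega
      · intro s' hs'; omega
    | [], hQ, 1 =>
      simp only [List.length_nil] at hlen h1
      obtain ⟨e1, e2, e3⟩ := ih hG' (Q := []) (s := 0) (by simp)
        (by simp) (fun h => by have := h1 h; omega)
      have hi1 : i ≠ 1 := by intro h; have := h1 h; omega
      obtain ⟨k1, k2⟩ := signature_kCol hs (g := g) (a := 1) (b := i) (by omega)
        hgn (by omega)
      obtain ⟨m1, m2⟩ := signature_holeSeg hs (c := 1) (p := 1) (g := g) hi (by omega) hgn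
      rw [if_neg (by omega)] at m1 m2
      simp only [List.nil_append, List.replicate_zero] at e1 e2
      simp only [kWord, List.drop_succ_cons, List.drop_nil, List.nil_append,
        List.replicate_succ, List.replicate_zero, List.getD_nil, List.getD_cons_succ,
        List.getD_cons_zero]
      rw [if_neg (by omega), if_pos rfl, if_neg (by omega)] at k1
      rw [if_neg (by omega), if_neg (by omega)] at k2
      refine ⟨?_, ?_, ?_⟩
      · rw [epsWord_append, e1, e2, k1]
        simp
      · rw [phiWord_append, e2, k1, k2]
        simp
      · intro s' hs'
        obtain rfl : s' = 0 := by omega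
        have h := (raise_neg (X := X) hi hin).iter
        simp only [partialIter, Option.bind_fun_some] at h
        rw [eWd_append, k1, e2, if_neg (by simp)]
        simp only [kCol]
        rw [eWd_append, m2, if_neg (by rw [(signature_neg hs hin.le).1]; simp), h]
        rfl
    | [], hQ, s + 2 =>
      simp only [List.length_nil] at hlen h1
      obtain ⟨e1, e2, e3⟩ := ih hG' (Q := []) (s := s) (by simp)
        (by simp; omega) (fun h => by have := h1 h; simp; omega)
      obtain ⟨k1, k2⟩ := signature_kCol hs (g := g) (a := i) (b := i) (by omega)
        hgn (by omega)
      obtain ⟨m1, m2⟩ := signature_holeSeg hs (c := 1) (p := i) (g := g) hi (by omega) hgn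
      rw [if_neg (by omega)] at m2
      simp only [List.nil_append] at e1 e2
      simp only [kWord, List.drop_succ_cons, List.drop_zero, List.nil_append,
        List.replicate_succ, List.getD_cons_succ, List.getD_cons_zero]
      rw [if_pos (by omega), if_pos rfl, if_neg (by omega)] at k1
      rw [if_neg (by omega), if_neg (by omega)] at k2
      refine ⟨?_, ?_, ?_⟩
      · rw [epsWord_append, e1, e2, k1]
        simp
      · rw [phiWord_append, e2, k1, k2]
        simp
      · intro s' hs'
        obtain rfl : s' = s + 1 := by omega
        have h := (raise_neg (X := X) hi hin).iter
        simp only [partialIter, Option.bind_fun_some] at h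
        rw [eWd_append, k1, e2, if_neg (by simp)]
        simp only [kCol]
        rw [eWd_append, m2, if_neg (by rw [(signature_neg hs hin.le).1]; simp), h]
        simp [List.replicate_succ]

theorem kWord_move_iter (hi : 1 ≤ i) (hin : i < n) {G : List ℕ} (hG : ∀ g ∈ G, i < g ∧ g ≤ n)
    {Q : List ℕ} (hQ : ∀ q ∈ Q, i < q ∧ q ≤ n) {s t : ℕ}
    (hlen : Q.length + (t + s) ≤ 2 * G.length)
    (h1 : i = 1 → Q.length + (t + s) = 2 * G.length) :
    partialIter (eWd X n i) t (kWord G (Q ++ List.replicate (t + s) i)) =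
      some (kWord G (Q ++ (List.replicate t (i + 1) ++ List.replicate s i))) := by
  induction t generalizing Q with
  | zero => simp [partialIter]
  | succ t ih =>
    have h := (kWord_move (X := X) hi hin hG hQ (s := t + 1 + s) hlen h1).2.2 (t + s) (by omega)
    simp only [partialIter, h, Option.bind_some]
    have h' := ih (Q := Q ++ [i + 1])
      (by
        intro q hq
        rcases List.mem_append.mp hq with hq | hq
        · exact hQ q hq
        · simp at hq; omega)
      (by simp; omega) (fun h => by have := h1 h; simp; omega)
    simpa [List.replicate_succ] using h'

end Signature

/-! ### Blocked columns -/

section Stuck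

variable {X : KRType} {n i : ℕ}

theorem count_eq_of_suffix {G P : List ℕ} (hG : G.Pairwise (· ≥ ·)) (hP : P <:+ G) {p : ℕ}
    (hp : p ∈ P) (hip : i < p) : P.count i = G.count i := by
  obtain ⟨A, rfl⟩ := hP
  rw [List.pairwise_append] at hG
  have : A.count i = 0 := by
    rw [List.count_eq_zero]
    intro h
    have := hG.2.2 i h p hp
    omega
  rw [List.count_append, this, Nat.zero_add]

theorem suffix_drop_two {g : ℕ} {G P : List ℕ} (h : P <:+ g :: G) : P.drop 2 <:+ G := by
  rcases List.suffix_cons_iff.mp h with rfl | h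
  · simpa using List.drop_suffix 1 G
  · exact (List.drop_suffix 2 P).trans h

/-- What the recursion defining `kWord` needs to know about the first two values of `P`. -/
theorem suffix_head {g : ℕ} {G P : List ℕ} (hi : 2 ≤ i) (hG : (g :: G).Pairwise (· ≥ ·))
    (h3 : ∀ h ∈ g :: G, 1 ≤ h) (hP : P <:+ g :: G) :
    P.getD 1 1 ≤ P.getD 0 1 ∧ P.getD 0 1 ≤ g ∧ 1 ≤ P.getD 1 1 ∧
    (∀ p ∈ P.drop 2, p ≤ P.getD 1 1) ∧
    P.count i = (P.drop 2).count i +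
      ((if P.getD 0 1 = i then 1 else 0) + if P.getD 1 1 = i then 1 else 0) ∧
    P.countP (i < ·) = (P.drop 2).countP (i < ·) +
      ((if i < P.getD 0 1 then 1 else 0) + if i < P.getD 1 1 then 1 else 0) ∧
    (i < P.getD 0 1 → P.count i = (g :: G).count i) := by
  have hg1 := h3 g (by simp)
  have hle : ∀ p ∈ P, p ≤ g := by
    intro p hp
    rcases List.mem_cons.mp (hP.mem hp) with rfl | h
    · exact le_rfl
    · exact (List.pairwise_cons.mp hG).1 p h
  have hPs := hG.sublist hP.sublist
  have hP1 : ∀ p ∈ P, 1 ≤ p := fun p hp => h3 p (hP.mem hp)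
  match P, hle, hPs, hP, hP1 with
  | [], _, _, _, _ =>
    have : (1 : ℕ) ≠ i := by omega
    have h0 : i ≠ 0 := by omega
    simp [this, h0]
    omega
  | [p1], hle, _, hP, hP1 =>
    have : (1 : ℕ) ≠ i := by omega
    have h1 := hle p1 (by simp)
    have h2 := hP1 p1 (by simp)
    refine ⟨by simpa using h2, by simpa using h1, by simp, by simp, ?_, ?_, ?_⟩
    · simp [List.count_cons, this]
    · simp [List.countP_cons]; omega
    · intro h
      exact count_eq_of_suffix hG hP (p := p1) (by simp) (by simpa using h)
  | p1 :: p2 :: P, hle, hPs, hP, hP1 =>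
    have h1 := hle p1 (by simp)
    rw [List.pairwise_cons, List.pairwise_cons] at hPs
    refine ⟨by simpa using hPs.1 p2 (by simp), by simpa using h1,
      by simpa using hP1 p2 (by simp), by simpa using hPs.2.1, ?_, ?_, ?_⟩
    · simp [List.count_cons]; omega
    · simp [List.countP_cons]; omega
    · intro h
      exact count_eq_of_suffix hG hP (p := p1) (by simp) (by simpa using h)

/-- The columns of a blocked word are bracketed: its `ε_i` vanishes. -/
theorem kWord_blocked (hs : Standard X n i) (hi : 2 ≤ i) {G P : List ℕ}
    (hG : G.Pairwise (· ≥ ·)) (hGn : ∀ g ∈ G, 1 ≤ g ∧ g ≤ n) (hP : P <:+ G) :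
    epsWord X n i (kWord G P) = 0 ∧ G.count i - P.count i ≤ phiWord X n i (kWord G P) ∧
    ((∀ p ∈ P, p ≤ i) → phiWord X n i (kWord G P) = G.count i - P.count i) := by
  induction G generalizing P with
  | nil =>
    simp [kWord, epsWord, phiWord]
  | cons g G ih =>
    obtain ⟨a1, a2, a3, a4, a5, a6, a7⟩ := suffix_head hi hG (fun h hh => (hGn h hh).1) hP
    have hG' := (List.pairwise_cons.mp hG).2
    obtain ⟨e1, e2, e3⟩ := ih hG' (fun h hh => hGn h (by simp [hh])) (suffix_drop_two hP)
    have hgn := (hGn g (by simp)).2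
    have q1 : P.count i ≤ (g :: G).count i := hP.sublist.count_le i
    have q2 : (P.drop 2).count i ≤ G.count i := (suffix_drop_two hP).sublist.count_le i
    simp only [kWord]
    have hmem : P.getD 0 1 ≤ i → ∀ p ∈ P.drop 2, p ≤ i := fun h p hp => by
      have := a4 p hp; omega
    have hmem' : (∀ p ∈ P, p ≤ i) → P.getD 0 1 ≤ i := by
      intro h
      cases P with
      | nil => simp; omega
      | cons p P => simpa using h p (by simp)
    generalize P.getD 0 1 = p1 at *
    generalize P.getD 1 1 = p2 at *
    obtain ⟨k1, k2⟩ := signature_kCol hs (g := g) (a := p2) (b := p1) (by omega) hgn (by omega)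
    rw [List.count_cons] at a7 q1 ⊢
    simp only [beq_iff_eq] at a7 q1 ⊢
    rw [epsWord_append, phiWord_append, k1, k2, e1]
    refine ⟨?_, ?_, ?_⟩
    · grind
    · grind
    · intro h
      have h1 := hmem' h
      rw [e3 (hmem h1)]
      grind

theorem map_min_getD {i : ℕ} (hi : 1 ≤ i) (P : List ℕ) (s : ℕ) :
    (P.map (min i)).getD s 1 = min i (P.getD s 1) := by
  rw [List.getD_eq_getElem?_getD, List.getD_eq_getElem?_getD, List.getElem?_map]
  cases P[s]? <;> simp [hi]

/-- Raising at the node `i` a word whose values are bounded by `i`: the values that are equal to `i`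
and have reached their final value `p` are blocked by the columns of height `i`; the others
become `i + 1`. -/
theorem kWord_raise (hi : 2 ≤ i) (hin : i < n) {G P : List ℕ}
    (hG : G.Pairwise (· ≥ ·)) (hGn : ∀ g ∈ G, 1 ≤ g ∧ g ≤ n) (hP : P <:+ G) :
    Raise X n i (P.countP (i < ·)) (G.count i - P.count i)
      (kWord G (P.map (min i))) (kWord G (P.map (min (i + 1)))) := by
  have hs := standard_of_lt (X := X) (by omega : 1 ≤ i) hin
  have hi1 : 1 ≤ i := by omega
  induction G generalizing P with
  | nil =>
    have : P = [] := List.suffix_nil.mp hP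
    subst this
    simpa [kWord] using Raise.nil
  | cons g G ih =>
    obtain ⟨a1, a2, a3, a4, a5, a6, a7⟩ := suffix_head hi hG (fun h hh => (hGn h hh).1) hP
    have hG' := (List.pairwise_cons.mp hG).2
    have e := ih hG' (fun h hh => hGn h (by simp [hh])) (suffix_drop_two hP)
    have hgn := (hGn g (by simp)).2
    have q1 : P.count i ≤ (g :: G).count i := hP.sublist.count_le i
    have q2 : (P.drop 2).count i ≤ G.count i := (suffix_drop_two hP).sublist.count_le i
    simp only [kWord, map_min_getD hi1, map_min_getD (by omega : 1 ≤ i + 1), ← List.map_drop]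
    have hmem : P.getD 1 1 ≤ i → (P.drop 2).countP (i < ·) = 0 := fun h => by
      rw [List.countP_eq_zero]
      intro p hp
      have := a4 p hp
      simp; omega
    generalize P.getD 0 1 = p1 at *
    generalize P.getD 1 1 = p2 at *
    rw [List.count_cons] at a7 q1 ⊢
    simp only [beq_iff_eq] at a7 q1 ⊢
    by_cases h2 : i < p2
    · have hp1 : i < p1 := by omega
      have := a7 hp1
      rw [min_eq_left hp1.le, min_eq_left h2.le, min_eq_left (by omega : i + 1 ≤ p1),
        min_eq_left (by omega : i + 1 ≤ p2)]
      have hphi : G.count i - (P.drop 2).count i = 0 := by grind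
      rw [hphi] at e
      have hc := (raise_holeSeg (X := X) hi1 hin hi1 (by omega : i < g) hgn).append hi1
        (raise_neg hi1 hin)
      refine (e.append hi1 hc).cast ?_ ?_ rfl rfl
      · grind
      · grind
    · rw [min_eq_right (by omega : p2 ≤ i), min_eq_right (by omega : p2 ≤ i + 1)]
      rw [hmem (by omega)] at a6 e
      by_cases h1 : i < p1
      · have := a7 h1
        obtain ⟨k1, k2⟩ := signature_holeSeg hs (c := 1) (p := p2) (g := g) hi1 (by omega) hgn
        rw [min_eq_left h1.le, min_eq_left (by omega : i + 1 ≤ p1)]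
        have h3 := e.append_absorb hi1 k1 k2 (by grind)
        have h4 := (h3.cast rfl (m' := 0) (p' := 0)
          (by grind) rfl rfl).append hi1 (raise_neg (X := X) hi1 hin)
        refine h4.cast ?_ ?_ ?_ ?_
        · grind
        · grind
        · rw [kCol, List.append_assoc]
        · rw [kCol, List.append_assoc]
      · rw [min_eq_right (by omega : p1 ≤ i), min_eq_right (by omega : p1 ≤ i + 1)]
        obtain ⟨k1, k2⟩ := signature_kCol hs (g := g) (a := p2) (b := p1) (by omega) hgn (by omega)
        refine (e.append_absorb hi1 k1 k2 ?_).cast ?_ ?_ rfl rfl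
        · grind
        · grind
        · grind

end Stuck

/-! ### Columns with a travelling letter -/

section Nodes

variable {X : KRType} {n r i : ℕ}

theorem le_of_inRange (h : InRange X n r) : r ≤ n := by
  cases X <;> simp [InRange] at h <;> omega

/-- The letters whose absolute value is at most two do not move at the nodes `3, …, n`. -/
theorem inert_small (hn : InRange X n r) (hr : 3 ≤ r) (hi : 3 ≤ i) (hin : i ≤ n) {c : ℕ}
    (hc : c ≤ 2) :
    (epsLetter X n i (pos c) = 0 ∧ phiLetter X n i (pos c) = 0) ∧
    epsLetter X n i (neg c) = 0 ∧ phiLetter X n i (neg c) = 0 := by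
  have hs : Standard X n i → (epsLetter X n i (pos c) = 0 ∧ phiLetter X n i (pos c) = 0) ∧
      epsLetter X n i (neg c) = 0 ∧ phiLetter X n i (neg c) = 0 := by
    intro hs
    rw [hs.eps_pos c (by omega), hs.phi_pos c (by omega), hs.eps_neg c (by omega),
      hs.phi_neg c (by omega)]
    refine ⟨⟨?_, ?_⟩, ?_, ?_⟩ <;> rw [if_neg (by omega)]
  rcases Nat.lt_or_ge i n with h | h
  · exact hs (standard_of_lt (by omega) h)
  · obtain rfl : i = n := by omega
    cases X with
    | typeA => exact hs (standard_typeA (by omega))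
    | typeB => exact inert_last_B (by simp [InRange] at hn; omega)
    | typeD => exact inert_last_D (by simp [InRange] at hn; omega)

/-- At the node `n` either the type is `C_n`, or the letters of absolute value at most `r` do not
move. -/
theorem standard_or_inert (hn : InRange X n r) (hr : 3 ≤ r) :
    Standard X n n ∨ (r < n ∧ ∀ c ≤ r,
      (epsLetter X n n (pos c) = 0 ∧ phiLetter X n n (pos c) = 0) ∧
      epsLetter X n n (neg c) = 0 ∧ phiLetter X n n (neg c) = 0) := by
  cases X with
  | typeA => exact Or.inl (standard_typeA (by simp [InRange] at hn; omega))
  | typeB =>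
    simp only [InRange] at hn
    exact Or.inr ⟨by omega, fun c hc => inert_last_B (by omega)⟩
  | typeD =>
    simp only [InRange] at hn
    exact Or.inr ⟨by omega, fun c hc => inert_last_D (by omega)⟩

/-- The unbarred letter that `e_n` makes of `n` with a bar when applied as often as possible. -/
def turn (X : KRType) (n : ℕ) : ℕ := if X = KRType.typeD then n - 1 else n

/-- The number of times `e_n` can be applied to `n` with a bar. -/
def turnLength (X : KRType) : ℕ := if X = KRType.typeB then 2 else 1

theorem turn_bounds (hn : InRange X n r) : r ≤ turn X n ∧ turn X n ≤ n := by
  cases X <;> simp [InRange, turn] at * <;> omega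

theorem raise_turn (hn : InRange X n r) (hr : 3 ≤ r) :
    Raise X n n (turnLength X) 0 [neg n] [pos (turn X n)] := by
  have := le_of_inRange hn
  cases X with
  | typeA =>
    refine Raise.letter ?_ ?_ ?_
    · simp [eLetter, turn]
    · simp [epsLetter, eLetter]
    · simp [phiLetter, fLetter]
  | typeB =>
    refine ⟨?_, ?_, ?_⟩
    · simp [epsWord, epsLetter, eLetter, turnLength]
    · simp [phiWord, phiLetter, epsWord, fLetter]
    · simp [turnLength, turn, partialIter, eWd, epsWord, eLetter]
  | typeD =>
    have h1 : n ≠ n - 1 := by omega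
    refine Raise.letter ?_ ?_ ?_
    · simp [eLetter, turn]
    · simp [epsLetter, eLetter]
    · simp [phiLetter, fLetter]

end Nodes

theorem holeSeg_self {c g : ℕ} : holeSeg c g g = seg c (g - 1) := by
  rw [holeSeg, seg_of_lt (by omega : g < g + 1), List.append_nil]

/-- A column with the letters `3, …, g` except `min i g`, followed by `i` with a bar; the additional
letters in front and at the end are not moved by the nodes from `3` on. A column is given by
the letters in front, the number `g`, and the letters at the end. -/
def freeCol (i : ℕ) (t : List KRLetter × ℕ × List KRLetter) : List KRLetter :=
  t.1 ++ (holeSeg 3 (min i t.2.1) t.2.1 ++ [neg i]) ++ t.2.2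

/-- The column `freeCol` after the letter with a bar has turned into an unbarred one, which
descends to `i`, but not below `g`. -/
def turnedCol (i : ℕ) (t : List KRLetter × ℕ × List KRLetter) : List KRLetter :=
  t.1 ++ (seg 3 (t.2.1 - 1) ++ [pos (max i t.2.1)]) ++ t.2.2

/-- The hypotheses on the data of a column `freeCol`. -/
structure FreeData (r : ℕ) (t : List KRLetter × ℕ × List KRLetter) : Prop where
  three_le : 3 ≤ t.2.1
  le : t.2.1 ≤ r
  front : ∀ a ∈ t.1, ∃ c ≤ 2, a = pos c
  back : ∀ a ∈ t.2.2, ∃ c ≤ 2, a = neg c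

/-- A column with the letter `x`, followed by the letters `3, …, h` except `min i h`. -/
def dotCol (i : ℕ) (t : ℕ × ℕ) : List KRLetter := pos t.1 :: holeSeg 3 (min i t.2) t.2

section FreeColumns

variable {X : KRType} {n r i : ℕ}

theorem inert_front (hn : InRange X n r) (hr : 3 ≤ r) (hi : 3 ≤ i) (hin : i ≤ n)
    {A : List KRLetter} (hA : ∀ a ∈ A, ∃ c ≤ 2, a = pos c) :
    Raise X n i 0 0 A A := by
  have := inert_word (X := X) (n := n) (i := i) (u := A) (by
    intro a ha
    obtain ⟨c, hc, rfl⟩ := hA a ha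
    exact (inert_small hn hr hi hin hc).1)
  exact Raise.refl this.1 this.2

theorem inert_back (hn : InRange X n r) (hr : 3 ≤ r) (hi : 3 ≤ i) (hin : i ≤ n)
    {A : List KRLetter} (hA : ∀ a ∈ A, ∃ c ≤ 2, a = neg c) :
    Raise X n i 0 0 A A := by
  have := inert_word (X := X) (n := n) (i := i) (u := A) (by
    intro a ha
    obtain ⟨c, hc, rfl⟩ := hA a ha
    exact (inert_small hn hr hi hin hc).2)
  exact Raise.refl this.1 this.2

theorem raise_side (hn : InRange X n r) (hr : 3 ≤ r) (hi : 3 ≤ i) (hin : i ≤ n)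
    {t : List KRLetter × ℕ × List KRLetter} (ht : FreeData r t) {m : ℕ} {u v : List KRLetter}
    (h : Raise X n i m 0 u v) :
    Raise X n i m 0 (t.1 ++ u ++ t.2.2) (t.1 ++ v ++ t.2.2) :=
  (((inert_front hn hr hi hin ht.front).append (by omega) h).append (by omega)
    (inert_back hn hr hi hin ht.back)).cast (by omega) rfl rfl rfl

theorem raise_freeCol (hn : InRange X n r) (hr : 3 ≤ r) (hi : 3 ≤ i) (hin : i < n)
    {t : List KRLetter × ℕ × List KRLetter} (ht : FreeData r t) :
    Raise X n i ((if i < t.2.1 then 1 else 0) + 1) 0 (freeCol i t) (freeCol (i + 1) t) := by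
  have hrn := le_of_inRange hn
  have := ht.le
  refine raise_side hn hr hi hin.le ht (Raise.append (by omega) ?_ (raise_neg (by omega) hin))
  by_cases h : i < t.2.1
  · rw [if_pos h, min_eq_left h.le, min_eq_left (by omega : i + 1 ≤ t.2.1)]
    exact raise_holeSeg (by omega) hin hi h (by omega)
  · rw [if_neg h, min_eq_right (by omega), min_eq_right (by omega)]
    obtain ⟨h1, h2⟩ := signature_holeSeg (standard_of_lt (X := X) (by omega : 1 ≤ i) hin) (c := 3)
      (p := t.2.1) (g := t.2.1) hi (by omega) (by omega)
    exact Raise.refl (by rw [h1, if_neg (by omega)]) (by rw [h2, if_neg (by omega)])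

theorem raise_seg_last (hn : InRange X n r) (hr : 3 ≤ r) {b : ℕ} (hb : b < r) :
    Raise X n n 0 0 (seg 3 b) (seg 3 b) := by
  have hrn := le_of_inRange hn
  rcases standard_or_inert hn hr with hs | ⟨_, h⟩
  · obtain ⟨h1, h2⟩ := epsWord_seg hs (a := 3) (b := b) (by omega)
    exact Raise.refl (by rw [h1, if_neg (by omega)]) (by rw [h2, if_neg (by omega)])
  · have := inert_word (X := X) (n := n) (i := n) (u := seg 3 b) (by
      intro a ha
      obtain ⟨c, _, hc, rfl⟩ := mem_seg.mp ha
      exact (h c (by omega)).1)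
    exact Raise.refl this.1 this.2

theorem raise_freeCol_last (hn : InRange X n r) (hr : 3 ≤ r)
    {t : List KRLetter × ℕ × List KRLetter} (ht : FreeData r t) :
    Raise X n n (turnLength X) 0 (freeCol n t) (turnedCol (turn X n) t) := by
  have hrn := le_of_inRange hn
  have h1 := ht.le
  have h2 := ht.three_le
  have h3 := turn_bounds hn
  refine raise_side hn hr (by omega) le_rfl ht ?_
  rw [min_eq_right (by omega), max_eq_left (by omega), holeSeg_self]
  exact ((raise_seg_last hn hr (by omega)).append (by omega) (raise_turn hn hr)).cast
    (by omega) rfl rfl rfl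

theorem raise_turnedCol (hn : InRange X n r) (hr : 3 ≤ r) (hi : 3 ≤ i) (hin : i < n)
    {t : List KRLetter × ℕ × List KRLetter} (ht : FreeData r t) :
    Raise X n i (if t.2.1 ≤ i then 1 else 0) 0 (turnedCol (i + 1) t) (turnedCol i t) := by
  have hrn := le_of_inRange hn
  have h1 := ht.le
  have h2 := ht.three_le
  have hs := standard_of_lt (X := X) (by omega : 1 ≤ i) hin
  refine raise_side hn hr hi hin.le ht ?_
  by_cases h : t.2.1 ≤ i
  · rw [if_pos h, max_eq_left (by omega), max_eq_left h]
    obtain ⟨h3, h4⟩ := epsWord_seg hs (a := 3) (b := t.2.1 - 1) (by omega)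
    refine ((Raise.refl (p := 0) (by rw [h3, if_neg (by omega)])
      (by rw [h4, if_neg (by omega)])).append (m' := 1) (by omega) (Raise.letter ?_ ?_ ?_)).cast
      (by omega) rfl rfl rfl
    · rw [eLetter_pos (by omega) hin, if_pos rfl]
    · rw [epsLetter_pos (by omega) hin, if_pos rfl]
    · rw [phiLetter_pos (by omega) hin, if_neg (by omega)]
  · rw [if_neg h, max_eq_right (by omega), max_eq_right (by omega), ← seg_self]
    have := seg_append (a := 3) (b := t.2.1 - 1) (c := t.2.1) (by omega) (by omega)
    rw [Nat.sub_add_cancel (by omega)] at this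
    rw [this]
    obtain ⟨h3, h4⟩ := epsWord_seg hs (a := 3) (b := t.2.1) (by omega)
    exact Raise.refl (by rw [h3, if_neg (by omega)]) (by rw [h4, if_neg (by omega)])

theorem turnedCol_succ {t : List KRLetter × ℕ × List KRLetter} (h : i < t.2.1) :
    turnedCol (i + 1) t = turnedCol i t := by
  rw [turnedCol, turnedCol, max_eq_right (by omega), max_eq_right (by omega)]

theorem raise_colWord {τ : Type} (hi : 1 ≤ i) {F : List τ} {m : τ → ℕ}
    {c c' : τ → List KRLetter} (h : ∀ t ∈ F, Raise X n i (m t) 0 (c t) (c' t)) :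
    Raise X n i (F.map m).sum 0 (colWord c F) (colWord c' F) := by
  induction F with
  | nil => exact Raise.nil
  | cons t F ih =>
    simp only [List.map_cons, List.sum_cons, colWord]
    exact ((ih (fun s hs => h s (by simp [hs]))).append hi (h t (by simp))).cast
      (by omega) rfl rfl rfl

theorem epsWord_colWord {τ : Type} {F : List τ} {c : τ → List KRLetter}
    (h : ∀ t ∈ F, epsWord X n i (c t) = 0) : epsWord X n i (colWord c F) = 0 := by
  induction F with
  | nil => rfl
  | cons t F ih =>
    simp only [colWord]
    rw [epsWord_append, h t (by simp), ih (fun s hs => h s (by simp [hs]))]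
    omega

theorem phiWord_colWord {τ : Type} {F : List τ} {c : τ → List KRLetter}
    (h : ∀ t ∈ F, phiWord X n i (c t) = 0) : phiWord X n i (colWord c F) = 0 := by
  induction F with
  | nil => rfl
  | cons t F ih =>
    simp only [colWord]
    rw [phiWord_append, h t (by simp), ih (fun s hs => h s (by simp [hs]))]
    omega

theorem sum_map_indicator {τ : Type} (F : List τ) (p : τ → Prop) [DecidablePred p] :
    (F.map (fun t => if p t then 1 else 0)).sum = F.countP (fun t => decide (p t)) := by
  induction F with
  | nil => rfl
  | cons t F ih =>
    rw [List.map_cons, List.sum_cons, ih, List.countP_cons]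
    simp [Nat.add_comm]

theorem raise_freeCols (hn : InRange X n r) (hr : 3 ≤ r) (hi : 3 ≤ i) (hin : i < n)
    {F : List (List KRLetter × ℕ × List KRLetter)} (hF : ∀ t ∈ F, FreeData r t) :
    Raise X n i ((F.map (·.2.1)).countP (i < ·) + (F.map (·.2.1)).length) 0
      (colWord (freeCol i) F) (colWord (freeCol (i + 1)) F) := by
  refine (raise_colWord (by omega) fun t ht => raise_freeCol hn hr hi hin (hF t ht)).cast ?_ rfl
    rfl rfl
  rw [List.sum_map_add, sum_map_indicator, List.countP_map]
  simp
  rfl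

theorem raise_freeCols_last (hn : InRange X n r) (hr : 3 ≤ r)
    {F : List (List KRLetter × ℕ × List KRLetter)} (hF : ∀ t ∈ F, FreeData r t) :
    Raise X n n (turnLength X * (F.map (·.2.1)).length) 0
      (colWord (freeCol n) F) (colWord (turnedCol (turn X n)) F) := by
  have := le_of_inRange hn
  refine (raise_colWord (by omega) fun t ht => raise_freeCol_last hn hr (hF t ht)).cast ?_ rfl
    rfl rfl
  simp [Nat.mul_comm]

theorem raise_turnedCols (hn : InRange X n r) (hr : 3 ≤ r) (hi : 3 ≤ i) (hin : i < n)
    {F : List (List KRLetter × ℕ × List KRLetter)} (hF : ∀ t ∈ F, FreeData r t) :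
    Raise X n i ((F.map (·.2.1)).countP (· ≤ i)) 0
      (colWord (turnedCol (i + 1)) F) (colWord (turnedCol i) F) := by
  refine (raise_colWord (by omega) fun t ht => raise_turnedCol hn hr hi hin (hF t ht)).cast ?_ rfl
    rfl rfl
  rw [sum_map_indicator, List.countP_map]
  rfl

theorem raise_dotCol (hn : InRange X n r) (hr : 3 ≤ r) (hi : 3 ≤ i) (hin : i < n)
    {t : ℕ × ℕ} (hx : t.1 ≤ 2) (ht : t.2 ≤ r) :
    Raise X n i (if i < t.2 then 1 else 0) 0 (dotCol i t) (dotCol (i + 1) t) := by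
  have hrn := le_of_inRange hn
  have hA : Raise X n i 0 0 [pos t.1] [pos t.1] :=
    inert_front hn hr hi hin.le (by simpa using hx)
  refine (hA.append (m' := if i < t.2 then 1 else 0) (by omega) ?_).cast (by omega) rfl rfl rfl
  by_cases h : i < t.2
  · rw [if_pos h, min_eq_left h.le, min_eq_left (by omega : i + 1 ≤ t.2)]
    exact raise_holeSeg (by omega) hin hi h (by omega)
  · rw [if_neg h, min_eq_right (by omega), min_eq_right (by omega)]
    obtain ⟨h1, h2⟩ := signature_holeSeg (standard_of_lt (X := X) (by omega : 1 ≤ i) hin) (c := 3)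
      (p := t.2) (g := t.2) hi (by omega) (by omega)
    exact Raise.refl (h1.trans (if_neg (by omega))) (h2.trans (if_neg (by omega)))

theorem raise_dotCols (hn : InRange X n r) (hr : 3 ≤ r) (hi : 3 ≤ i) (hin : i < n)
    {D : List (ℕ × ℕ)} (hD : ∀ t ∈ D, t.1 ≤ 2 ∧ 3 ≤ t.2 ∧ t.2 ≤ r) :
    Raise X n i ((D.map (·.2)).countP (i < ·)) 0
      (colWord (dotCol i) D) (colWord (dotCol (i + 1)) D) := by
  refine (raise_colWord (by omega) fun t ht =>
    raise_dotCol hn hr hi hin (hD t ht).1 (hD t ht).2.2).cast ?_ rfl rfl rfl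
  rw [sum_map_indicator, List.countP_map]
  rfl

theorem dotCol_final {t : ℕ × ℕ} {m : ℕ} (h : t.2 ≤ m) :
    dotCol m t = pos t.1 :: seg 3 (t.2 - 1) := by
  rw [dotCol, min_eq_right h, holeSeg_self]

theorem dotCols_last (hn : InRange X n r) (hr : 3 ≤ r)
    {D : List (ℕ × ℕ)} (hD : ∀ t ∈ D, t.1 ≤ 2 ∧ 3 ≤ t.2 ∧ t.2 ≤ r) :
    Raise X n n 0 0 (colWord (dotCol n) D) (colWord (dotCol n) D) := by
  have hrn := le_of_inRange hn
  refine (raise_colWord (m := fun _ => 0) (by omega) fun t ht => ?_).cast (by simp) rfl rfl rfl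
  obtain ⟨h1, h2, h3⟩ := hD t ht
  rw [dotCol_final (by omega)]
  have hA : Raise X n n 0 0 [pos t.1] [pos t.1] :=
    inert_front hn hr (by omega) le_rfl (by simpa using h1)
  exact hA.append (by omega) (raise_seg_last hn hr (by omega))

theorem dotCols_down (hn : InRange X n r) (hr : 3 ≤ r) (hi : 3 ≤ i) (hin : i < n)
    {D : List (ℕ × ℕ)} (hD : ∀ t ∈ D, t.1 ≤ 2 ∧ 3 ≤ t.2 ∧ t.2 ≤ r) :
    epsWord X n i (colWord (dotCol n) D) = 0 ∧
    ((∀ t ∈ D, t.2 ≤ i) → phiWord X n i (colWord (dotCol n) D) = 0) := by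
  have hrn := le_of_inRange hn
  have hs := standard_of_lt (X := X) (by omega : 1 ≤ i) hin
  have key : ∀ t ∈ D, epsWord X n i (dotCol n t) = 0 ∧
      (t.2 ≤ i → phiWord X n i (dotCol n t) = 0) := by
    intro t ht
    obtain ⟨h1, h2, h3⟩ := hD t ht
    have hA : Raise X n i 0 0 [pos t.1] [pos t.1] :=
      inert_front hn hr hi hin.le (by simpa using h1)
    obtain ⟨h4, h5⟩ := epsWord_seg hs (a := 3) (b := t.2 - 1) (by omega)
    rw [dotCol_final (by omega), ← List.singleton_append, epsWord_append, phiWord_append,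
      hA.eps, hA.phi, h4, h5, if_neg (by omega)]
    refine ⟨by omega, fun h => ?_⟩
    rw [if_neg (by omega)]
  exact ⟨epsWord_colWord fun t ht => (key t ht).1,
    fun h => phiWord_colWord fun t ht => (key t ht).2 (h t ht)⟩

end FreeColumns

/-! ### Raising along a list of nodes -/

/-- `Raises X n z L u v`: the word `v` is obtained from `u` by applying, for the pairs `(i, m)` of
the list `L` in this order, `e_i` as often as possible, namely `m` times. If `z` holds, then in
addition `φ_i` vanishes before each of these steps. -/
def Raises (X : KRType) (n : ℕ) (z : Prop) :
    List (ℕ × ℕ) → List KRLetter → List KRLetter → Prop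
  | [], u, v => u = v
  | (i, m) :: L, u, v => ∃ w, (∃ p, Raise X n i m p u w ∧ (z → p = 0)) ∧ Raises X n z L w v

section Raises

variable {X : KRType} {n r : ℕ} {z : Prop}

theorem Raises.append {L L' : List (ℕ × ℕ)} {u v w : List KRLetter} (h : Raises X n z L u v)
    (h' : Raises X n z L' v w) : Raises X n z (L ++ L') u w := by
  induction L generalizing u with
  | nil => simp only [Raises] at h; subst h; simpa using h'
  | cons a L ih =>
    obtain ⟨w, hw, h⟩ := h
    exact ⟨w, hw, ih h⟩

theorem Raises.single {i m p : ℕ} {u v : List KRLetter} (h : Raise X n i m p u v)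
    (hp : z → p = 0) : Raises X n z [(i, m)] u v := ⟨v, ⟨p, h, hp⟩, rfl⟩

theorem Raises.up {a len : ℕ} {m : ℕ → ℕ} {s : ℕ → List KRLetter}
    (h : ∀ i, a ≤ i → i < a + len → ∃ p, Raise X n i (m i) p (s i) (s (i + 1)) ∧ (z → p = 0)) :
    Raises X n z ((List.range' a len).map fun i => (i, m i)) (s a) (s (a + len)) := by
  induction len generalizing a with
  | zero => simp [Raises]
  | succ len ih =>
    rw [List.range'_succ, List.map_cons]
    refine ⟨s (a + 1), h a le_rfl (by omega), ?_⟩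
    have := ih (a := a + 1) (fun i h1 h2 => h i (by omega) (by omega))
    rwa [show a + 1 + len = a + (len + 1) by omega] at this

theorem Raises.down {a len : ℕ} {m : ℕ → ℕ} {s : ℕ → List KRLetter}
    (h : ∀ i, a ≤ i → i < a + len → ∃ p, Raise X n i (m i) p (s (i + 1)) (s i) ∧ (z → p = 0)) :
    Raises X n z ((List.range' a len).reverse.map fun i => (i, m i)) (s (a + len)) (s a) := by
  induction len with
  | zero => simp [Raises]
  | succ len ih =>
    rw [List.range'_concat, List.reverse_append, List.map_append]
    simp only [List.reverse_cons, List.reverse_nil, List.nil_append, List.map_cons,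
      List.map_nil, Nat.one_mul]
    refine Raises.append ?_ (ih fun i h1 h2 => h i h1 (by omega))
    obtain ⟨p, h1, h2⟩ := h (a + len) (by omega) (by omega)
    exact Raises.single h1 h2

/-- The nodes `3, …, n, …, 3` with the exponents that move the travelling letters of the columns of
heights `H`, and the holes of columns of heights `D`. -/
def middlePath (X : KRType) (n : ℕ) (D H : List ℕ) : List (ℕ × ℕ) :=
  (List.range' 3 (n - 3)).map (fun i => (i, D.countP (i < ·) + (H.countP (i < ·) + H.length))) ++
  [(n, turnLength X * H.length)] ++
  (List.range' 3 (turn X n - 3)).reverse.map (fun i => (i, H.countP (· ≤ i)))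

/-- Raising along `3, …, n, …, 3` a word that consists of a part `pre`, of columns with a travelling
letter, and of a part `suf` that does not move, provided that the arrows of `pre` do not
block the travelling letters. -/
theorem raises_middlePath (hn : InRange X n r) (hr : 3 ≤ r) {D : List ℕ}
    {F : List (List KRLetter × ℕ × List KRLetter)} (hF : ∀ t ∈ F, FreeData r t)
    {pre : ℕ → List KRLetter} {suf : List KRLetter}
    (hup : ∀ i, 3 ≤ i → i < n → ∃ p, Raise X n i (D.countP (i < ·)) p (pre i) (pre (i + 1)) ∧
      (F = [] ∨ p = 0) ∧ (z → p = 0))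
    (hlast : ∃ p, Raise X n n 0 p (pre n) (pre n) ∧ (F = [] ∨ p = 0) ∧ (z → p = 0))
    (hdown : ∀ i, 3 ≤ i → i < n → ∃ p, Raise X n i 0 p (pre n) (pre n) ∧
      ((∀ t ∈ F, i < t.2.1) ∨ p = 0) ∧ (z → p = 0))
    (hsuf : ∀ i, 3 ≤ i → i ≤ n → epsWord X n i suf = 0) (hz : z → suf = []) :
    Raises X n z (middlePath X n D (F.map (·.2.1)))
      (pre 3 ++ colWord (freeCol 3) F ++ suf) (pre n ++ colWord (turnedCol 3) F ++ suf) := by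
  have hrn := le_of_inRange hn
  have htb := turn_bounds hn
  have hsuf' : ∀ i p, 3 ≤ i → i ≤ n → ∀ m u v, Raise X n i m p u v → (z → p = 0) →
      ∃ p, Raise X n i m p (u ++ suf) (v ++ suf) ∧ (z → p = 0) := by
    intro i p h1 h2 m u v h hp
    refine ⟨_, h.append_absorb (by omega) (hsuf i h1 h2) rfl (by omega), fun hz' => ?_⟩
    rw [hz hz', hp hz']
    rfl
  refine Raises.append (Raises.append (v := pre n ++ colWord (freeCol n) F ++ suf) ?_ ?_
    (w := pre n ++ colWord (turnedCol (turn X n)) F ++ suf)) ?_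
  · have := Raises.up (X := X) (n := n) (z := z) (a := 3) (len := n - 3)
      (m := fun i => D.countP (i < ·) + ((F.map (·.2.1)).countP (i < ·) + (F.map (·.2.1)).length))
      (s := fun i => pre i ++ colWord (freeCol i) F ++ suf) (by
        intro i h1 h2
        obtain ⟨p, e1, e2, e3⟩ := hup i h1 (by omega)
        rcases e2 with rfl | rfl
        · simpa [colWord] using hsuf' i p h1 (by omega) _ _ _ e1 e3
        · exact hsuf' i 0 h1 (by omega) _ _ _
            (e1.append (by omega) (raise_freeCols hn hr h1 (by omega) hF)) (fun _ => rfl))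
    rwa [show 3 + (n - 3) = n by omega] at this
  · obtain ⟨p, e1, e2, e3⟩ := hlast
    obtain ⟨q, e4, e5⟩ : ∃ p, Raise X n n (turnLength X * (F.map (·.2.1)).length) p
        (pre n ++ colWord (freeCol n) F ++ suf)
        (pre n ++ colWord (turnedCol (turn X n)) F ++ suf) ∧ (z → p = 0) := by
      rcases e2 with rfl | rfl
      · simpa [colWord] using hsuf' n p (by omega) le_rfl _ _ _ e1 e3
      · exact hsuf' n 0 (by omega) le_rfl _ _ _
          ((e1.append (by omega) (raise_freeCols_last hn hr hF)).cast (by omega) rfl rfl rfl)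
          (fun _ => rfl)
    exact Raises.single e4 e5
  · have := Raises.down (X := X) (n := n) (z := z) (a := 3) (len := turn X n - 3)
      (m := fun i => (F.map (·.2.1)).countP (· ≤ i))
      (s := fun i => pre n ++ colWord (turnedCol i) F ++ suf) (by
        intro i h1 h2
        obtain ⟨p, e1, e2, e3⟩ := hdown i h1 (by omega)
        have hc := raise_turnedCols hn hr h1 (by omega : i < n) hF
        rcases e2 with e2 | rfl
        · have h0 : (F.map (·.2.1)).countP (· ≤ i) = 0 := by
            rw [List.countP_eq_zero]
            intro g hg
            obtain ⟨t, ht, rfl⟩ := List.mem_map.mp hg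
            have := e2 t ht
            simpa using this
          have hw : colWord (turnedCol (i + 1)) F = colWord (turnedCol i) F :=
            colWord_congr fun t ht => turnedCol_succ (e2 t ht)
          rw [h0, hw] at hc ⊢
          refine hsuf' i _ h1 (by omega) _ _ _
            (e1.append_absorb (by omega) hc.eps hc.phi (by omega)) (fun h => ?_)
          rw [e3 h]
        · exact hsuf' i 0 h1 (by omega) _ _ _ ((e1.append (by omega) hc).cast
            (by omega) rfl rfl rfl) (fun _ => rfl))
    rwa [show 3 + (turn X n - 3) = turn X n by omega] at this

end Raises

/-! ### The two families of words exchanged by the involution -/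

/-- Distribution of `f` signs `+` over columns of heights `F`, from left to right and two for each
column. An entry `(x, g, y)` stands for the height `g`, an additional unbarred letter `x` and
an additional barred letter `y`: the first sign changes `y` from `1` to `2`, and the second one
changes `x` from `2` to `1`. -/
def freeFill : ℕ → List ℕ → List (ℕ × ℕ × ℕ)
  | _, [] => []
  | f, g :: F => (if 2 ≤ f then 1 else 2, g, if 1 ≤ f then 2 else 1) :: freeFill (f - 2) F

/-- Distribution of `f` signs `+` over columns of heights `D`, from left to right and one for each
column. An entry `(x, h)` stands for the height `h` and an additional unbarred letter `x`, which
is changed from `2` to `1` by a sign. -/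
def dotFill : ℕ → List ℕ → List (ℕ × ℕ)
  | _, [] => []
  | f, h :: D => (if 1 ≤ f then 1 else 2, h) :: dotFill (f - 1) D

/-- The data of a column `freeCol` given by an entry of `freeFill`. -/
def toFree (t : ℕ × ℕ × ℕ) : List KRLetter × ℕ × List KRLetter := ([pos t.1], t.2.1, [neg t.2.2])

/-- The column that becomes `freeCol 3 (toFree t)` under `e_2`. -/
def freeStart (t : ℕ × ℕ × ℕ) : List KRLetter :=
  (if t.1 = 1 then pos 1 :: seg 4 t.2.1 else seg 3 t.2.1) ++
    if t.2.2 = 2 then [neg 3, neg 2] else [neg 2, neg 1]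

/-- The column that becomes `dotCol 3 t` under `e_2`. -/
def dotStart (t : ℕ × ℕ) : List KRLetter :=
  if t.1 = 1 then pos 1 :: seg 4 t.2 else seg 3 t.2

/-- The data of a step of a `0`-string through a classical highest weight element: the heights, from
left to right, of the columns different from `1` are `Ft`, `Gt`, `Gl`, and there are
`a + b` columns of height `1`. Two dominoes have been involved for the columns in `Ft`, one for
the columns in `Gl` and for `b` of the columns of height `1`, none for the others. -/
structure Config (r : ℕ) (Ft Gt Gl : List ℕ) (b : ℕ) : Prop where
  sorted : (Ft ++ (Gt ++ Gl)).Pairwise (· ≥ ·)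
  bounds : ∀ g ∈ Ft ++ (Gt ++ Gl), 3 ≤ g ∧ g ≤ r
  odd : ∀ g ∈ Ft ++ (Gt ++ Gl), g % 2 = 1
  top : Gt = [] ∨ (Ft = [] ∧ b = 0)
  low : b = 0 ∨ Gl = []

/-- The word of an element of the `1`-string through the image of the highest weight element. -/
def sWord (Ft Gt Gl : List ℕ) (a b : ℕ) : List KRLetter :=
  List.replicate a (neg 1) ++ kWord (Gt ++ Gl) (List.replicate Gl.length 2) ++
    (List.replicate b (neg 2) ++ kWord Ft (List.replicate (2 * Ft.length) 2))

/-- The `{2, …, n}`-highest word above `sWord`. -/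
def sTop (Ft Gt Gl : List ℕ) (a b : ℕ) : List KRLetter :=
  List.replicate a (neg 1) ++ kWord (Gt ++ Gl) Gl ++
    (List.replicate b (pos 2) ++ colWord (seg 1) Ft)

/-- The columns of `rWord` in which a domino has been removed, and those with two barred letters. -/
def rDots (Ft Gl : List ℕ) (a b : ℕ) : List (ℕ × ℕ) :=
  dotFill (a + b - 2 * (Ft ++ List.replicate b 3).length) (Gl ++ List.replicate a 3)

/-- The word of an element of the `0`-string through the highest weight element. -/
def rWord (Ft Gt Gl : List ℕ) (a b : ℕ) : List KRLetter :=
  colWord dotStart (rDots Ft Gl a b) ++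
    colWord freeStart (freeFill (a + b) (Ft ++ List.replicate b 3)) ++ colWord (seg 1) Gt

/-- The `{2, …, n}`-highest word above `rWord`. -/
def rTop (n : ℕ) (Ft Gt Gl : List ℕ) (a b : ℕ) : List KRLetter :=
  colWord (dotCol n) (rDots Ft Gl a b) ++
    kWord (Ft ++ List.replicate b 3) (List.replicate b 3 ++
      List.replicate (min (a + b) (2 * (Ft ++ List.replicate b 3).length) - b) 2) ++
    colWord (seg 1) Gt

/-- The common path from `sWord` to `sTop` and from `rWord` to `rTop`. -/
def topPath (X : KRType) (n : ℕ) (Ft Gl : List ℕ) (b : ℕ) : List (ℕ × ℕ) :=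
  (2, Gl.length + (b + 2 * Ft.length)) ::
    (middlePath X n Gl (Ft ++ List.replicate b 3) ++ [(2, b)])

section Fill

theorem freeFill_heights (f : ℕ) (F : List ℕ) : (freeFill f F).map (·.2.1) = F := by
  induction F generalizing f with
  | nil => rfl
  | cons g F ih => simp [freeFill, ih]

theorem dotFill_heights (f : ℕ) (D : List ℕ) : (dotFill f D).map (·.2) = D := by
  induction D generalizing f with
  | nil => rfl
  | cons g F ih => simp [dotFill, ih]

theorem mem_freeFill {f : ℕ} {F : List ℕ} {t : ℕ × ℕ × ℕ} (h : t ∈ freeFill f F) :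
    (t.1 = 1 ∨ t.1 = 2) ∧ t.2.1 ∈ F ∧ (t.2.2 = 1 ∨ t.2.2 = 2) := by
  induction F generalizing f with
  | nil => simp [freeFill] at h
  | cons g F ih =>
    rw [freeFill, List.mem_cons] at h
    rcases h with rfl | h
    · refine ⟨?_, by simp, ?_⟩ <;> simp only <;> split_ifs <;> simp
    · obtain ⟨h1, h2, h3⟩ := ih h
      exact ⟨h1, by simp [h2], h3⟩

theorem mem_dotFill {f : ℕ} {D : List ℕ} {t : ℕ × ℕ} (h : t ∈ dotFill f D) :
    (t.1 = 1 ∨ t.1 = 2) ∧ t.2 ∈ D := by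
  induction D generalizing f with
  | nil => simp [dotFill] at h
  | cons g F ih =>
    rw [dotFill, List.mem_cons] at h
    rcases h with rfl | h
    · refine ⟨?_, by simp⟩; simp only; split_ifs <;> simp
    · obtain ⟨h1, h2⟩ := ih h
      exact ⟨h1, by simp [h2]⟩

theorem kWord_replicate (c : ℕ) (G : List ℕ) :
    kWord G (List.replicate (2 * G.length) c) = colWord (fun g => kCol g c c) G := by
  induction G with
  | nil => rfl
  | cons g G ih =>
    have h : List.replicate (2 * (g :: G).length) c = c :: c :: List.replicate (2 * G.length) c := by
      rw [List.length_cons, Nat.mul_succ, List.replicate_succ, List.replicate_succ]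
    rw [h]
    simp [kWord, colWord, ih]

/-- The columns of `F` read the first `2 |F|` values, those of `G` the others. -/
theorem kWord_append {F G P Q : List ℕ} (h : P.length = 2 * F.length) :
    kWord (F ++ G) (P ++ Q) = kWord G Q ++ kWord F P := by
  induction F generalizing P with
  | nil =>
    have : P = [] := List.length_eq_zero_iff.mp (by simpa using h)
    simp [this, kWord]
  | cons g F ih =>
    match P, h with
    | p1 :: p2 :: P, h =>
      simp only [List.length_cons] at h
      simp [kWord, ih (P := P) (by omega)]

/-- The columns of `freeFill` after raising them. -/
theorem colWord_freeFill (f : ℕ) {F : List ℕ} (hF : ∀ g ∈ F, 3 ≤ g) :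
    colWord (fun t => turnedCol 3 (toFree t)) (freeFill f F) =
      kWord F (List.replicate (min f (2 * F.length)) 2) := by
  have key : ∀ x g y : ℕ, (x = 1 ∨ x = 2) → 3 ≤ g →
      turnedCol 3 (toFree (x, g, y)) = kCol g (3 - x) y := by
    intro x g y hx hg
    have h1 := seg_append (a := 3) (b := g - 1) (c := g) (by omega) (by omega)
    rw [Nat.sub_add_cancel (by omega), seg_self] at h1
    simp only [turnedCol, toFree, kCol, max_eq_right hg, h1, holeSeg]
    rcases hx with rfl | rfl
    · simp [seg_self]
    · have : seg 2 g = pos 2 :: seg 3 g := seg_cons (by omega)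
      simp [this, seg_of_lt]
  induction F generalizing f with
  | nil => rfl
  | cons g F ih =>
    have hg := hF g (by simp)
    simp only [freeFill, colWord, kWord]
    rw [ih (f - 2) (fun g hg => hF g (by simp [hg]))]
    congr 1
    · congr 1
      rw [List.drop_replicate]
      congr 1
      simp only [List.length_cons]
      omega
    · rw [key _ _ _ (by split_ifs <;> simp) hg]
      match f with
      | 0 => simp
      | 1 =>
        have : min 1 (2 * (g :: F).length) = 1 := by simp only [List.length_cons]; omega
        rw [this]
        simp
      | f + 2 =>
        have : min (f + 2) (2 * (g :: F).length) = (min f (2 * F.length)) + 2 := by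
          simp only [List.length_cons]; omega
        rw [this]
        simp [List.replicate_succ]

end Fill

section Signatures

variable {X : KRType} {n r i : ℕ}

theorem epsWord_append_le (u v : List KRLetter) :
    epsWord X n i (u ++ v) ≤ epsWord X n i u + epsWord X n i v := by
  rw [epsWord_append]; omega

/-- A column all of whose `ε_i` can be bracketed with arrows of the part to its left. -/
theorem absorb {u v : List KRLetter} {s t : ℕ} (hu : epsWord X n i u = 0)
    (hu' : s + t ≤ phiWord X n i u) (hv : epsWord X n i v ≤ t) :
    epsWord X n i (u ++ v) = 0 ∧ s ≤ phiWord X n i (u ++ v) := by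
  rw [epsWord_append, phiWord_append]
  omega

/-- If the signs `+` raise `ε_i` of a column by at most one, and the columns of height three without
a sign contribute to `φ_i`, then the arrows of the columns cancel. -/
theorem dotFill_budget {c : ℕ × ℕ → List KRLetter} {D : List ℕ} {a f : ℕ} (hf : f ≤ a)
    (h1 : ∀ h ∈ D, epsWord X n i (c (1, h)) ≤ 1) (h2 : ∀ h ∈ D, epsWord X n i (c (2, h)) = 0)
    (h3 : epsWord X n i (c (1, 3)) = 0)
    (h4 : epsWord X n i (c (2, 3)) = 0 ∧ 1 ≤ phiWord X n i (c (2, 3))) :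
    epsWord X n i (colWord c (dotFill f (D ++ List.replicate a 3))) = 0 ∧
    a - f ≤ phiWord X n i (colWord c (dotFill f (D ++ List.replicate a 3))) := by
  induction D generalizing f with
  | nil =>
    clear h1 h2
    rw [List.nil_append]
    induction a generalizing f with
    | zero => simp [dotFill, colWord, epsWord]
    | succ a ih =>
      simp only [List.replicate_succ, dotFill, colWord]
      obtain ⟨e1, e2⟩ := ih (f := f - 1) (by omega)
      rw [epsWord_append, phiWord_append]
      by_cases hf1 : 1 ≤ f
      · rw [if_pos hf1]
        omega
      · rw [if_neg hf1]
        omega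
  | cons h D ih =>
    simp only [List.cons_append, dotFill, colWord]
    obtain ⟨e1, e2⟩ := ih (f := f - 1) (by omega) (fun h hh => h1 h (by simp [hh]))
      (fun h hh => h2 h (by simp [hh]))
    by_cases hf1 : 1 ≤ f
    · rw [if_pos hf1]
      exact absorb e1 (t := 1) (by omega) (h1 h (by simp))
    · rw [if_neg hf1]
      exact absorb e1 (t := 0) (by omega) (h2 h (by simp)).le

theorem dotStart_eps (hn : InRange X n r) (hr : 3 ≤ r) (hi : 3 ≤ i) (hin : i ≤ n) {h : ℕ}
    (hh : h ≤ r) :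
    epsWord X n i (dotStart (2, h)) = 0 ∧
    (epsWord X n i (dotStart (1, h)) = if i = 3 ∧ 4 ≤ h then 1 else 0) ∧
    (h = 3 → i = 3 → phiWord X n i (dotStart (2, h)) = 1 ∧ epsWord X n i (dotStart (1, h)) = 0) := by
  have hrn := le_of_inRange hn
  simp only [dotStart, if_true, if_neg (by norm_num : ¬ (2 : ℕ) = 1)]
  have h1 := (inert_small hn hr hi hin (c := 1) (by omega)).1
  rw [← List.singleton_append, epsWord_append, phiWord_singleton, epsWord_singleton, h1.1, h1.2]
  have hs : Standard X n i → epsWord X n i (seg 3 h) = 0 ∧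
      (0 + (epsWord X n i (seg 4 h) - 0) = if i = 3 ∧ 4 ≤ h then 1 else 0) ∧
      (h = 3 → i = 3 → phiWord X n i (seg 3 h) = 1 ∧ 0 + (epsWord X n i (seg 4 h) - 0) = 0) := by
    intro hs
    obtain ⟨a1, a2⟩ := epsWord_seg hs (a := 3) (b := h) (by omega)
    obtain ⟨a3, a4⟩ := epsWord_seg hs (a := 4) (b := h) (by omega)
    rw [a1, a2, a3]
    grind
  rcases Nat.lt_or_ge i n with hin' | hin'
  · exact hs (standard_of_lt (by omega) hin')
  · obtain rfl : i = n := by omega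
    rcases standard_or_inert hn hr with h2 | ⟨hlt, h2⟩
    · exact hs h2
    · have : ∀ b, epsWord X i i (seg b h) = 0 := fun b => epsWord_eq_zero_of_letters (by
        intro x hx
        obtain ⟨c, _, hc, rfl⟩ := mem_seg.mp hx
        exact (h2 c (by omega)).1.1)
      rw [this, this]
      grind

theorem eps_neg_pair (hn : InRange X n r) (hr : 3 ≤ r) (hi : 3 ≤ i) (hin : i ≤ n) :
    epsWord X n i [neg 3, neg 2] = (if i = 3 then 1 else 0) ∧ epsWord X n i [neg 2, neg 1] = 0 ∧
    phiWord X n i [neg 3, neg 2] = 0 ∧ phiWord X n i [neg 2, neg 1] = 0 := by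
  have hrn := le_of_inRange hn
  have h1 := (inert_small hn hr hi hin (c := 1) (by omega)).2
  have h2 := (inert_small hn hr hi hin (c := 2) (by omega)).2
  simp only [epsWord, phiWord, h1, h2]
  have hs : epsLetter X n i (neg 3) = (if i = 3 then 1 else 0) ∧ phiLetter X n i (neg 3) = 0 := by
    have hs : Standard X n i → epsLetter X n i (neg 3) = (if i = 3 then 1 else 0) ∧
        phiLetter X n i (neg 3) = 0 := by
      intro hs
      rw [hs.eps_neg 3 (by omega), hs.phi_neg 3 (by omega)]
      grind
    rcases Nat.lt_or_ge i n with hin' | hin'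
    · exact hs (standard_of_lt (by omega) hin')
    · obtain rfl : i = n := by omega
      rcases standard_or_inert hn hr with h2 | ⟨hlt, h2⟩
      · exact hs h2
      · rw [(h2 3 hr).2.1, (h2 3 hr).2.2, if_neg (by omega)]
        exact ⟨rfl, rfl⟩
  rw [hs.1, hs.2]
  simp

/-- The words `rWord` are highest for the nodes `3, …, n`: the arrows of the columns that have
received a sign are bracketed with those of the columns of height three that have not. -/
theorem rWord_budget (hn : InRange X n r) (hr : 3 ≤ r) {Ft Gl : List ℕ}
    {a b : ℕ} (hF : ∀ g ∈ Ft, 3 ≤ g ∧ g ≤ r) (hG : ∀ g ∈ Gl, 3 ≤ g ∧ g ≤ r) {f : ℕ}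
    (hf : f ≤ a + b) :
    epsWord X n 3 (colWord dotStart (dotFill (f - 2 * (Ft ++ List.replicate b 3).length)
      (Gl ++ List.replicate a 3)) ++ colWord freeStart (freeFill f (Ft ++ List.replicate b 3))) = 0 ∧
    a + b - f ≤ phiWord X n 3 (colWord dotStart (dotFill (f - 2 * (Ft ++ List.replicate b 3).length)
      (Gl ++ List.replicate a 3)) ++
        colWord freeStart (freeFill f (Ft ++ List.replicate b 3))) := by
  have hrn := le_of_inRange hn
  obtain ⟨n1, n2, n3, n4⟩ := eps_neg_pair hn hr le_rfl (by omega : 3 ≤ n)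
  rw [if_pos rfl] at n1
  have d : ∀ h ≤ r, _ := fun h hh => dotStart_eps (X := X) (h := h) hn hr le_rfl
    (by omega : 3 ≤ n) hh
  have hstart : ∀ x g y, freeStart (x, g, y) = dotStart (x, g) ++
    if y = 2 then [neg 3, neg 2] else [neg 2, neg 1] := fun _ _ _ => rfl
  induction Ft generalizing f with
  | nil =>
    rw [List.nil_append]
    induction b generalizing f with
    | zero =>
      simp only [List.replicate_zero, freeFill, colWord, List.append_nil, List.length_nil,
        Nat.mul_zero, Nat.sub_zero, Nat.add_zero]
      refine dotFill_budget (by omega) (fun h hh => ?_) (fun h hh => ?_) ?_ ?_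
      · rw [(d h (hG h hh).2).2.1]; split_ifs <;> omega
      · exact (d h (hG h hh).2).1
      · exact ((d 3 hr).2.2 rfl rfl).2
      · exact ⟨(d 3 hr).1, by rw [((d 3 hr).2.2 rfl rfl).1]⟩
    | succ b ih =>
      obtain ⟨e1, e2⟩ := ih (f := f - 2) (by omega)
      have hl : f - 2 * (List.replicate (b + 1) 3).length =
          f - 2 - 2 * (List.replicate b 3).length := by simp; omega
      obtain ⟨p1, p2⟩ := (d 3 hr).2.2 rfl rfl
      have p3 := (d 3 hr).1
      rw [hl, List.replicate_succ]
      simp only [freeFill, colWord, hstart]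
      rw [← List.append_assoc]
      revert e1 e2
      generalize colWord dotStart _ ++ colWord freeStart _ = w
      intro e1 e2
      simp only [epsWord_append, phiWord_append, e1]
      match f, hf with
      | 0, _ =>
        simp only [Nat.not_ofNat_le_one, Nat.reduceLeDiff, if_false, OfNat.one_ne_ofNat,
          p1, p3, n2, n4]
        omega
      | 1, _ =>
        simp only [Nat.not_ofNat_le_one, Nat.reduceLeDiff, le_refl, if_true, if_false, p1, p3, n1,
          n3]
        omega
      | f + 2, _ =>
        have h1 : 1 ≤ f + 2 := by omega
        simp only [h1, Nat.le_add_left, if_true, p2, n1, n3]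
        omega
  | cons g F ih =>
    obtain ⟨e1, e2⟩ := ih (f := f - 2) (fun g hg => hF g (by simp [hg])) (by omega)
    have hl : f - 2 * (g :: F ++ List.replicate b 3).length =
        f - 2 - 2 * (F ++ List.replicate b 3).length := by simp; omega
    obtain ⟨q1, q2, _⟩ := d g (hF g (by simp)).2
    have q3 : epsWord X n 3 (dotStart (1, g)) ≤ 1 := by rw [q2]; split_ifs <;> omega
    rw [hl, List.cons_append]
    simp only [freeFill, colWord, hstart]
    rw [← List.append_assoc]
    match f, hf with
    | 0, _ =>
      refine absorb e1 (t := 0) (by omega) ?_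
      simp only [Nat.not_ofNat_le_one, Nat.reduceLeDiff, if_false, OfNat.one_ne_ofNat]
      have := epsWord_append_le (X := X) (n := n) (i := 3) (dotStart (2, g)) [neg 2, neg 1]
      omega
    | 1, _ =>
      refine absorb e1 (t := 1) (by omega) ?_
      simp only [Nat.not_ofNat_le_one, le_refl, if_true, if_false]
      have := epsWord_append_le (X := X) (n := n) (i := 3) (dotStart (2, g)) [neg 3, neg 2]
      omega
    | f + 2, _ =>
      have h1 : 1 ≤ f + 2 := by omega
      refine absorb e1 (t := 2) (by omega) ?_
      simp only [h1, Nat.le_add_left, if_true]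
      have := epsWord_append_le (X := X) (n := n) (i := 3) (dotStart (1, g)) [neg 3, neg 2]
      omega

end Signatures

/-! ### Raising the two families -/

section Kit

variable {X : KRType} {n r i : ℕ}

theorem Raise.replicate (hi : 1 ≤ i) {x y : KRLetter} (h : Raise X n i 1 0 [x] [y]) (b : ℕ) :
    Raise X n i b 0 (List.replicate b x) (List.replicate b y) := by
  induction b with
  | zero => exact Raise.nil
  | succ b ih =>
    rw [List.replicate_succ, List.replicate_succ]
    exact (h.append hi ih).cast (by omega) rfl rfl rfl

theorem mem_kWord {G P : List ℕ} (hG : ∀ g ∈ G, g ≤ r) (hP : ∀ p ∈ P, p ≤ r) (hr : 1 ≤ r)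
    {a : KRLetter} (ha : a ∈ kWord G P) : ∃ c ≤ r, a = pos c ∨ a = neg c := by
  induction G generalizing P with
  | nil => simp [kWord] at ha
  | cons g G ih =>
    have hgetD : ∀ s, P.getD s 1 ≤ r := by
      intro s
      rw [List.getD_eq_getElem?_getD]
      cases h : P[s]? with
      | none => simpa using hr
      | some p => exact hP p (List.mem_of_getElem? h)
    rw [kWord, List.mem_append] at ha
    rcases ha with ha | ha
    · exact ih (fun g hg => hG g (by simp [hg]))
        (fun p hp => hP p ((List.drop_sublist 2 P).mem hp)) ha
    · rw [kCol, holeSeg, List.mem_append, List.mem_append, mem_seg, mem_seg] at ha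
      have := hG g (by simp)
      rcases ha with (⟨c, h1, h2, rfl⟩ | ⟨c, h1, h2, rfl⟩) | ha
      · by_cases hc : c ≤ r
        · exact ⟨c, hc, Or.inl rfl⟩
        · have := hgetD 1
          omega
      · exact ⟨c, by omega, Or.inl rfl⟩
      · exact ⟨_, hgetD 0, Or.inr (by simpa using ha)⟩

/-- Blocked columns at any of the nodes `2, …, n`. -/
theorem kWord_fixed (hn : InRange X n r) (hr : 3 ≤ r) (hi : 2 ≤ i) (hin : i ≤ n)
    {G P : List ℕ} (hG : G.Pairwise (· ≥ ·)) (hGr : ∀ g ∈ G, 1 ≤ g ∧ g ≤ r) (hP : P <:+ G) :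
    epsWord X n i (kWord G P) = 0 ∧
    (G = P → (∀ p ∈ P, p ≤ i) → phiWord X n i (kWord G P) = 0) := by
  have hrn := le_of_inRange hn
  have hs : Standard X n i → epsWord X n i (kWord G P) = 0 ∧
      (G = P → (∀ p ∈ P, p ≤ i) → phiWord X n i (kWord G P) = 0) := by
    intro hs
    obtain ⟨h1, _, h2⟩ := kWord_blocked hs hi hG (fun g hg => ⟨(hGr g hg).1,
      (hGr g hg).2.trans hrn⟩) hP
    refine ⟨h1, fun he h => ?_⟩
    rw [h2 h, he, Nat.sub_self]
  rcases Nat.lt_or_ge i n with h | h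
  · exact hs (standard_of_lt (by omega) h)
  · obtain rfl : i = n := by omega
    rcases standard_or_inert hn hr with h | ⟨_, h⟩
    · exact hs h
    · have := inert_word (X := X) (n := i) (i := i) (u := kWord G P) (by
        intro a ha
        obtain ⟨c, hc, rfl | rfl⟩ := mem_kWord (r := r) (fun g hg => (hGr g hg).2)
          (fun p hp => (hGr p (hP.mem hp)).2) (by omega) ha
        · exact (h c hc).1
        · exact (h c hc).2)
      exact ⟨this.1, fun _ _ => this.2⟩

theorem epsWord_segOne (hn : InRange X n r) (hr : 3 ≤ r) (hi : 1 ≤ i) (hin : i ≤ n) {g : ℕ}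
    (hg : g ≤ r) : epsWord X n i (seg 1 g) = 0 := by
  have hrn := le_of_inRange hn
  have hs : Standard X n i → epsWord X n i (seg 1 g) = 0 := by
    intro hs
    rw [(epsWord_seg hs (by omega)).1, if_neg (by omega)]
  rcases Nat.lt_or_ge i n with h | h
  · exact hs (standard_of_lt (by omega) h)
  · obtain rfl : i = n := by omega
    rcases standard_or_inert hn hr with h | ⟨_, h⟩
    · exact hs h
    · refine epsWord_eq_zero_of_letters fun a ha => ?_
      obtain ⟨c, _, hc, rfl⟩ := mem_seg.mp ha
      exact (h c (by omega)).1.1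

theorem epsWord_segs (hn : InRange X n r) (hr : 3 ≤ r) (hi : 1 ≤ i) (hin : i ≤ n) {G : List ℕ}
    (hG : ∀ g ∈ G, g ≤ r) : epsWord X n i (colWord (seg 1) G) = 0 :=
  epsWord_colWord fun g hg => epsWord_segOne hn hr hi hin (hG g hg)

/-- Columns with holes and barred letters at most two are highest for the nodes `3, …, n`. -/
theorem epsWord_kWord_small (hn : InRange X n r) (hr : 3 ≤ r) (hi : 3 ≤ i) (hin : i ≤ n)
    {G P : List ℕ} (hG : ∀ g ∈ G, g ≤ r) (hP : ∀ p ∈ P, p ≤ 2) :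
    epsWord X n i (kWord G P) = 0 := by
  have hrn := le_of_inRange hn
  have hs : Standard X n i → epsWord X n i (kWord G P) = 0 := by
    intro hs
    induction G generalizing P with
    | nil => rfl
    | cons g G ih =>
      have hgetD : ∀ s, P.getD s 1 ≤ 2 := by
        intro s
        rw [List.getD_eq_getElem?_getD]
        cases h : P[s]? with
        | none => simp
        | some p => exact hP p (List.mem_of_getElem? h)
      have h0 := hgetD 0
      have h1 := hgetD 1
      have hg := hG g (by simp)
      rw [kWord, epsWord_append, ih (fun g hg => hG g (by simp [hg]))
        (fun p hp => hP p ((List.drop_sublist 2 P).mem hp)),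
        (signature_kCol hs (by omega) (by omega) (by omega)).1, if_neg (by omega),
        if_neg (by omega)]
      omega
  rcases Nat.lt_or_ge i n with h | h
  · exact hs (standard_of_lt (by omega) h)
  · obtain rfl : i = n := by omega
    rcases standard_or_inert hn hr with h | ⟨_, h⟩
    · exact hs h
    · refine epsWord_eq_zero_of_letters fun a ha => ?_
      obtain ⟨c, hc, rfl | rfl⟩ := mem_kWord (r := r) hG (fun p hp => (hP p hp).trans (by omega))
        (by omega) ha
      · exact (h c hc).1.1
      · exact (h c hc).2.1

theorem raise_replicate_neg_one (hn : 3 ≤ n) (a : ℕ) :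
    Raise X n 2 0 0 (List.replicate a (neg 1)) (List.replicate a (neg 1)) := by
  have := inert_word (X := X) (n := n) (i := 2) (u := List.replicate a (neg 1)) (by
    intro x hx
    obtain ⟨_, rfl⟩ := List.mem_replicate.mp hx
    simp [epsLetter_neg (by omega : 1 ≤ 2) (by omega : 2 < n),
      phiLetter_neg (by omega : 1 ≤ 2) (by omega : 2 < n)])
  exact Raise.refl this.1 this.2

end Kit

section SWord

variable {X : KRType} {n r a b : ℕ} {Ft Gt Gl : List ℕ}

namespace Config

theorem sortedG (h : Config r Ft Gt Gl b) : (Gt ++ Gl).Pairwise (· ≥ ·) :=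
  (List.pairwise_append.mp h.sorted).2.1

theorem boundsF (h : Config r Ft Gt Gl b) : ∀ g ∈ Ft, 3 ≤ g ∧ g ≤ r :=
  fun g hg => h.bounds g (by simp [hg])

theorem boundsG (h : Config r Ft Gt Gl b) : ∀ g ∈ Gt ++ Gl, 3 ≤ g ∧ g ≤ r :=
  fun g hg => h.bounds g (List.mem_append_right _ hg)

theorem boundsGl (h : Config r Ft Gt Gl b) : ∀ g ∈ Gl, 3 ≤ g ∧ g ≤ r :=
  fun g hg => h.bounds g (by simp [hg])

theorem boundsGt (h : Config r Ft Gt Gl b) : ∀ g ∈ Gt, 3 ≤ g ∧ g ≤ r :=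
  fun g hg => h.bounds g (by simp [hg])

theorem le_of_mem (h : Config r Ft Gt Gl b) {f g : ℕ} (hf : f ∈ Ft) (hg : g ∈ Gl) : g ≤ f :=
  (List.pairwise_append.mp h.sorted).2.2 f hf g (by simp [hg])

end Config

theorem raise_kCol_two (hn : 3 ≤ n) {g : ℕ} (hg : 3 ≤ g) (hgn : g ≤ n) :
    Raise X n 2 2 0 (kCol g 2 2) (kCol g 3 3) :=
  (raise_holeSeg (X := X) (by omega) (by omega) (by omega) (by omega) hgn).append (by omega)
    (raise_neg (by omega) (by omega))

/-- Raising `sWord` to `sTop`. -/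
theorem raises_sWord (hn : InRange X n r) (hr : 3 ≤ r) (h : Config r Ft Gt Gl b) :
    Raises X n False (topPath X n Ft Gl b) (sWord Ft Gt Gl a b) (sTop Ft Gt Gl a b) := by
  have hrn := le_of_inRange hn
  have hb : ∀ g ∈ Gt ++ Gl, 1 ≤ g ∧ g ≤ n := fun g hg => by have := h.boundsG g hg; omega
  have hsuf : Gl <:+ Gt ++ Gl := List.suffix_append _ _
  -- The columns with a travelling letter: those of `Ft`, with the letters `1, 2` above it, and the
  -- single boxes of the `b` columns of height 1, treated as columns of height 3 with nothing above.
  let F : List (List KRLetter × ℕ × List KRLetter) :=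
    Ft.map (fun g => ([pos 1, pos 2], g, [])) ++ List.replicate b ([], 3, [])
  have hF : ∀ t ∈ F, FreeData r t := by
    intro t ht
    rcases List.mem_append.mp ht with ht | ht
    · obtain ⟨g, hg, rfl⟩ := List.mem_map.mp ht
      refine ⟨(h.boundsF g hg).1, (h.boundsF g hg).2, ?_, by simp⟩
      intro a ha
      simp only [List.mem_cons, List.not_mem_nil, or_false] at ha
      rcases ha with rfl | rfl
      · exact ⟨1, by omega, rfl⟩
      · exact ⟨2, by omega, rfl⟩
    · obtain ⟨_, rfl⟩ := List.mem_replicate.mp ht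
      exact ⟨le_rfl, hr, by simp, by simp⟩
  have hFh : F.map (·.2.1) = Ft ++ List.replicate b 3 := by
    simp [F, Function.comp_def]
  have hFnil : F = [] ∨ Gt = [] := by
    rcases h.top with h1 | ⟨h1, h2⟩
    · exact Or.inr h1
    · left; simp [F, h1, h2]
  -- The other columns, after their letters have been raised up to level `i`.
  let pre : ℕ → List KRLetter := fun i =>
    List.replicate a (neg 1) ++ kWord (Gt ++ Gl) (Gl.map (min i))
  have hpre : pre n = List.replicate a (neg 1) ++ kWord (Gt ++ Gl) Gl := by
    have : Gl.map (min n) = Gl := by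
      refine (List.map_congr_left (g := id) fun g hg => ?_).trans (List.map_id _)
      exact min_eq_right (hb g (List.mem_append_right _ hg)).2
    simp only [pre, this]
  have hone : ∀ i, 3 ≤ i → i ≤ n →
      Raise X n i 0 0 (List.replicate a (neg 1)) (List.replicate a (neg 1)) := by
    intro i h1 h2
    refine inert_back hn hr h1 h2 fun x hx => ?_
    obtain ⟨_, rfl⟩ := List.mem_replicate.mp hx
    exact ⟨1, by omega, rfl⟩
  have hfix : ∀ i, 3 ≤ i → i ≤ n → ∃ p, Raise X n i 0 p (pre n) (pre n) ∧
      (Gt = [] → (∀ g ∈ Gl, g ≤ i) → p = 0) := by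
    intro i h1 h2
    rw [hpre]
    obtain ⟨e1, e2⟩ := kWord_fixed hn hr (by omega : 2 ≤ i) h2 h.sortedG
      (fun g hg => ⟨(hb g hg).1, (h.boundsG g hg).2⟩) hsuf
    refine ⟨_, (hone i h1 h2).append (by omega) (Raise.refl e1 rfl), fun h3 h4 => ?_⟩
    exact e2 (by simp [h3]) h4
  have hmid := raises_middlePath (X := X) (z := False) (D := Gl) hn hr hF (pre := pre) (suf := [])
    (fun i h1 h2 => by
      have e := kWord_raise (X := X) (by omega : 2 ≤ i) h2 h.sortedG hb hsuf
      refine ⟨_, ((hone i h1 h2.le).append (by omega) e).cast (by omega) rfl rfl rfl, ?_, by simp⟩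
      rcases hFnil with h3 | h3
      · exact Or.inl h3
      · right; simp [h3])
    (by
      obtain ⟨p, e1, e2⟩ := hfix n (by omega) le_rfl
      refine ⟨p, e1, ?_, by simp⟩
      rcases hFnil with h3 | h3
      · exact Or.inl h3
      · exact Or.inr (e2 h3 fun g hg => (hb g (by simp [hg])).2))
    (fun i h1 h2 => by
      obtain ⟨p, e1, e2⟩ := hfix i h1 h2.le
      refine ⟨p, e1, ?_, by simp⟩
      rcases hFnil with h3 | h3
      · left; simp [h3]
      · by_cases h4 : ∀ g ∈ Gl, g ≤ i
        · exact Or.inr (e2 h3 h4)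
        · left
          push Not at h4
          obtain ⟨g, hg, hgi⟩ := h4
          have hb0 : b = 0 := by
            rcases h.low with h5 | h5
            · exact h5
            · simp [h5] at hg
          intro t ht
          simp only [F, hb0, List.replicate_zero, List.append_nil] at ht
          obtain ⟨f, hf, rfl⟩ := List.mem_map.mp ht
          exact hgi.trans_le (h.le_of_mem hf hg))
    (fun _ _ _ => rfl) (by simp)
  rw [hFh] at hmid
  have hmin : Gl.map (min 2) = List.replicate Gl.length 2 := by
    rw [List.eq_replicate_iff]
    refine ⟨by simp, fun x hx => ?_⟩
    obtain ⟨g, hg, rfl⟩ := List.mem_map.mp hx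
    have := h.boundsGl g hg
    omega
  refine ⟨pre 3 ++ colWord (freeCol 3) F, ⟨0, ?_, by simp⟩, Raises.append
    (v := pre n ++ colWord (turnedCol 3) F) (by simpa using hmid) ?_⟩
  · have e1 := kWord_raise (X := X) (by omega : 2 ≤ 2) (by omega : 2 < n) h.sortedG hb hsuf
    have e2 := Raise.replicate (X := X) (n := n) (by omega) (raise_neg (by omega : 1 ≤ 2)
      (by omega)) b
    have e3 := raise_colWord (X := X) (n := n) (i := 2) (by omega) (F := Ft) (m := fun _ => 2)
      (c := fun g => kCol g 2 2) (c' := fun g => kCol g 3 3) (fun g hg =>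
        raise_kCol_two (by omega) (h.boundsF g hg).1 ((h.boundsF g hg).2.trans hrn))
    have h0 : (Gt ++ Gl).count 2 = 0 := by
      rw [List.count_eq_zero]
      intro hm
      have := h.boundsG 2 hm
      omega
    have h1 : Gl.countP (2 < ·) = Gl.length := by
      rw [List.countP_eq_length]
      intro g hg
      have := h.boundsGl g hg
      simp; omega
    rw [h0, Nat.zero_sub, hmin, h1] at e1
    refine (((raise_replicate_neg_one (by omega) a).append (by omega) e1).append (by omega)
      (e2.append (by omega) e3)).cast ?_ rfl ?_ ?_
    · simp; omega
    · rw [sWord, kWord_replicate]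
    · simp only [pre, F]
      rw [colWord_append, colWord_map, colWord_eq_flatten (freeCol 3) (List.replicate _ _)]
      congr 2
      · simp [freeCol, holeSeg_self, seg_of_lt]
      · refine colWord_congr fun g hg => ?_
        have hg3 := (h.boundsF g hg).1
        have h2 : seg 1 2 = [pos 1, pos 2] := rfl
        simp [freeCol, kCol, holeSeg, min_eq_left hg3, h2, seg_of_lt (by omega : 2 < 3)]
  · have hend : colWord (turnedCol 3) F = List.replicate b (pos 3) ++ colWord (seg 1) Ft := by
      simp only [F]
      rw [colWord_append, colWord_map, colWord_eq_flatten (turnedCol 3) (List.replicate _ _)]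
      congr 1
      · simp [turnedCol, seg_of_lt]
      · refine colWord_congr fun g hg => ?_
        have hg3 := (h.boundsF g hg).1
        have h2 := seg_append (a := 1) (b := g - 1) (c := g) (by omega) (by omega)
        rw [Nat.sub_add_cancel (by omega), seg_self, seg_cons (by omega : 1 ≤ g - 1),
          seg_cons (by omega : 1 + 1 ≤ g - 1)] at h2
        simpa [turnedCol, max_eq_right hg3] using h2
    have hsegs : epsWord X n 2 (colWord (seg 1) Ft) = 0 :=
      epsWord_segs hn hr (by omega) (by omega) fun g hg => (h.boundsF g hg).2
    rw [hpre, hend]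
    rcases Nat.eq_zero_or_pos b with rfl | hb0
    · obtain ⟨e1, _⟩ := kWord_fixed hn hr (by omega : 2 ≤ 2) (by omega : 2 ≤ n) h.sortedG
        (fun g hg => ⟨(hb g hg).1, (h.boundsG g hg).2⟩) hsuf
      have := (raise_replicate_neg_one (X := X) (by omega : 3 ≤ n) a).append (by omega)
        (Raise.refl e1 rfl)
      refine Raises.single (p := _) (((this.append_absorb (by omega) hsegs rfl (by omega))).cast
        rfl rfl ?_ ?_) (by simp)
      · simp
      · simp [sTop]
    · obtain rfl : Gl = [] := h.low.resolve_left (by omega)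
      obtain rfl : Gt = [] := h.top.resolve_right (by omega)
      have e := Raise.replicate (X := X) (n := n) (i := 2) (by omega) (Raise.letter (a := pos 3)
        (b := pos 2) (by simp [eLetter_pos (by omega : 1 ≤ 2) (by omega : 2 < n)])
        (by simp [epsLetter_pos (by omega : 1 ≤ 2) (by omega : 2 < n)])
        (by simp [phiLetter_pos (by omega : 1 ≤ 2) (by omega : 2 < n)])) b
      refine Raises.single (p := _) ((((raise_replicate_neg_one (X := X) (by omega : 3 ≤ n)
        a).append (by omega) e).append_absorb (by omega) hsegs rfl (by omega)).cast
        (by omega) rfl ?_ ?_) (by simp)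
      · simp [kWord]
      · simp [sTop, kWord]

/-- The words `sWord` are highest for the nodes `3, …, n`. -/
theorem epsWord_sWord (hn : InRange X n r) (hr : 3 ≤ r) (h : Config r Ft Gt Gl b) {i : ℕ}
    (hi : 3 ≤ i) (hin : i ≤ n) : epsWord X n i (sWord Ft Gt Gl a b) = 0 := by
  have h1 : ∀ c ≤ 2, ∀ m, epsWord X n i (List.replicate m (neg c)) = 0 := fun c hc m =>
    (inert_back hn hr hi hin fun x hx => ⟨c, hc, (List.mem_replicate.mp hx).2⟩).eps
  have h2 : ∀ G : List ℕ, (∀ g ∈ G, 3 ≤ g ∧ g ≤ r) → ∀ m,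
      epsWord X n i (kWord G (List.replicate m 2)) = 0 := fun G hG m =>
    epsWord_kWord_small hn hr hi hin (fun g hg => (hG g hg).2)
      (fun p hp => (List.mem_replicate.mp hp).2.le)
  simp only [sWord, epsWord_append, h1 1 (by omega), h1 2 (by omega), h2 _ h.boundsG,
    h2 _ h.boundsF]
  omega

end SWord

section RWord

variable {X : KRType} {n r a b : ℕ} {Ft Gt Gl : List ℕ}

theorem raise_dotStart (hn : 3 ≤ n) {t : ℕ × ℕ} (h1 : t.1 = 1 ∨ t.1 = 2)
    (h2 : 3 ≤ t.2) (h2' : t.2 ≤ n) :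
    Raise X n 2 (if t.1 = 1 then 0 else 1) 0 (dotStart t) (dotCol 3 t) := by
  obtain ⟨x, g⟩ := t
  simp only at h1 h2 h2'
  simp only [dotStart, dotCol, holeSeg, min_eq_left h2, seg_of_lt (by omega : 3 - 1 < 3),
    List.nil_append]
  rcases h1 with rfl | rfl
  · obtain ⟨e1, e2⟩ := epsWord_seg (standard_of_lt (X := X) (by omega : 1 ≤ 2) (by omega : 2 < n))
      (a := 4) h2'
    rw [if_neg (by omega)] at e1 e2
    refine Raise.refl ?_ ?_
    · simp [epsWord, e1, epsLetter_pos (by omega : 1 ≤ 2) (by omega : 2 < n)]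
    · simp [phiWord, e1, e2, phiLetter_pos (by omega : 1 ≤ 2) (by omega : 2 < n)]
  · exact raise_seg (by omega) (by omega) (by omega) h2'

theorem raise_freeStart (hn : 3 ≤ n) {t : ℕ × ℕ × ℕ} (h1 : t.1 = 1 ∨ t.1 = 2)
    (h2 : 3 ≤ t.2.1) (h2' : t.2.1 ≤ n) (h3 : t.2.2 = 1 ∨ t.2.2 = 2) :
    Raise X n 2 ((if t.1 = 1 then 0 else 1) + if t.2.2 = 2 then 0 else 1) 0 (freeStart t)
      (freeCol 3 (toFree t)) := by
  obtain ⟨x, g, y⟩ := t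
  simp only at h1 h2 h2' h3
  have e1 := raise_dotStart (X := X) hn (t := (x, g)) h1 h2 h2'
  have e2 : Raise X n 2 (if y = 2 then 0 else 1) 0 (if y = 2 then [neg 3, neg 2] else [neg 2, neg 1])
      ([neg 3] ++ [neg y]) := by
    have l1 : 1 ≤ 2 := by omega
    have l2 : 2 < n := by omega
    rcases h3 with rfl | rfl
    · exact (raise_neg l1 l2).append l1 (raise_replicate_neg_one hn 1)
    · refine Raise.refl ?_ ?_ <;>
        simp [epsWord, phiWord, epsLetter_neg l1 l2, phiLetter_neg l1 l2]
  refine (e1.append (by omega) e2).cast rfl rfl rfl ?_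
  simp [freeCol, toFree, dotCol]

theorem sum_freeFill (f : ℕ) (F : List ℕ) : ((freeFill f F).map fun t =>
    (if t.1 = 1 then 0 else 1) + if t.2.2 = 2 then 0 else 1).sum = 2 * F.length - f := by
  induction F generalizing f with
  | nil => simp [freeFill]
  | cons g F ih =>
    simp only [freeFill, List.map_cons, List.sum_cons, ih, List.length_cons]
    grind

theorem sum_dotFill (f : ℕ) (D : List ℕ) : ((dotFill f D).map fun t =>
    if t.1 = 1 then 0 else 1).sum = D.length - f := by
  induction D generalizing f with
  | nil => simp [dotFill]
  | cons g F ih =>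
    simp only [dotFill, List.map_cons, List.sum_cons, ih, List.length_cons]
    grind

theorem dotFill_three {i : ℕ} {c : ℕ × ℕ → List KRLetter} {a f : ℕ}
    (h3 : epsWord X n i (c (1, 3)) = 0 ∧ phiWord X n i (c (1, 3)) = 0)
    (h4 : epsWord X n i (c (2, 3)) = 0 ∧ phiWord X n i (c (2, 3)) = 1) :
    epsWord X n i (colWord c (dotFill f (List.replicate a 3))) = 0 ∧
    phiWord X n i (colWord c (dotFill f (List.replicate a 3))) = a - f := by
  induction a generalizing f with
  | zero => simp [dotFill, colWord, epsWord, phiWord]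
  | succ a ih =>
    simp only [List.replicate_succ, dotFill, colWord]
    obtain ⟨e1, e2⟩ := ih (f := f - 1)
    rw [epsWord_append, phiWord_append]
    by_cases hf1 : 1 ≤ f
    · rw [if_pos hf1]
      omega
    · rw [if_neg hf1]
      omega

theorem dotCol_last_two (hn : InRange X n r) (hn3 : 3 ≤ n) {h : ℕ} (hh : h ≤ r) (hh3 : 3 ≤ h) :
    epsWord X n 2 (dotCol n (1, h)) ≤ 1 ∧ epsWord X n 2 (dotCol n (2, h)) = 0 ∧
    (epsWord X n 2 (dotCol n (1, 3)) = 0 ∧ phiWord X n 2 (dotCol n (1, 3)) = 0) ∧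
    epsWord X n 2 (dotCol n (2, 3)) = 0 ∧ phiWord X n 2 (dotCol n (2, 3)) = 1 := by
  have hrn := le_of_inRange hn
  have l1 : 1 ≤ 2 := by omega
  have l2 : 2 < n := by omega
  obtain ⟨e1, e2⟩ := epsWord_seg (standard_of_lt (X := X) l1 l2) (a := 3) (b := h - 1) (by omega)
  rw [dotCol_final (by simp; omega), dotCol_final (by simp; omega), dotCol_final (by simp; omega),
    dotCol_final (by simp; omega)]
  simp only [epsWord, phiWord, e1, epsLetter_pos l1 l2, phiLetter_pos l1 l2,
    seg_of_lt (by omega : 3 - 1 < 3)]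
  grind

/-- Raising `rWord` to `rTop`. -/
theorem raises_rWord {z : Prop} (hn : InRange X n r) (hr : 3 ≤ r) (h : Config r Ft Gt Gl b)
    (hz : z → a = 0 ∧ Gl = [] ∧ Gt = []) :
    Raises X n z (topPath X n Ft Gl b) (rWord Ft Gt Gl a b) (rTop n Ft Gt Gl a b) := by
  have hrn := le_of_inRange hn
  have h3 : ∀ c, ∀ g ∈ List.replicate c 3, 3 ≤ g ∧ g ≤ r := fun c g hg => by
    have := (List.mem_replicate.mp hg).2
    omega
  have hD : ∀ t ∈ rDots Ft Gl a b, (t.1 = 1 ∨ t.1 = 2) ∧ 3 ≤ t.2 ∧ t.2 ≤ r := by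
    intro t ht
    obtain ⟨h1, h2⟩ := mem_dotFill ht
    refine ⟨h1, ?_⟩
    rcases List.mem_append.mp h2 with h2 | h2
    · exact h.boundsGl _ h2
    · exact h3 a _ h2
  have hD' : ∀ t ∈ rDots Ft Gl a b, t.1 ≤ 2 ∧ 3 ≤ t.2 ∧ t.2 ≤ r := fun t ht => by
    have := hD t ht
    omega
  have hF3 : ∀ g ∈ Ft ++ List.replicate b 3, 3 ≤ g ∧ g ≤ r := by
    intro g hg
    rcases List.mem_append.mp hg with h2 | h2
    · exact h.boundsF _ h2
    · exact h3 b _ h2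
  have hFm : ∀ t ∈ freeFill (a + b) (Ft ++ List.replicate b 3),
      (t.1 = 1 ∨ t.1 = 2) ∧ (3 ≤ t.2.1 ∧ t.2.1 ≤ r) ∧ (t.2.2 = 1 ∨ t.2.2 = 2) := by
    intro t ht
    obtain ⟨h1, h2, h3⟩ := mem_freeFill ht
    exact ⟨h1, hF3 _ h2, h3⟩
  have hFree : ∀ t ∈ (freeFill (a + b) (Ft ++ List.replicate b 3)).map toFree, FreeData r t := by
    intro t ht
    obtain ⟨s, hs, rfl⟩ := List.mem_map.mp ht
    obtain ⟨h1, h2, h3⟩ := hFm s hs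
    refine ⟨h2.1, h2.2, ?_, ?_⟩
    · intro x hx
      exact ⟨s.1, by omega, by simpa [toFree] using hx⟩
    · intro x hx
      exact ⟨s.2.2, by omega, by simpa [toFree] using hx⟩
  have hFh : ((freeFill (a + b) (Ft ++ List.replicate b 3)).map toFree).map (·.2.1) =
      Ft ++ List.replicate b 3 := by
    rw [List.map_map]
    exact freeFill_heights _ _
  have hDh : (rDots Ft Gl a b).map (·.2) = Gl ++ List.replicate a 3 := dotFill_heights _ _
  have hDc : ∀ i, 3 ≤ i → ((rDots Ft Gl a b).map (·.2)).countP (i < ·) = Gl.countP (i < ·) := by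
    intro i hi
    rw [hDh, List.countP_append, List.countP_replicate, if_neg (by simp; omega), Nat.add_zero]
  have hsuf : ∀ i, 1 ≤ i → i ≤ n → epsWord X n i (colWord (seg 1) Gt) = 0 := fun i h1 h2 =>
    epsWord_segs hn hr h1 h2 fun g hg => (h.boundsGt g hg).2
  have hzs : z → colWord (seg 1) Gt = [] := fun hz' => by rw [(hz hz').2.2]; rfl
  -- The columns with a dot precede those with a travelling letter, and the full columns `Gt`, which
  -- are highest, follow them.
  have hmid := raises_middlePath (X := X) (z := z) (D := Gl) hn hr hFree
    (pre := fun i => colWord (dotCol i) (rDots Ft Gl a b)) (suf := colWord (seg 1) Gt)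
    (fun i h1 h2 => ⟨0, (raise_dotCols hn hr h1 h2 hD').cast (hDc i h1) rfl rfl rfl, Or.inr rfl,
      fun _ => rfl⟩)
    ⟨0, dotCols_last hn hr hD', Or.inr rfl, fun _ => rfl⟩
    (fun i h1 h2 => by
      obtain ⟨e1, e2⟩ := dotCols_down (X := X) hn hr h1 h2 hD'
      refine ⟨_, Raise.refl e1 rfl, ?_, ?_⟩
      · by_cases h4 : ∀ t ∈ rDots Ft Gl a b, t.2 ≤ i
        · exact Or.inr (e2 h4)
        · left
          push Not at h4
          obtain ⟨t, ht, hti⟩ := h4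
          have hg : t.2 ∈ Gl := by
            rcases List.mem_append.mp (mem_dotFill ht).2 with hg | hg
            · exact hg
            · have := (List.mem_replicate.mp hg).2
              omega
          have hb0 : b = 0 := by
            rcases h.low with h5 | h5
            · exact h5
            · simp [h5] at hg
          intro s hs
          obtain ⟨u, hu, rfl⟩ := List.mem_map.mp hs
          have := (mem_freeFill hu).2.1
          simp only [hb0, List.replicate_zero, List.append_nil] at this
          exact hti.trans_le (h.le_of_mem this hg)
      · intro hz'
        refine e2 fun t ht => ?_
        have := (mem_dotFill ht).2
        rw [(hz hz').2.1, (hz hz').1] at this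
        simp at this)
    (fun i h1 h2 => hsuf i (by omega) h2) hzs
  rw [hFh, colWord_map, colWord_map, colWord_freeFill _ fun g hg => (hF3 g hg).1] at hmid
  refine ⟨_, ⟨phiWord X n 2 (colWord (seg 1) Gt), ?_, fun hz' => by rw [hzs hz']; rfl⟩,
    hmid.append ?_⟩
  · have e1 := raise_colWord (X := X) (n := n) (i := 2) (by omega) (F := rDots Ft Gl a b)
      (fun t ht => raise_dotStart (X := X) (by omega) (hD t ht).1 (hD t ht).2.1
        ((hD t ht).2.2.trans hrn))
    have e2 := raise_colWord (X := X) (n := n) (i := 2) (by omega)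
      (F := freeFill (a + b) (Ft ++ List.replicate b 3))
      (fun t ht => raise_freeStart (X := X) (by omega) (hFm t ht).1 (hFm t ht).2.1.1
        ((hFm t ht).2.1.2.trans hrn) (hFm t ht).2.2)
    refine ((e1.append (by omega) e2).append_absorb (by omega) (hsuf 2 (by omega) (by omega)) rfl
      (by omega)).cast ?_ (by omega) rfl rfl
    rw [sum_freeFill, rDots, sum_dotFill]
    simp only [List.length_append, List.length_replicate]
    omega
  · obtain ⟨_, _, c3, c4⟩ := dotCol_last_two (X := X) hn (hr.trans hrn) hr le_rfl
    have hG : ∀ g ∈ Ft ++ List.replicate b 3, 2 < g ∧ g ≤ n := fun g hg => by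
      have := hF3 g hg
      omega
    obtain ⟨k1, k2, _⟩ := kWord_move (X := X) (by omega : 1 ≤ 2) (by omega) hG (Q := [])
      (by simp) (s := min (a + b) (2 * (Ft ++ List.replicate b 3).length)) (by simp) (by omega)
    simp only [List.nil_append, List.count_nil] at k1 k2
    rcases Nat.eq_zero_or_pos b with rfl | hb0
    · obtain ⟨d1, d2⟩ := dotFill_budget (X := X) (n := n) (i := 2) (c := dotCol n) (D := Gl) (a := a)
        (f := a + 0 - 2 * (Ft ++ List.replicate 0 3).length) (by omega)
        (fun g hg => (dotCol_last_two hn (hr.trans hrn) (h.boundsGl g hg).2 (h.boundsGl g hg).1).1)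
        (fun g hg => (dotCol_last_two hn (hr.trans hrn) (h.boundsGl g hg).2 (h.boundsGl g hg).1).2.1)
        c3.1 ⟨c4.1, c4.2.ge⟩
      have e : epsWord X n 2 (colWord (dotCol n) (rDots Ft Gl a 0) ++
          kWord (Ft ++ List.replicate 0 3) (List.replicate (min (a + 0)
            (2 * (Ft ++ List.replicate 0 3).length)) 2) ++ colWord (seg 1) Gt) = 0 := by
        rw [epsWord_append, epsWord_append, hsuf 2 (by omega) (by omega), k1]
        unfold rDots
        omega
      refine Raises.single ((Raise.refl e rfl).cast rfl rfl rfl (by simp [rTop])) ?_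
      intro hz'
      obtain ⟨rfl, rfl, rfl⟩ := hz hz'
      simp [rDots, dotFill, colWord] at k2 ⊢
      exact k2
    · obtain rfl : Gl = [] := h.low.resolve_left (by omega)
      obtain ⟨d1, d2⟩ := dotFill_three (X := X) (n := n) (i := 2) (c := dotCol n) (a := a)
        (f := a + b - 2 * (Ft ++ List.replicate b 3).length) c3 c4
      obtain ⟨s, hs⟩ : ∃ s, min (a + b) (2 * (Ft ++ List.replicate b 3).length) = b + s := by
        refine Nat.exists_eq_add_of_le ?_
        simp only [List.length_append, List.length_replicate]
        omega
      have hs' : s = a - (a + b - 2 * (Ft ++ List.replicate b 3).length) := by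
        simp only [List.length_append, List.length_replicate] at hs ⊢
        omega
      have it := kWord_move_iter (X := X) (by omega : 1 ≤ 2) (by omega) hG (Q := [])
        (by simp) (t := b) (s := s) (by simp only [List.length_nil]; omega) (by omega)
      rw [hs] at k1 k2
      simp only [List.nil_append] at it
      refine Raises.single ⟨?_, rfl, ?_⟩ ?_
      · rw [hs, epsWord_append, epsWord_append, hsuf 2 (by omega) (by omega), k1]
        simp only [rDots, List.nil_append]
        omega
      · rw [hs, rTop, hs, Nat.add_sub_cancel_left]
        refine partialIter_eWd_append_left (by omega) _ (partialIter_eWd_append_right (by omega) _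
          it ?_) (by rw [hsuf 2 (by omega) (by omega)]; omega)
        rw [k1]
        simp only [rDots, List.nil_append]
        omega
      · intro hz'
        rw [hs, phiWord_append, phiWord_append, hzs hz', k2]
        obtain ⟨rfl, _, _⟩ := hz hz'
        simp [rDots, dotFill, colWord, phiWord]

/-- The words `rWord` are highest for the nodes `3, …, n`. -/
theorem epsWord_rWord (hn : InRange X n r) (hr : 3 ≤ r) (h : Config r Ft Gt Gl b) {i : ℕ}
    (hi : 3 ≤ i) (hin : i ≤ n) : epsWord X n i (rWord Ft Gt Gl a b) = 0 := by
  have hrn := le_of_inRange hn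
  have hsuf : epsWord X n i (colWord (seg 1) Gt) = 0 :=
    epsWord_segs hn hr (by omega) hin fun g hg => (h.boundsGt g hg).2
  rcases hi.eq_or_lt with rfl | hi3
  · rw [rWord, epsWord_append, hsuf, rDots,
      (rWord_budget hn hr h.boundsF h.boundsGl le_rfl).1]
    omega
  · obtain ⟨n1, n2, n3, n4⟩ := eps_neg_pair (X := X) hn hr hi hin
    rw [if_neg (by omega)] at n1
    have d : ∀ t : ℕ × ℕ, (t.1 = 1 ∨ t.1 = 2) → t.2 ≤ r → epsWord X n i (dotStart t) = 0 := by
      rintro ⟨x, g⟩ hx hg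
      obtain ⟨d1, d2, _⟩ := dotStart_eps (X := X) hn hr hi hin hg
      rcases hx with hx | hx <;> simp only at hx <;> subst hx
      · exact d2.trans (if_neg (by omega))
      · exact d1
    have h3 : ∀ G c, (∀ g ∈ G, 3 ≤ g ∧ g ≤ r) → ∀ g ∈ G ++ List.replicate c 3, g ≤ r := by
      intro G c hG g hg
      rcases List.mem_append.mp hg with hg | hg
      · exact (hG g hg).2
      · have := (List.mem_replicate.mp hg).2
        omega
    rw [rWord, epsWord_append, epsWord_append, hsuf, epsWord_colWord, epsWord_colWord]
    · omega
    · rintro ⟨x, g, y⟩ ht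
      obtain ⟨h1, h2, _⟩ := mem_freeFill ht
      have := d (x, g) h1 (h3 _ _ h.boundsF _ h2)
      rw [show freeStart (x, g, y) = dotStart (x, g) ++
        if y = 2 then [neg 3, neg 2] else [neg 2, neg 1] from rfl, epsWord_append, this]
      split_ifs <;> omega
    · intro t ht
      obtain ⟨h1, h2⟩ := mem_dotFill ht
      exact d t h1 (h3 _ _ h.boundsGl _ h2)

end RWord

/-! ### `±`-diagrams and their tableaux -/

/-- The position of a sign in the order of the columns of a given outer height. -/
def signRank : Sign → ℕ
  | Sign.dot => 0
  | Sign.plus => 1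
  | Sign.minus => 2
  | Sign.both => 3

/-- Whether a column contains a `-`. -/
def hasMinus : Sign → Bool
  | Sign.dot => false
  | Sign.plus => false
  | Sign.minus => true
  | Sign.both => true

/-- The order, from left to right, of the columns of a `±`-diagram. -/
def ColumnLE (c d : ℕ × Sign) : Prop := d.1 < c.1 ∨ (c.1 = d.1 ∧ signRank c.2 ≤ signRank d.2)

/-- The `±`-diagram with the given columns. -/
def countDiagram (L : List (ℕ × Sign)) : Diagram := fun i s => L.count (i, s)

/-- The columns of a `±`-diagram as in `IsDiagram`, except that the number of columns is not
prescribed. -/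
structure Columns (X : KRType) (n r : ℕ) (L : List (ℕ × Sign)) : Prop where
  sorted : L.Pairwise ColumnLE
  height : ∀ c ∈ L, c.1 ≤ r ∧ c.1 % 2 = r % 2
  sign : ∀ c ∈ L, (c.2 ≠ Sign.dot → 1 ≤ c.1) ∧ (c.2 = Sign.both → 2 ≤ c.1)
  last : X = KRType.typeA → ∀ c ∈ L, c.1 = n → c.2 ≠ Sign.dot

/-- The tableau of the `±`-diagram with columns `L`. -/
def columnsTab (n : ℕ) (L : List (ℕ × Sign)) : Tab :=
  let cols := (fillColumns n L (L.filterMap (plusHeight n))).reverse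
  ⟨cols.map List.length, cols.flatten⟩

/-- The column of the tableau made of a column of a `±`-diagram, met while the `+` at heights `hs` are
still to be used, together with the heights that remain. -/
def fillColumn (n : ℕ) (c : ℕ × Sign) (hs : List ℕ) : List KRLetter × List ℕ :=
  if hasMinus c.2 then
    ((fillString (c.1 - 1) (fillBar hs).2).1 ++ (fillBar hs).1,
      (fillString (c.1 - 1) (fillBar hs).2).2)
  else if c.2 = Sign.plus ∧ c.1 = n then (seg 1 n, hs) else fillString c.1 hs

theorem fillColumns_cons (n : ℕ) (c : ℕ × Sign) (cs : List (ℕ × Sign)) (hs : List ℕ) :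
    fillColumns n (c :: cs) hs =
      (fillColumn n c hs).1 :: fillColumns n cs (fillColumn n c hs).2 := by
  obtain ⟨i, s⟩ := c
  cases s
  · simp [fillColumns, fillColumn, hasMinus]
  · by_cases h : i = n <;> simp [fillColumns, fillColumn, hasMinus, h]
  · simp [fillColumns, fillColumn, hasMinus]
  · simp [fillColumns, fillColumn, hasMinus]

section Counting

theorem count_diagramColumns (r : ℕ) (p : Diagram) (i : ℕ) (s : Sign) :
    (diagramColumns r p).count (i, s) = if i ≤ r then p i s else 0 := by
  have hblock : ∀ j, (List.replicate (p j Sign.dot) (j, Sign.dot) ++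
    List.replicate (p j Sign.plus) (j, Sign.plus) ++
    List.replicate (p j Sign.minus) (j, Sign.minus) ++
    List.replicate (p j Sign.both) (j, Sign.both)).count (i, s) = if i = j then p j s else 0 := by
    intro j
    by_cases h : i = j
    · subst h
      cases s <;> simp [List.count_replicate]
    · have h' : ¬ j = i := fun e => h e.symm
      simp [List.count_replicate, h, h']
  induction r with
  | zero =>
    have := hblock 0
    simp only [diagramColumns, zero_add, List.range_one, List.reverse_singleton,
      List.flatMap_singleton]
    rw [this]
    grind
  | succ r ih =>
    rw [diagramColumns, List.range_succ, List.reverse_append, List.reverse_singleton,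
      List.singleton_append, List.flatMap_cons, List.count_append, hblock]
    rw [diagramColumns] at ih
    rw [ih]
    grind

theorem mem_diagramColumns {r : ℕ} {p : Diagram} {c : ℕ × Sign} :
    c ∈ diagramColumns r p ↔ c.1 ≤ r ∧ p c.1 c.2 ≠ 0 := by
  rw [← List.count_pos_iff, count_diagramColumns]
  grind

theorem diagramColumns_sorted (r : ℕ) (p : Diagram) :
    (diagramColumns r p).Pairwise ColumnLE := by
  have hblock : ∀ j, (List.replicate (p j Sign.dot) (j, Sign.dot) ++
    List.replicate (p j Sign.plus) (j, Sign.plus) ++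
    List.replicate (p j Sign.minus) (j, Sign.minus) ++
    List.replicate (p j Sign.both) (j, Sign.both)).Pairwise ColumnLE := by
    intro j
    have hrep : ∀ m s, (List.replicate m (j, s)).Pairwise ColumnLE := fun m s =>
      List.pairwise_replicate.mpr (Or.inr (Or.inr ⟨rfl, le_rfl⟩))
    simp only [List.pairwise_append, hrep, List.mem_append, List.mem_replicate, true_and]
    refine ⟨⟨?_, ?_⟩, ?_⟩
    all_goals
      intro c hc d hd
      right
      grind [signRank]
  induction r with
  | zero =>
    simpa only [diagramColumns, zero_add, List.range_one, List.reverse_singleton,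
      List.flatMap_singleton] using hblock 0
  | succ r ih =>
    rw [diagramColumns, List.range_succ, List.reverse_append, List.reverse_singleton,
      List.singleton_append, List.flatMap_cons, List.pairwise_append]
    refine ⟨hblock _, ih, fun c hc d hd => Or.inl ?_⟩
    have h1 : d.1 ≤ r := (mem_diagramColumns.mp (show d ∈ diagramColumns r p from hd)).1
    have h2 : c.1 = r + 1 := by
      simp only [List.mem_append, List.mem_replicate] at hc
      grind
    omega

/-- A sorted list of columns is the list of the columns of its diagram. -/
theorem diagramColumns_countDiagram {r : ℕ} {L : List (ℕ × Sign)} (h : L.Pairwise ColumnLE)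
    (hr : ∀ c ∈ L, c.1 ≤ r) : diagramColumns r (countDiagram L) = L := by
  refine List.Perm.eq_of_pairwise (le := ColumnLE) ?_ (diagramColumns_sorted r _) h ?_
  · rintro ⟨i, s⟩ ⟨j, t⟩ _ _ h1 h2
    simp only [ColumnLE] at h1 h2
    cases s <;> cases t <;> simp only [signRank] at h1 h2 <;> grind
  · rw [List.perm_iff_count]
    rintro ⟨i, s⟩
    rw [count_diagramColumns]
    split_ifs with hi
    · rfl
    · refine (List.count_eq_zero.mpr fun hm => hi ?_).symm
      exact hr _ hm

theorem count_columns (L : List (ℕ × Sign)) (i : ℕ) :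
    (L.map fun c => (c.1, hasMinus c.2)).count (i, false) =
      L.count (i, Sign.dot) + L.count (i, Sign.plus) ∧
    (L.map fun c => (c.1, hasMinus c.2)).count (i, true) =
      L.count (i, Sign.minus) + L.count (i, Sign.both) := by
  induction L with
  | nil => simp
  | cons c L ih =>
    obtain ⟨j, s⟩ := c
    simp only [List.map_cons, List.count_cons (l := L.map _), ih]
    cases s <;> simp only [List.count_cons, hasMinus, beq_iff_eq, Prod.mk.injEq,
      reduceCtorEq, and_false, and_true, if_false, Bool.true_eq_false, Bool.false_eq_true] <;> grind

theorem count_plusHeight (n : ℕ) {L : List (ℕ × Sign)}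
    (hL : ∀ c ∈ L, c.2 = Sign.both → 2 ≤ c.1) (h : ℕ) :
    (L.filterMap (plusHeight n)).count h =
      (if h = n then 0 else L.count (h, Sign.plus)) + L.count (h + 1, Sign.both) := by
  induction L with
  | nil => simp
  | cons c L ih =>
    have ih := ih fun c hc => hL c (by simp [hc])
    have hc := hL c (by simp)
    obtain ⟨j, s⟩ := c
    cases s
    · rw [List.filterMap_cons_none (by rfl), ih]
      simp
    · by_cases hj : j = n
      · simp [plusHeight, ih, hj, List.count_cons]
        grind
      · simp [plusHeight, ih, hj, List.count_cons]
        grind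
    · rw [List.filterMap_cons_none (by rfl), ih]
      simp
    · simp only [forall_const] at hc
      simp [plusHeight, ih, List.count_cons]
      grind

end Counting

section Injective

variable {X : KRType} {n r : ℕ}

theorem suffix_drop {x : ℕ} {hs l : List ℕ} (h : hs <:+ x :: l) {j : ℕ} (hj : 1 ≤ j) :
    hs.drop j <:+ l := by
  rcases List.suffix_cons_iff.mp h with rfl | h
  · obtain ⟨j, rfl⟩ : ∃ i, j = i + 1 := ⟨j - 1, by omega⟩
    simpa using List.drop_suffix j l
  · exact (List.drop_suffix j hs).trans h

theorem fillString_snd {m : ℕ} (hm : m ≠ 0) (hs : List ℕ) : (fillString m hs).2 = hs.drop 1 := by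
  cases hs <;> simp [fillString, hm]

theorem fillBar_snd (hs : List ℕ) : (fillBar hs).2 = hs.drop 1 := by
  cases hs <;> simp [fillBar]

theorem fillBar_length (hs : List ℕ) : (fillBar hs).1.length = 1 := by
  cases hs <;> simp [fillBar]

theorem fillString_length {m : ℕ} {hs : List ℕ} (h : m ≠ 0 → ∀ x ∈ hs, x ≤ m) :
    (fillString m hs).1.length = m := by
  by_cases hm : m = 0
  · simp [fillString, hm]
  · cases hs with
    | nil => simp [fillString, hm, length_seg]
    | cons x hs =>
      have := h hm x (by simp)
      simp [fillString, hm, length_seg]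
      omega

/-- The string and the remaining heights determine the heights before. -/
theorem fillString_injective {m : ℕ} {hs hs' : List ℕ} (h : m ≠ 0 → ∀ x ∈ hs, 1 ≤ x ∧ x ≤ m)
    (h' : m ≠ 0 → ∀ x ∈ hs', 1 ≤ x ∧ x ≤ m) (he : fillString m hs = fillString m hs') :
    hs = hs' := by
  by_cases hm : m = 0
  · simpa [fillString, hm] using he
  · have hmem : ∀ x : ℕ, 1 ≤ x → x ≤ m →
        ∀ c, pos c ∈ seg 1 x ++ seg (x + 2) (m + 1) ↔ 1 ≤ c ∧ c ≤ m + 1 ∧ c ≠ x + 1 := by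
      intro x h1 h2 c
      simp only [List.mem_append, mem_seg, KRLetter.pos.injEq]
      constructor
      · rintro (⟨d, h3, h4, rfl⟩ | ⟨d, h3, h4, rfl⟩) <;> omega
      · rintro ⟨h3, h4, h5⟩
        by_cases h6 : c ≤ x
        · exact Or.inl ⟨c, h3, h6, rfl⟩
        · exact Or.inr ⟨c, by omega, h4, rfl⟩
    have hnil : ∀ c, pos c ∈ seg 2 (m + 1) ↔ 2 ≤ c ∧ c ≤ m + 1 := by
      intro c
      simp only [mem_seg, KRLetter.pos.injEq]
      constructor
      · rintro ⟨d, h3, h4, rfl⟩; omega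
      · rintro ⟨h3, h4⟩; exact ⟨c, h3, h4, rfl⟩
    cases hs with
    | nil =>
      cases hs' with
      | nil => rfl
      | cons x' hs' =>
        obtain ⟨h1, h2⟩ := h' hm x' (by simp)
        simp only [fillString, hm, if_false, Prod.mk.injEq] at he
        have h3 := hnil 1
        rw [he.1, hmem x' h1 h2] at h3
        omega
    | cons x hs =>
      obtain ⟨h1, h2⟩ := h hm x (by simp)
      cases hs' with
      | nil =>
        simp only [fillString, hm, if_false, Prod.mk.injEq] at he
        have h3 := hnil 1
        rw [← he.1, hmem x h1 h2] at h3
        omega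
      | cons x' hs' =>
        obtain ⟨h1', h2'⟩ := h' hm x' (by simp)
        simp only [fillString, hm, if_false, Prod.mk.injEq] at he
        have h3 := hmem x h1 h2 (x + 1)
        rw [he.1, hmem x' h1' h2'] at h3
        obtain rfl : x = x' := by omega
        rw [he.2]

theorem fillBar_injective {hs hs' : List ℕ} (h : ∀ x ∈ hs, 1 ≤ x) (h' : ∀ x ∈ hs', 1 ≤ x)
    (he : fillBar hs = fillBar hs') : hs = hs' := by
  cases hs <;> cases hs' <;> simp [fillBar] at he h h' ⊢ <;> omega

/-- What remains to be scanned: sorted columns `L`, and heights of `+` that belong to columns of `L`. -/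
structure Remaining (n : ℕ) (L : List (ℕ × Sign)) (hs : List ℕ) : Prop where
  sorted : L.Pairwise ColumnLE
  sign : ∀ c ∈ L, (c.2 ≠ Sign.dot → 1 ≤ c.1) ∧ (c.2 = Sign.both → 2 ≤ c.1)
  last : ∀ c ∈ L, c.1 = n → c.2 ≠ Sign.dot
  suffix : hs <:+ L.filterMap (plusHeight n)

namespace Remaining

variable {c : ℕ × Sign} {L : List (ℕ × Sign)} {hs : List ℕ}

theorem one_le (h : Remaining n L hs) {x : ℕ} (hx : x ∈ hs) : 1 ≤ x := by
  obtain ⟨⟨i, s⟩, hd, he⟩ := List.mem_filterMap.mp (h.suffix.mem hx)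
  have := h.sign _ hd
  cases s <;> simp [plusHeight] at he this <;> omega

/-- The `+` available for a string are not higher than the string. -/
theorem le (h : Remaining n (c :: L) hs) {x : ℕ} (hx : x ∈ hs) :
    x ≤ if hasMinus c.2 then c.1 - 1 else c.1 := by
  obtain ⟨⟨i, s⟩, hd, he⟩ := List.mem_filterMap.mp (h.suffix.mem hx)
  have h1 := h.sign _ hd
  have h3 := (List.pairwise_cons.mp h.sorted).1
  have h2 : (i, s) = c ∨ ColumnLE c (i, s) := by
    rcases List.mem_cons.mp hd with hd | hd
    · exact Or.inl hd
    · exact Or.inr (h3 _ hd)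
  obtain ⟨j, t⟩ := c
  simp only [ColumnLE] at h2
  cases s <;> cases t <;> simp [plusHeight, hasMinus, signRank] at he h1 h2 ⊢ <;> omega

theorem tail (h : Remaining n (c :: L) hs) : Remaining n L (fillColumn n c hs).2 := by
  refine ⟨(List.pairwise_cons.mp h.sorted).2, fun d hd => h.sign d (by simp [hd]),
    fun d hd => h.last d (by simp [hd]), ?_⟩
  have hc := h.sign c (by simp)
  have hs' := h.suffix
  obtain ⟨i, s⟩ := c
  have hdrop : ∀ j, hs <:+ L.filterMap (plusHeight n) → hs.drop j <:+ L.filterMap (plusHeight n) :=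
    fun j h => (List.drop_suffix j hs).trans h
  cases s
  · rw [List.filterMap_cons_none (by rfl)] at hs'
    by_cases hi : i = 0
    · simpa [fillColumn, hasMinus, hi, fillString] using hs'
    · simpa [fillColumn, hasMinus, fillString_snd hi] using hdrop 1 hs'
  · by_cases hi : i = n
    · rw [List.filterMap_cons_none (by simp [plusHeight, hi])] at hs'
      simpa [fillColumn, hasMinus, hi] using hs'
    · rw [List.filterMap_cons_some (b := i) (by simp [plusHeight, hi])] at hs'
      have : i ≠ 0 := by have := hc.1 (by simp); simp at this; omega
      simpa [fillColumn, hasMinus, hi, fillString_snd this] using suffix_drop hs' le_rfl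
  · rw [List.filterMap_cons_none (by rfl)] at hs'
    by_cases hi : i - 1 = 0
    · simpa [fillColumn, hasMinus, hi, fillString, fillBar_snd] using hdrop 1 hs'
    · simpa [fillColumn, hasMinus, fillString_snd hi, fillBar_snd] using hdrop 2 hs'
  · rw [List.filterMap_cons_some (b := i - 1) (by simp [plusHeight])] at hs'
    have : i - 1 ≠ 0 := by have := hc.2 (by simp); simp at this; omega
    simpa [fillColumn, hasMinus, fillString_snd this, fillBar_snd] using
      suffix_drop (j := 2) hs' (by omega)

theorem length_fillColumn (h : Remaining n (c :: L) hs) : (fillColumn n c hs).1.length = c.1 := by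
  have h1 := fun x hx => h.le (x := x) hx
  have h2 := (h.sign c (by simp)).1
  obtain ⟨i, s⟩ := c
  by_cases hm : hasMinus s
  · simp only [hm, if_true] at h1
    have h3 : 1 ≤ i := h2 (by rintro rfl; simp [hasMinus] at hm)
    simp only [fillColumn, hm, if_true, List.length_append, fillBar_length]
    rw [fillString_length]
    · omega
    · intro _ x hx
      rw [fillBar_snd] at hx
      exact h1 x (List.mem_of_mem_drop hx)
  · simp only [hm] at h1
    simp only [fillColumn, hm]
    by_cases h3 : s = Sign.plus ∧ i = n
    · simp [length_seg, h3]
    · simp only [h3, if_false, Bool.false_eq_true]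
      exact fillString_length fun _ x hx => by simpa using h1 x hx

theorem map_length (h : Remaining n L hs) : (fillColumns n L hs).map List.length = L.map (·.1) := by
  induction L generalizing hs with
  | nil => rfl
  | cons c L ih => simp [fillColumns_cons, h.length_fillColumn, ih h.tail]

end Remaining

theorem forall_pos_of_seg {a b : ℕ} : ∀ x ∈ seg a b, ∃ c, x = pos c := by
  intro x hx
  obtain ⟨c, _, _, rfl⟩ := mem_seg.mp hx
  exact ⟨c, rfl⟩

theorem fillString_pos {m : ℕ} {hs : List ℕ} : ∀ x ∈ (fillString m hs).1, ∃ c, x = pos c := by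
  by_cases hm : m = 0
  · simp [fillString, hm]
  · cases hs with
    | nil => simpa [fillString, hm] using fun x => forall_pos_of_seg (x := x)
    | cons h hs =>
      simp only [fillString, hm, if_false, List.mem_append]
      rintro x (hx | hx)
      · exact forall_pos_of_seg x hx
      · exact forall_pos_of_seg x hx

/-- Whether a column contains a `-` can be read off from its tableau. -/
theorem hasMinus_iff {c : ℕ × Sign} {hs : List ℕ} :
    hasMinus c.2 = true ↔ ∃ b, neg b ∈ (fillColumn n c hs).1 := by
  unfold fillColumn
  split_ifs with h1 h2
  · simp only [h1, true_iff]
    cases hs with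
    | nil => exact ⟨1, by simp [fillBar]⟩
    | cons h hs => exact ⟨h + 1, by simp [fillBar]⟩
  · simp only [h1, Bool.false_eq_true, false_iff]
    rintro ⟨b, hb⟩
    obtain ⟨c, hc⟩ := forall_pos_of_seg _ hb
    simp at hc
  · simp only [h1, Bool.false_eq_true, false_iff]
    rintro ⟨b, hb⟩
    obtain ⟨c, hc⟩ := fillString_pos _ hb
    simp at hc

/-- The columns of a tableau determine the heights of the `+` and the columns with a `-`. -/
theorem fillColumns_injective {L L' : List (ℕ × Sign)} {hs hs' : List ℕ} (h : Remaining n L hs)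
    (h' : Remaining n L' hs') (hL : L.map (·.1) = L'.map (·.1))
    (he : fillColumns n L hs = fillColumns n L' hs') :
    hs = hs' ∧ L.map (fun c => (c.1, hasMinus c.2)) = L'.map (fun c => (c.1, hasMinus c.2)) := by
  induction L generalizing L' hs hs' with
  | nil =>
    obtain rfl : L' = [] := by simpa using hL.symm
    refine ⟨?_, rfl⟩
    rw [List.suffix_nil.mp h.suffix, List.suffix_nil.mp h'.suffix]
  | cons c L ih =>
    match L', hL with
    | c' :: L', hL =>
      simp only [List.map_cons, List.cons.injEq] at hL
      rw [fillColumns_cons, fillColumns_cons, List.cons.injEq] at he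
      -- The heights of the `+` are used up from the left, so the tails determine the heights left over
      -- after the first column, which then decides whether it has used one.
      obtain ⟨e1, e2⟩ := ih h.tail h'.tail hL.2 he.2
      have hm : hasMinus c.2 = hasMinus c'.2 := by
        rw [Bool.eq_iff_iff, hasMinus_iff (n := n) (hs := hs), hasMinus_iff (n := n) (hs := hs'),
          he.1]
      refine ⟨?_, by rw [List.map_cons, List.map_cons, e2, hL.1, hm]⟩
      have g1 := fun x hx => h.le (x := x) hx
      have g1' := fun x hx => h'.le (x := x) hx
      have g2 := fun x hx => h.one_le (x := x) hx
      have g2' := fun x hx => h'.one_le (x := x) hx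
      have g3 := h.last c (by simp)
      have g3' := h'.last c' (by simp)
      obtain ⟨i, s⟩ := c
      obtain ⟨i', s'⟩ := c'
      simp only at hL hm g1 g1' g3 g3'
      obtain ⟨rfl, hL⟩ := hL
      have e0 := he.1
      unfold fillColumn at e0 e1
      simp only [← hm] at e0 e1 g1'
      by_cases hs0 : hasMinus s
      · simp only [hs0, if_true] at e0 e1 g1 g1'
        have e3 := List.append_inj' e0 (by rw [fillBar_length, fillBar_length])
        have e4 := fillString_injective (m := i - 1) (hs := (fillBar hs).2) (hs' := (fillBar hs').2)
          (fun _ x hx => by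
            rw [fillBar_snd] at hx
            have := List.mem_of_mem_drop hx
            exact ⟨g2 x this, g1 x this⟩)
          (fun _ x hx => by
            rw [fillBar_snd] at hx
            have := List.mem_of_mem_drop hx
            exact ⟨g2' x this, g1' x this⟩) (Prod.ext e3.1 e1)
        exact fillBar_injective g2 g2' (Prod.ext e3.2 e4)
      · have hp : i = n → s = Sign.plus := fun hi => by
          have := g3 hi
          cases s <;> simp [hasMinus] at this hs0 ⊢
        have hp' : i = n → s' = Sign.plus := fun hi => by
          have := g3' hi
          rw [hm] at hs0
          cases s' <;> simp [hasMinus] at this hs0 ⊢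
        simp only [hs0] at e0 e1 g1 g1'
        by_cases hi : i = n
        · simpa [hp hi, hp' hi, hi] using e1
        · simp only [hi, and_false, if_false] at e0 e1
          exact fillString_injective (fun _ x hx => ⟨g2 x hx, by simpa using g1 x hx⟩)
            (fun _ x hx => ⟨g2' x hx, by simpa using g1' x hx⟩) (Prod.ext e0 e1)

theorem Columns.remaining (hn : InRange X n r) {L : List (ℕ × Sign)} (h : Columns X n r L) :
    Remaining n L (L.filterMap (plusHeight n)) := by
  refine ⟨h.sorted, h.sign, fun c hc hcn => ?_, List.suffix_refl _⟩
  refine h.last ?_ c hc hcn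
  have := (h.height c hc).1
  cases X <;> simp [InRange] at hn ⊢ <;> omega

theorem columns_of_isDiagram {k : ℕ} {p : Diagram} (h : IsDiagram X n r k p) :
    Columns X n r (diagramColumns r p) := by
  obtain ⟨h1, h2, h3, h4, _⟩ := h
  refine ⟨diagramColumns_sorted r p, fun c hc => h1 c.1 c.2 (mem_diagramColumns.mp hc).2,
    fun c hc => ⟨fun hd => ?_, fun hd => ?_⟩, fun hX c hc hcn hd => ?_⟩
  · by_contra h0
    have h5 := (mem_diagramColumns.mp hc).2
    rw [show c.1 = 0 by omega] at h5
    exact h5 (h2 _ hd)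
  · by_contra h0
    have h5 := (mem_diagramColumns.mp hc).2
    rw [hd] at h5
    rcases Nat.lt_or_ge c.1 1 with h6 | h6
    · rw [show c.1 = 0 by omega] at h5
      exact h5 (h2 _ (by simp))
    · rw [show c.1 = 1 by omega] at h5
      exact h5 h3
  · have h5 := (mem_diagramColumns.mp hc).2
    rw [hd, hcn] at h5
    exact h5 (h4 hX)

theorem sum_countDiagram {L : List (ℕ × Sign)} (h : ∀ c ∈ L, c.1 ≤ r) :
    ∑ i ∈ Finset.range (r + 1), (countDiagram L i Sign.dot + countDiagram L i Sign.plus +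
      countDiagram L i Sign.minus + countDiagram L i Sign.both) = L.length := by
  induction L with
  | nil => simp [countDiagram]
  | cons c L ih =>
    have ih := ih fun d hd => h d (by simp [hd])
    have hc := h c (by simp)
    obtain ⟨j, s⟩ := c
    have : ∀ i, countDiagram ((j, s) :: L) i Sign.dot + countDiagram ((j, s) :: L) i Sign.plus +
        countDiagram ((j, s) :: L) i Sign.minus + countDiagram ((j, s) :: L) i Sign.both =
        (countDiagram L i Sign.dot + countDiagram L i Sign.plus +
        countDiagram L i Sign.minus + countDiagram L i Sign.both) + if j = i then 1 else 0 := by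
      intro i
      simp only [countDiagram]
      cases s <;> simp [List.count_cons] <;> split_ifs <;> omega
    simp only [this, Finset.sum_add_distrib (f := fun i => _ + _ + _ + _)]
    rw [ih, Finset.sum_ite_eq, if_pos (by simp at hc ⊢; omega)]
    rfl

theorem Columns.isDiagram {L : List (ℕ × Sign)} (h : Columns X n r L) :
    IsDiagram X n r L.length (countDiagram L) := by
  have hmem : ∀ i s, countDiagram L i s ≠ 0 → (i, s) ∈ L := fun i s h =>
    List.count_pos_iff.mp (Nat.pos_of_ne_zero h)
  refine ⟨fun i s hp => h.height _ (hmem i s hp), fun s hs => ?_, ?_, fun hX => ?_,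
    sum_countDiagram fun c hc => (h.height c hc).1⟩
  · by_contra hp
    have := (h.sign _ (hmem 0 s hp)).1 hs
    simp at this
  · by_contra hp
    have := (h.sign _ (hmem 1 _ hp)).2 rfl
    simp at this
  · by_contra hp
    exact h.last hX _ (hmem n _ hp) rfl rfl

/-- The map from `±`-diagrams to tableaux is injective: the tableau determines the outer heights, the
columns with a `-`, and the heights of the `+`; the latter are congruent to `r` modulo `2` above
an inner column of height congruent to `r - 1`, that is, if they come from a single `+`. -/
theorem columnsTab_injective (hn : InRange X n r) {L L' : List (ℕ × Sign)} (h : Columns X n r L)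
    (h' : Columns X n r L') (he : columnsTab n L = columnsTab n L') : L = L' := by
  have g := h.remaining hn
  have g' := h'.remaining hn
  simp only [columnsTab, Tab.mk.injEq] at he
  have e1 : fillColumns n L (L.filterMap (plusHeight n)) =
      fillColumns n L' (L'.filterMap (plusHeight n)) := by
    have := List.eq_iff_flatten_eq.mpr ⟨he.2, he.1⟩
    simpa using this
  have e2 : L.map (·.1) = L'.map (·.1) := by
    rw [← g.map_length, ← g'.map_length, e1]
  obtain ⟨e3, e4⟩ := fillColumns_injective g g' e2 e1
  refine List.Perm.eq_of_pairwise (le := ColumnLE) ?_ h.sorted h'.sorted ?_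
  · rintro ⟨i, s⟩ ⟨j, t⟩ _ _ h1 h2
    simp only [ColumnLE] at h1 h2
    cases s <;> cases t <;> simp only [signRank] at h1 h2 <;> grind
  rw [List.perm_iff_count]
  have key : ∀ {L : List (ℕ × Sign)}, Columns X n r L → ∀ i,
      (r < i ∨ i % 2 ≠ r % 2 → ∀ s, L.count (i, s) = 0) ∧
      (i = n → L.count (i, Sign.dot) = 0) := by
    intro L h i
    refine ⟨fun hi s => List.count_eq_zero.mpr fun hm => ?_, fun hi =>
      List.count_eq_zero.mpr fun hm => (h.remaining hn).last _ hm hi rfl⟩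
    have := h.height _ hm
    simp only at this
    omega
  rintro ⟨i, s⟩
  obtain ⟨k1, k2⟩ := key h i
  obtain ⟨k1', k2'⟩ := key h' i
  by_cases hi : r < i ∨ i % 2 ≠ r % 2
  · rw [k1 hi, k1' hi]
  obtain ⟨c1, c2⟩ := count_columns L i
  obtain ⟨c1', c2'⟩ := count_columns L' i
  rw [e4] at c1 c2
  have p1 := count_plusHeight n (fun c hc => (h.sign c hc).2) i
  have p1' := count_plusHeight n (fun c hc => (h'.sign c hc).2) i
  rw [(key h (i + 1)).1 (by omega), e3] at p1
  rw [(key h' (i + 1)).1 (by omega)] at p1'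
  -- All outer heights are congruent to `r` modulo `2`, so a `+` at height `i` belongs to a column of
  -- outer height `i` with a single `+`, and one at height `i - 1` to a column with both signs.
  have hplus : L.count (i, Sign.plus) = L'.count (i, Sign.plus) := by
    by_cases hin : i = n
    · have := k2 hin
      have := k2' hin
      omega
    · rw [if_neg hin] at p1 p1'
      omega
  have hboth : L.count (i, Sign.both) = L'.count (i, Sign.both) := by
    rcases Nat.eq_zero_or_pos i with rfl | hi0
    · have : ∀ {L : List (ℕ × Sign)}, Columns X n r L → L.count (0, Sign.both) = 0 := fun h =>
        List.count_eq_zero.mpr fun hm => by have := (h.sign _ hm).2 rfl; simp at this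
      rw [this h, this h']
    · have p2 := count_plusHeight n (fun c hc => (h.sign c hc).2) (i - 1)
      have p2' := count_plusHeight n (fun c hc => (h'.sign c hc).2) (i - 1)
      rw [Nat.sub_add_cancel hi0, (key h (i - 1)).1 (by omega), e3] at p2
      rw [Nat.sub_add_cancel hi0, (key h' (i - 1)).1 (by omega)] at p2'
      simp only [ite_self] at p2 p2'
      omega
  cases s <;> omega

/-- `σ` on the `{2, …, n}`-highest tableaux, in terms of the columns of the `±`-diagrams. -/
theorem sigmaHighest_columnsTab (hn : InRange X n r) {L L' : List (ℕ × Sign)}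
    (h : Columns X n r L) (h' : Columns X n r L')
    (hs : swapDiagram r (countDiagram L) = countDiagram L') :
    sigmaHighest X n r L.length (columnsTab n L) = some (columnsTab n L') := by
  have hcol : ∀ {L : List (ℕ × Sign)}, Columns X n r L → diagramColumns r (countDiagram L) = L :=
    fun h => diagramColumns_countDiagram h.sorted fun c hc => (h.height c hc).1
  have hex : ∃ p, IsDiagram X n r L.length p ∧ diagramTab n r p = columnsTab n L :=
    ⟨countDiagram L, h.isDiagram, congrArg (columnsTab n) (hcol h)⟩
  obtain ⟨g1, g2⟩ := hex.choose_spec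
  have e := columnsTab_injective hn (columns_of_isDiagram g1) h g2
  have e' : hex.choose = countDiagram L := by
    funext i s
    have hc := count_diagramColumns r hex.choose i s
    rw [e] at hc
    rw [countDiagram, hc]
    split_ifs with hi
    · rfl
    · by_contra hne
      exact hi (g1.1 i s hne).1
  rw [sigmaHighest, dif_pos hex, e', hs]
  exact congrArg (fun L => some (columnsTab n L)) (hcol h')

end Injective

/-! ### The involution on the two families -/

/-- The columns of the `±`-diagram of `sTop`. -/
def sColumns (Ft Gt Gl : List ℕ) (a b : ℕ) : List (ℕ × Sign) :=
  Ft.map (fun g => (g, Sign.plus)) ++ (Gt.map (fun g => (g, Sign.minus)) ++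
    Gl.map (fun g => (g, Sign.both))) ++
      (List.replicate b (1, Sign.dot) ++ List.replicate a (1, Sign.minus))

/-- The columns of the `±`-diagram of `rTop`. -/
def rColumns (Ft Gt Gl : List ℕ) (a b : ℕ) : List (ℕ × Sign) :=
  Gt.map (fun g => (g, Sign.plus)) ++ (Ft.map (fun g => (g, Sign.minus)) ++
    List.replicate b (3, Sign.both)) ++
      (Gl.map (fun g => (g - 2, Sign.dot)) ++ List.replicate a (1, Sign.plus))

/-- The columns, from left to right, of `kWord`. -/
def kCols : List ℕ → List ℕ → List (List KRLetter)
  | [], _ => []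
  | g :: G, P => kCol g (P.getD 1 1) (P.getD 0 1) :: kCols G (P.drop 2)

section Fill

variable {n : ℕ}

theorem flatten_kCols (G P : List ℕ) : (kCols G P).reverse.flatten = kWord G P := by
  induction G generalizing P with
  | nil => rfl
  | cons g G ih => simp [kCols, kWord, ih]

theorem kWord_take (G P : List ℕ) : kWord G (P.take (2 * G.length)) = kWord G P := by
  induction G generalizing P with
  | nil => rfl
  | cons g G ih =>
    rw [kWord, kWord, List.length_cons, Nat.mul_succ, List.drop_take, Nat.add_sub_cancel, ih]
    match P with
    | [] => simp
    | [p] => simp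
    | p :: q :: P => simp

theorem fillColumns_plus {F : List ℕ} (hF : ∀ g ∈ F, 1 ≤ g) (cs : List (ℕ × Sign)) (hs : List ℕ) :
    fillColumns n (F.map (fun g => (g, Sign.plus)) ++ cs)
      ((F.map (fun g => (g, Sign.plus))).filterMap (plusHeight n) ++ hs) =
      F.map (seg 1) ++ fillColumns n cs hs := by
  induction F with
  | nil => rfl
  | cons g F ih =>
    have ih := ih fun g hg => hF g (by simp [hg])
    have hg := hF g (by simp)
    rw [List.map_cons, List.cons_append, fillColumns_cons]
    by_cases h : g = n
    · rw [List.filterMap_cons_none (by simp [plusHeight, h])]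
      simpa [fillColumn, hasMinus, h] using ih
    · rw [List.filterMap_cons_some (b := g) (by simp [plusHeight, h])]
      have h0 : g ≠ 0 := by omega
      simpa [fillColumn, hasMinus, h, h0, fillString, seg_of_lt] using ih

theorem fillColumns_minus {M : List (ℕ × Sign)} (hM : ∀ c ∈ M, hasMinus c.2 = true ∧ 2 ≤ c.1)
    (cs : List (ℕ × Sign)) (hs : List ℕ) :
    fillColumns n (M ++ cs) hs = kCols (M.map (·.1)) (hs.map (· + 1)) ++
      fillColumns n cs (hs.drop (2 * M.length)) := by
  induction M generalizing hs with
  | nil => rfl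
  | cons c M ih =>
    obtain ⟨h1, h2⟩ := hM c (by simp)
    have h0 : c.1 - 1 ≠ 0 := by omega
    have h3 : (fillColumn n c hs).1 =
        kCol c.1 ((hs.map (· + 1)).getD 1 1) ((hs.map (· + 1)).getD 0 1) := by
      have h4 : c.1 - 1 + 1 = c.1 := by omega
      match hs with
      | [] => simp [fillColumn, h1, fillBar, fillString, h0, kCol, holeSeg, h4, seg_of_lt]
      | [x] => simp [fillColumn, h1, fillBar, fillString, h0, kCol, holeSeg, h4, seg_of_lt]
      | x :: y :: hs => simp [fillColumn, h1, fillBar, fillString, h0, kCol, holeSeg, h4]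
    have h5 : (fillColumn n c hs).2 = hs.drop 2 := by
      simp [fillColumn, h1, fillString_snd h0, fillBar_snd]
    rw [List.cons_append, fillColumns_cons, h3, h5, ih fun c hc => hM c (by simp [hc])]
    simp [kCols, Nat.mul_succ, Nat.add_comm]

theorem fillColumns_dots {cs : List (ℕ × Sign)} (hcs : ∀ c ∈ cs, hasMinus c.2 = false ∧
    ¬ (c.2 = Sign.plus ∧ c.1 = n) ∧ 1 ≤ c.1 ∧ c.1 + 2 ≤ n) (f : ℕ) :
    fillColumns n cs (List.replicate f 1) =
      (dotFill f (cs.map (·.1 + 2))).map (dotCol n) := by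
  induction cs generalizing f with
  | nil => rfl
  | cons c cs ih =>
    have ih := ih (fun c hc => hcs c (by simp [hc])) (f - 1)
    obtain ⟨h1, h2, h3, h4⟩ := hcs c (by simp)
    have h0 : c.1 ≠ 0 := by omega
    rw [fillColumns_cons, List.map_cons, dotFill, List.map_cons, dotCol_final h4, ← ih]
    cases f with
    | zero =>
      simp [fillColumn, h1, h2, fillString, h0, seg_cons (by omega : 2 ≤ c.1 + 1)]
    | succ f =>
      simp [fillColumn, h1, h2, fillString, h0, List.replicate_succ, seg_self]

theorem fillColumns_ones (a b : ℕ) :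
    fillColumns n (List.replicate b (1, Sign.dot) ++ List.replicate a (1, Sign.minus)) [] =
      List.replicate b [pos 2] ++ List.replicate a [neg 1] := by
  induction b with
  | zero =>
    induction a with
    | zero => rfl
    | succ a ih =>
      simp only [List.replicate_zero, List.nil_append, List.replicate_succ] at ih ⊢
      rw [fillColumns_cons]
      simpa [fillColumn, hasMinus, fillString, fillBar] using ih
  | succ b ih =>
    rw [List.replicate_succ, List.cons_append, fillColumns_cons, List.replicate_succ,
      List.cons_append]
    simpa [fillColumn, hasMinus, fillString, seg_self] using ih

end Fill

section Columns

variable {X : KRType} {n r a b : ℕ} {Ft Gt Gl : List ℕ}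

theorem pairwise_map_sign {F : List ℕ} (h : F.Pairwise (· ≥ ·)) (s : Sign) :
    (F.map fun g => (g, s)).Pairwise ColumnLE := by
  rw [List.pairwise_map]
  refine h.imp fun {x y} hxy => ?_
  rcases Nat.eq_or_lt_of_le hxy with rfl | hlt
  · exact Or.inr ⟨rfl, le_rfl⟩
  · exact Or.inl hlt

theorem pairwise_replicate_column (m : ℕ) (c : ℕ × Sign) :
    (List.replicate m c).Pairwise ColumnLE :=
  List.pairwise_replicate.mpr (Or.inr (Or.inr ⟨rfl, le_rfl⟩))

theorem columns_sColumns (hn : InRange X n r) (hr : 3 ≤ r) (hodd : Odd r)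
    (h : Config r Ft Gt Gl b) : Columns X n r (sColumns Ft Gt Gl a b) := by
  have hrn := le_of_inRange hn
  have hodd' : r % 2 = 1 := Nat.odd_iff.mp hodd
  have hs := h.sorted
  rw [List.pairwise_append, List.pairwise_append] at hs
  obtain ⟨p1, ⟨p2, p3, p4⟩, p5⟩ := hs
  have hF := h.boundsF
  have hGt := h.boundsGt
  have hGl := h.boundsGl
  have ho : (∀ g ∈ Ft, g % 2 = 1) ∧ (∀ g ∈ Gt, g % 2 = 1) ∧ ∀ g ∈ Gl, g % 2 = 1 :=
    ⟨fun g hg => h.odd g (by simp [hg]), fun g hg => h.odd g (by simp [hg]),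
      fun g hg => h.odd g (by simp [hg])⟩
  obtain ⟨o1, o2, o3⟩ := ho
  have hmem : ∀ c, c ∈ sColumns Ft Gt Gl a b → (c.2 = Sign.plus ∧ c.1 ∈ Ft) ∨
      (c.2 = Sign.minus ∧ c.1 ∈ Gt) ∨ (c.2 = Sign.both ∧ c.1 ∈ Gl) ∨
      (c.1 = 1 ∧ (c.2 = Sign.dot ∨ c.2 = Sign.minus)) := by
    intro c hc
    simp only [sColumns, List.mem_append, List.mem_map, List.mem_replicate] at hc
    grind
  refine ⟨?_, fun c hc => ?_, fun c hc => ?_, fun _ c hc => ?_⟩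
  · simp only [sColumns, List.pairwise_append, pairwise_map_sign p1, pairwise_map_sign p2,
      pairwise_map_sign p3, pairwise_replicate_column, List.mem_append, List.mem_map,
      List.mem_replicate, true_and]
    refine ⟨⟨?_, ?_⟩, ?_, ?_⟩
    all_goals
      intro c hc d hd
      unfold ColumnLE
      grind [signRank]
  · have := hmem c hc
    grind
  · have := hmem c hc
    grind
  · have := hmem c hc
    grind

theorem columns_rColumns (hn : InRange X n r) (hr : 3 ≤ r) (hodd : Odd r)
    (h : Config r Ft Gt Gl b) : Columns X n r (rColumns Ft Gt Gl a b) := by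
  have hrn := le_of_inRange hn
  have hodd' : r % 2 = 1 := Nat.odd_iff.mp hodd
  have hs := h.sorted
  rw [List.pairwise_append, List.pairwise_append] at hs
  obtain ⟨p1, ⟨p2, p3, p4⟩, p5⟩ := hs
  have hF := h.boundsF
  have hGt := h.boundsGt
  have hGl := h.boundsGl
  have ho : (∀ g ∈ Ft, g % 2 = 1) ∧ (∀ g ∈ Gt, g % 2 = 1) ∧ ∀ g ∈ Gl, g % 2 = 1 :=
    ⟨fun g hg => h.odd g (by simp [hg]), fun g hg => h.odd g (by simp [hg]),
      fun g hg => h.odd g (by simp [hg])⟩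
  obtain ⟨o1, o2, o3⟩ := ho
  have hmem : ∀ c, c ∈ rColumns Ft Gt Gl a b → (c.2 = Sign.minus ∧ c.1 ∈ Ft) ∨
      (c.2 = Sign.plus ∧ c.1 ∈ Gt) ∨ (c.2 = Sign.dot ∧ c.1 + 2 ∈ Gl) ∨
      (c.1 = 1 ∧ c.2 = Sign.plus) ∨ (c.1 = 3 ∧ c.2 = Sign.both) := by
    intro c hc
    simp only [rColumns, List.mem_append, List.mem_map, List.mem_replicate] at hc
    rcases hc with (hc | hc | hc) | ⟨g, hg, rfl⟩ | hc
    · grind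
    · grind
    · grind
    · right; right; left
      have := hGl g hg
      refine ⟨rfl, ?_⟩
      rwa [Nat.sub_add_cancel (by omega)]
    · grind
  have hGs : (Gl.map fun g => (g - 2, Sign.dot)).Pairwise ColumnLE := by
    have := pairwise_map_sign (F := Gl.map (· - 2))
      (List.pairwise_map.mpr (p3.imp fun {x y} hxy => Nat.sub_le_sub_right hxy 2)) Sign.dot
    rwa [List.map_map] at this
  have htop := h.top
  have hlow := h.low
  refine ⟨?_, fun c hc => ?_, fun c hc => ?_, fun _ c hc => ?_⟩
  · simp only [rColumns, List.pairwise_append, pairwise_map_sign p1, pairwise_map_sign p2,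
      hGs, pairwise_replicate_column, List.mem_append, List.mem_map,
      List.mem_replicate, true_and]
    refine ⟨⟨?_, ?_⟩, ?_, ?_⟩
    · intro c hc d hd
      unfold ColumnLE
      grind [signRank]
    · intro c hc d hd
      unfold ColumnLE
      grind [signRank]
    · rintro c ⟨g, hg, rfl⟩ d ⟨_, rfl⟩
      have := hGl g hg
      have := o3 g hg
      unfold ColumnLE
      simp only [signRank]
      omega
    · intro c hc d hd
      left
      have hd' : d.1 = 1 ∨ ∃ g ∈ Gl, d.1 = g - 2 := by grind
      have hc' : 3 ≤ c.1 := by grind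
      rcases hd' with hd' | ⟨g, hg, hd'⟩
      · omega
      · have hg3 := hGl g hg
        have : g ≤ c.1 := by grind
        omega
  · have := hmem c hc
    grind
  · have := hmem c hc
    grind
  · have := hmem c hc
    grind

theorem count_map_pair (F : List ℕ) (s t : Sign) (i : ℕ) :
    (F.map fun g => (g, t)).count (i, s) = if t = s then F.count i else 0 := by
  induction F with
  | nil => simp
  | cons g F ih =>
    simp only [List.map_cons, List.count_cons, ih, beq_iff_eq, Prod.mk.injEq]
    grind

theorem count_map_dot {G : List ℕ} (hG : ∀ g ∈ G, 2 ≤ g) (s t : Sign) (i : ℕ) :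
    (G.map fun g => (g - 2, t)).count (i, s) = if t = s then G.count (i + 2) else 0 := by
  induction G with
  | nil => simp
  | cons g F ih =>
    have := hG g (by simp)
    simp only [List.map_cons, List.count_cons, ih fun g hg => hG g (by simp [hg]), beq_iff_eq,
      Prod.mk.injEq]
    grind

theorem count_sColumns (i : ℕ) :
    (sColumns Ft Gt Gl a b).count (i, Sign.dot) = (if i = 1 then b else 0) ∧
    (sColumns Ft Gt Gl a b).count (i, Sign.plus) = Ft.count i ∧
    (sColumns Ft Gt Gl a b).count (i, Sign.minus) = Gt.count i + (if i = 1 then a else 0) ∧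
    (sColumns Ft Gt Gl a b).count (i, Sign.both) = Gl.count i := by
  simp only [sColumns, List.count_append, count_map_pair, List.count_replicate, beq_iff_eq,
    Prod.mk.injEq]
  grind

theorem count_rColumns (h : ∀ g ∈ Gl, 2 ≤ g) (i : ℕ) :
    (rColumns Ft Gt Gl a b).count (i, Sign.dot) = Gl.count (i + 2) ∧
    (rColumns Ft Gt Gl a b).count (i, Sign.plus) = Gt.count i + (if i = 1 then a else 0) ∧
    (rColumns Ft Gt Gl a b).count (i, Sign.minus) = Ft.count i ∧
    (rColumns Ft Gt Gl a b).count (i, Sign.both) = (if i = 3 then b else 0) := by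
  simp only [rColumns, List.count_append, count_map_pair, count_map_dot h, List.count_replicate,
    beq_iff_eq, Prod.mk.injEq]
  grind

/-- The diagrams of the two highest words are exchanged by `𝔖`. -/
theorem swap_sColumns (hr : 3 ≤ r) (h : Config r Ft Gt Gl b) :
    swapDiagram r (countDiagram (sColumns Ft Gt Gl a b)) =
      countDiagram (rColumns Ft Gt Gl a b) := by
  have hG : ∀ i, (i < 3 ∨ r < i) → Gl.count i = 0 := fun i hi => List.count_eq_zero.mpr fun hm => by
    have := h.boundsGl i hm
    omega
  funext i s
  obtain ⟨r1, r2, r3, r4⟩ := count_rColumns (Ft := Ft) (Gt := Gt) (a := a) (b := b)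
    (fun g hg => by have := h.boundsGl g hg; omega) i
  have hS := count_sColumns (Ft := Ft) (Gt := Gt) (Gl := Gl) (a := a) (b := b)
  cases s <;> simp only [swapDiagram, countDiagram, hS, r1, r2, r3, r4]
  · split_ifs with h1 h2
    · rfl
    · omega
    · rw [hG (i + 2) (by omega)]
  · grind

theorem swap_rColumns (hr : 3 ≤ r) (h : Config r Ft Gt Gl b) :
    swapDiagram r (countDiagram (rColumns Ft Gt Gl a b)) =
      countDiagram (sColumns Ft Gt Gl a b) := by
  have hG : ∀ i, (i < 3 ∨ r < i) → Gl.count i = 0 := fun i hi => List.count_eq_zero.mpr fun hm => by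
    have := h.boundsGl i hm
    omega
  funext i s
  have hR := count_rColumns (Ft := Ft) (Gt := Gt) (a := a) (b := b)
    (fun g hg => by have := h.boundsGl g hg; omega)
  obtain ⟨s1, s2, s3, s4⟩ := count_sColumns (Ft := Ft) (Gt := Gt) (Gl := Gl) (a := a) (b := b) i
  cases s <;> simp only [swapDiagram, countDiagram, hR, s1, s2, s3, s4]
  · have := hG (i + 2)
    grind
  · split_ifs with h1
    · rw [Nat.sub_add_cancel h1]
    · rw [hG i (by omega)]

/-- The heights, in the order of the reading word, of the columns of `sTop`. -/
def sHeights (Ft Gt Gl : List ℕ) (m : ℕ) : List ℕ :=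
  List.replicate m 1 ++ (Ft ++ (Gt ++ Gl)).reverse

/-- The heights, in the order of the reading word, of the columns of `rTop`. -/
def rHeights (Ft Gt Gl : List ℕ) (a b : ℕ) : List ℕ :=
  ((rColumns Ft Gt Gl a b).map (·.1)).reverse

theorem columnsTab_eq (hn : InRange X n r) {L : List (ℕ × Sign)} (h : Columns X n r L) :
    columnsTab n L = ⟨(L.map (·.1)).reverse,
      (fillColumns n L (L.filterMap (plusHeight n))).reverse.flatten⟩ := by
  rw [columnsTab, List.map_reverse, (h.remaining hn).map_length]

theorem columnsTab_sColumns (hn : InRange X n r) (hr : 3 ≤ r) (hodd : Odd r)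
    (h : Config r Ft Gt Gl b) : columnsTab n (sColumns Ft Gt Gl a b) =
      ⟨sHeights Ft Gt Gl (a + b), sTop Ft Gt Gl a b⟩ := by
  have hrn := le_of_inRange hn
  rw [columnsTab_eq hn (columns_sColumns hn hr hodd h), Tab.mk.injEq]
  constructor
  · simp [sColumns, sHeights, Function.comp_def, ← List.append_assoc,
      List.replicate_append_replicate]
  · have e1 : ((List.map (fun g => (g, Sign.minus)) Gt ++ List.map (fun g => (g, Sign.both)) Gl ++
        (List.replicate b (1, Sign.dot) ++ List.replicate a (1, Sign.minus))).filterMap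
          (plusHeight n)) = Gl.map (· - 1) := by
      have : ∀ c, (List.replicate c (1, Sign.minus)).filterMap (plusHeight n) = [] := by
        intro c; induction c <;> simp_all [List.replicate_succ, plusHeight]
      have h' : ∀ c, (List.replicate c (1, Sign.dot)).filterMap (plusHeight n) = [] := by
        intro c; induction c <;> simp_all [List.replicate_succ, plusHeight]
      simp only [List.filterMap_append, List.filterMap_map, this, h', List.append_nil]
      have h1 : Gt.filterMap (plusHeight n ∘ fun g => (g, Sign.minus)) = [] := by
        simp [Function.comp_def, plusHeight]
      rw [h1, List.nil_append]
      simp [Function.comp_def, plusHeight]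
    have e2 : Gl.map ((· + 1) ∘ (· - 1)) = Gl := by
      refine (List.map_congr_left (g := id) fun g hg => ?_).trans (List.map_id _)
      have := h.boundsGl g hg
      simp only [Function.comp, id]
      omega
    rw [sColumns, List.append_assoc, List.filterMap_append, e1,
      fillColumns_plus (fun g hg => by have := h.boundsF g hg; omega), fillColumns_minus (by
        intro c hc
        rcases List.mem_append.mp hc with hc | hc
        · obtain ⟨g, hg, rfl⟩ := List.mem_map.mp hc
          have := h.boundsGt g hg
          exact ⟨rfl, by simp only; omega⟩
        · obtain ⟨g, hg, rfl⟩ := List.mem_map.mp hc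
          have := h.boundsGl g hg
          exact ⟨rfl, by simp only; omega⟩), List.map_map, e2]
    have e3 : (Gl.map (· - 1)).drop (2 * (Gt.map (fun g => (g, Sign.minus)) ++
        Gl.map (fun g => (g, Sign.both))).length) = [] := by
      rw [List.drop_eq_nil_iff]
      simp
      omega
    rw [e3, fillColumns_ones]
    simp only [List.reverse_append, List.flatten_append, List.map_append, List.map_map,
      flatten_kCols, List.reverse_replicate, Function.comp_def, List.map_id', ← colWord_eq_flatten,
      sTop]
    rcases h.low with rfl | hl
    · simp
    · rcases h.top with ht | ⟨_, rfl⟩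
      · subst hl ht
        simp [kWord]
      · simp

theorem columnsTab_rColumns (hn : InRange X n r) (hr : 3 ≤ r) (hodd : Odd r)
    (h : Config r Ft Gt Gl b) : columnsTab n (rColumns Ft Gt Gl a b) =
      ⟨rHeights Ft Gt Gl a b, rTop n Ft Gt Gl a b⟩ := by
  have hrn := le_of_inRange hn
  rw [columnsTab_eq hn (columns_rColumns hn hr hodd h), Tab.mk.injEq]
  refine ⟨rfl, ?_⟩
  have h1n : 1 ≠ n := by omega
  have e1 : ((Ft.map (fun g => (g, Sign.minus)) ++ List.replicate b (3, Sign.both) ++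
      (Gl.map (fun g => (g - 2, Sign.dot)) ++ List.replicate a (1, Sign.plus))).filterMap
        (plusHeight n)) = List.replicate b 2 ++ List.replicate a 1 := by
    have h1 : ∀ c, (List.replicate c (1, Sign.plus)).filterMap (plusHeight n) =
        List.replicate c 1 := by
      intro c; induction c <;> simp_all [List.replicate_succ, plusHeight]
    have h2 : ∀ c, (List.replicate c (3, Sign.both)).filterMap (plusHeight n) =
        List.replicate c 2 := by
      intro c; induction c <;> simp_all [List.replicate_succ, plusHeight]
    simp only [List.filterMap_append, List.filterMap_map, h1, h2]
    have h3 : Ft.filterMap (plusHeight n ∘ fun g => (g, Sign.minus)) = [] := by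
      simp [Function.comp_def, plusHeight]
    have h4 : Gl.filterMap (plusHeight n ∘ fun g => (g - 2, Sign.dot)) = [] := by
      simp [Function.comp_def, plusHeight]
    rw [h3, h4, List.nil_append, List.nil_append]
  rw [rColumns, List.append_assoc, List.filterMap_append, e1,
    fillColumns_plus (fun g hg => by have := h.boundsGt g hg; omega), fillColumns_minus (by
      intro c hc
      rcases List.mem_append.mp hc with hc | hc
      · obtain ⟨g, hg, rfl⟩ := List.mem_map.mp hc
        have := h.boundsF g hg
        exact ⟨rfl, by simp only; omega⟩
      · obtain ⟨_, rfl⟩ := List.mem_replicate.mp hc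
        exact ⟨rfl, by simp⟩)]
  have hlen : (Ft.map (fun g => (g, Sign.minus)) ++ List.replicate b (3, Sign.both)).length =
      (Ft ++ List.replicate b 3).length := by simp
  have hfst : (Ft.map (fun g => (g, Sign.minus)) ++ List.replicate b (3, Sign.both)).map
      (fun c : ℕ × Sign => c.1) =
      Ft ++ List.replicate b 3 := by simp [Function.comp_def]
  have hF : b ≤ 2 * (Ft ++ List.replicate b 3).length := by simp; omega
  have e3 : (List.replicate b 2 ++ List.replicate a 1).drop
      (2 * (Ft.map (fun g => (g, Sign.minus)) ++ List.replicate b (3, Sign.both)).length) =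
      List.replicate (a + b - 2 * (Ft ++ List.replicate b 3).length) 1 := by
    rw [hlen, List.drop_append, List.drop_replicate, List.drop_replicate, List.length_replicate,
      Nat.sub_eq_zero_of_le hF, List.replicate_zero, List.nil_append]
    congr 1
    omega
  have e4 : kWord (Ft ++ List.replicate b 3) ((List.replicate b 2 ++ List.replicate a 1).map
      (· + 1)) = kWord (Ft ++ List.replicate b 3) (List.replicate b 3 ++
      List.replicate (min (a + b) (2 * (Ft ++ List.replicate b 3).length) - b) 2) := by
    rw [← kWord_take, List.map_append, List.map_replicate, List.map_replicate, List.take_append,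
      List.take_replicate, List.take_replicate, List.length_replicate, min_eq_right hF]
    congr 3
    omega
  have e5 : (Gl.map (fun g => (g - 2, Sign.dot)) ++ List.replicate a (1, Sign.plus)).map
      (fun c : ℕ × Sign => c.1 + 2) = Gl ++ List.replicate a 3 := by
    rw [List.map_append, List.map_map, List.map_replicate]
    congr 1
    refine (List.map_congr_left (g := id) fun g hg => ?_).trans (List.map_id _)
    have := h.boundsGl g hg
    simp only [Function.comp, id]
    omega
  rw [hfst, e3, fillColumns_dots (by
    intro c hc
    rcases List.mem_append.mp hc with hc | hc
    · obtain ⟨g, hg, rfl⟩ := List.mem_map.mp hc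
      have := h.boundsGl g hg
      refine ⟨rfl, by simp, ?_, ?_⟩ <;> simp only <;> omega
    · obtain ⟨_, rfl⟩ := List.mem_replicate.mp hc
      exact ⟨rfl, by simp [h1n], by simp, by simp; omega⟩), e5]
  simp only [List.reverse_append, List.flatten_append, flatten_kCols, e4, ← colWord_eq_flatten,
    rTop, rDots, List.append_assoc]

/-- The involution exchanges the two families of highest tableaux. -/
theorem sigmaHighest_sTop {k : ℕ} (hn : InRange X n r) (hr : 3 ≤ r) (hodd : Odd r)
    (h : Config r Ft Gt Gl b) (hk : (Ft ++ (Gt ++ Gl)).length + (a + b) = k) :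
    sigmaHighest X n r k ⟨sHeights Ft Gt Gl (a + b), sTop Ft Gt Gl a b⟩ =
      some ⟨rHeights Ft Gt Gl a b, rTop n Ft Gt Gl a b⟩ := by
  have := sigmaHighest_columnsTab hn (columns_sColumns (a := a) hn hr hodd h)
    (columns_rColumns hn hr hodd h) (swap_sColumns hr h)
  rw [columnsTab_sColumns hn hr hodd h, columnsTab_rColumns hn hr hodd h] at this
  convert this using 2
  rw [← hk]
  simp [sColumns]
  omega

theorem sigmaHighest_rTop {k : ℕ} (hn : InRange X n r) (hr : 3 ≤ r) (hodd : Odd r)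
    (h : Config r Ft Gt Gl b) (hk : (Ft ++ (Gt ++ Gl)).length + (a + b) = k) :
    sigmaHighest X n r k ⟨rHeights Ft Gt Gl a b, rTop n Ft Gt Gl a b⟩ =
      some ⟨sHeights Ft Gt Gl (a + b), sTop Ft Gt Gl a b⟩ := by
  have := sigmaHighest_columnsTab hn (columns_rColumns (a := a) hn hr hodd h)
    (columns_sColumns hn hr hodd h) (swap_rColumns hr h)
  rw [columnsTab_sColumns hn hr hodd h, columnsTab_rColumns hn hr hodd h] at this
  convert this using 2
  rw [← hk]
  simp [rColumns]
  omega

end Columns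

section Sigma

variable {X : KRType} {n r k : ℕ}

theorem partialIter_eTab {i m : ℕ} {u v : List KRLetter} (h : partialIter (eWd X n i) m u = some v)
    (hts : List ℕ) : partialIter (eTab X n i) m ⟨hts, u⟩ = some ⟨hts, v⟩ := by
  induction m generalizing u with
  | zero => simp_all [partialIter]
  | succ m ih =>
    simp only [partialIter, Option.bind_eq_some_iff] at h ⊢
    obtain ⟨w, hw, h⟩ := h
    exact ⟨⟨hts, w⟩, by simp [eTab, hw], ih h⟩

theorem partialIter_fTab {i m : ℕ} {u v : List KRLetter} (h : partialIter (fWd X n i) m u = some v)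
    (hts : List ℕ) : partialIter (fTab X n i) m ⟨hts, u⟩ = some ⟨hts, v⟩ := by
  induction m generalizing u with
  | zero => simp_all [partialIter]
  | succ m ih =>
    simp only [partialIter, Option.bind_eq_some_iff] at h ⊢
    obtain ⟨w, hw, h⟩ := h
    exact ⟨⟨hts, w⟩, by simp [fTab, hw], ih h⟩

/-- If two words are raised along the same path to highest words that are exchanged by the
involution, then the involution exchanges the two words. -/
theorem sigmaAlong_raises {z z' : Prop} {L : List (ℕ × ℕ)} (hL : ∀ p ∈ L, 1 ≤ p.1)
    {S S' R R' : List KRLetter} {hs hs' : List ℕ} (h : Raises X n z L S S')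
    (h' : Raises X n z' L R R')
    (he : sigmaHighest X n r k ⟨hs, S'⟩ = some ⟨hs', R'⟩) :
    sigmaAlong X n r k (L.map (·.1)) ⟨hs, S⟩ = some ⟨hs', R⟩ := by
  induction L generalizing S R with
  | nil =>
    simp only [Raises] at h h'
    subst h h'
    exact he
  | cons p L ih =>
    obtain ⟨i, m⟩ := p
    obtain ⟨S1, ⟨q, r1, _⟩, h⟩ := h
    obtain ⟨R1, ⟨q', r1', _⟩, h'⟩ := h'
    have hi : 1 ≤ i := hL (i, m) (by simp)
    rw [List.map_cons, sigmaAlong]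
    simp only [r1.eps]
    rw [partialIter_eTab r1.iter, Option.bind_some, ih (fun p hp => hL p (by simp [hp])) h h',
      Option.bind_some]
    exact partialIter_fTab (partialIter_eWd hi r1'.iter).2.2 _

theorem nodesDown_eq (X : KRType) (n i : ℕ) :
    nodesDown X n i = (List.range' i (turn X n - i)).reverse := by
  cases X <;> simp [nodesDown, turn]

theorem raises_zero {z : Prop} {u : List KRLetter} {js : List ℕ}
    (h : ∀ j ∈ js, epsWord X n j u = 0) (hz : ¬ z) :
    Raises X n z (js.map fun j => (j, 0)) u u := by
  induction js with
  | nil => rfl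
  | cons j js ih =>
    exact ⟨u, ⟨_, Raise.refl (h j (by simp)) rfl, fun h => absurd h hz⟩,
      ih fun i hi => h i (by simp [hi])⟩

/-- The path along `raisingWord` of a word that is highest for the nodes `3, …, n`. -/
def raisingPath (X : KRType) (n : ℕ) (Ft Gl : List ℕ) (b : ℕ) : List (ℕ × ℕ) :=
  ((List.range' 3 (n - 2)).reverse.flatMap fun i => nodesUp n i ++ nodesDown X n i).map
    (fun j => (j, 0)) ++ topPath X n Ft Gl b

theorem topPath_nodes (hn : InRange X n r) (hr : 3 ≤ r) (Ft Gl : List ℕ) (b : ℕ) :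
    (topPath X n Ft Gl b).map (·.1) = nodesUp n 2 ++ nodesDown X n 2 := by
  have hrn := le_of_inRange hn
  have htb := turn_bounds hn
  have h1 : nodesUp n 2 = 2 :: (List.range' 3 (n - 3) ++ [n]) := by
    rw [nodesUp, show n + 1 - 2 = (n - 3) + 1 + 1 by omega, List.range'_succ, List.range'_concat]
    congr 3
    omega
  have h2 : nodesDown X n 2 = (List.range' 3 (turn X n - 3)).reverse ++ [2] := by
    rw [nodesDown_eq, show turn X n - 2 = (turn X n - 3) + 1 by omega, List.range'_succ,
      List.reverse_cons]
  rw [h1, h2, topPath, middlePath]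
  simp [Function.comp_def]

theorem raisingPath_nodes (hn : InRange X n r) (hr : 3 ≤ r) (Ft Gl : List ℕ) (b : ℕ) :
    (raisingPath X n Ft Gl b).map (·.1) = raisingWord X n := by
  have hrn := le_of_inRange hn
  rw [raisingPath, List.map_append, topPath_nodes hn hr, raisingWord,
    show n - 1 = (n - 2) + 1 by omega, List.range'_succ, List.reverse_cons, List.flatMap_append]
  simp [Function.comp_def]

theorem raisingPath_pos (hn : InRange X n r) (hr : 3 ≤ r) {Ft Gl : List ℕ} {b : ℕ} {p : ℕ × ℕ}
    (hp : p ∈ raisingPath X n Ft Gl b) : 1 ≤ p.1 := by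
  have hrn := le_of_inRange hn
  have := List.mem_map_of_mem (f := (·.1)) hp
  rw [raisingPath_nodes hn hr, raisingWord] at this
  simp only [List.mem_flatMap, List.mem_reverse, List.mem_range'_1, List.mem_append, nodesUp,
    nodesDown_eq] at this
  omega

theorem raises_raisingPath (hn : InRange X n r) (hr : 3 ≤ r) {Ft Gl : List ℕ} {b : ℕ}
    {u v : List KRLetter} (hu : ∀ i, 3 ≤ i → i ≤ n → epsWord X n i u = 0)
    (h : Raises X n False (topPath X n Ft Gl b) u v) :
    Raises X n False (raisingPath X n Ft Gl b) u v := by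
  have htb := turn_bounds hn
  refine Raises.append (raises_zero (fun j hj => ?_) id) h
  simp only [List.mem_flatMap, List.mem_reverse, List.mem_range'_1, List.mem_append, nodesUp,
    nodesDown_eq] at hj
  exact hu j (by omega) (by omega)

variable {a b : ℕ} {Ft Gt Gl : List ℕ}

/-- The involution `σ` exchanges `sWord` and `rWord`. -/
theorem sigma_sWord (hn : InRange X n r) (hr : 3 ≤ r) (hodd : Odd r)
    (h : Config r Ft Gt Gl b) (hk : (Ft ++ (Gt ++ Gl)).length + (a + b) = k) :
    sigma X n r k ⟨sHeights Ft Gt Gl (a + b), sWord Ft Gt Gl a b⟩ =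
      some ⟨rHeights Ft Gt Gl a b, rWord Ft Gt Gl a b⟩ := by
  rw [sigma, ← raisingPath_nodes hn hr Ft Gl b]
  exact sigmaAlong_raises (fun p hp => raisingPath_pos hn hr hp)
    (raises_raisingPath hn hr (fun i h1 h2 => epsWord_sWord hn hr h h1 h2) (raises_sWord hn hr h))
    (raises_raisingPath hn hr (fun i h1 h2 => epsWord_rWord hn hr h h1 h2)
      (raises_rWord hn hr h (by simp)))
    (sigmaHighest_sTop hn hr hodd h hk)

/-- The inverse of `sigma_sWord`. -/
theorem sigma_rWord (hn : InRange X n r) (hr : 3 ≤ r) (hodd : Odd r)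
    (h : Config r Ft Gt Gl b) (hk : (Ft ++ (Gt ++ Gl)).length + (a + b) = k) :
    sigma X n r k ⟨rHeights Ft Gt Gl a b, rWord Ft Gt Gl a b⟩ =
      some ⟨sHeights Ft Gt Gl (a + b), sWord Ft Gt Gl a b⟩ := by
  rw [sigma, ← raisingPath_nodes hn hr Ft Gl b]
  exact sigmaAlong_raises (fun p hp => raisingPath_pos hn hr hp)
    (raises_raisingPath hn hr (fun i h1 h2 => epsWord_rWord hn hr h h1 h2)
      (raises_rWord hn hr h (by simp)))
    (raises_raisingPath hn hr (fun i h1 h2 => epsWord_sWord hn hr h h1 h2) (raises_sWord hn hr h))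
    (sigmaHighest_rTop hn hr hodd h hk)

end Sigma

/-! ### The `0`-string through a highest weight element -/

/-- Missing values are `1`. -/
theorem kWord_pad (G P : List ℕ) (c : ℕ) : kWord G (P ++ List.replicate c 1) = kWord G P := by
  induction G generalizing P c with
  | nil => rfl
  | cons g G ih =>
    have hget : ∀ s, (P ++ List.replicate c 1).getD s 1 = P.getD s 1 := by
      intro s
      rw [List.getD_eq_getElem?_getD, List.getD_eq_getElem?_getD, List.getElem?_append]
      split_ifs with h
      · rfl
      · rw [List.getElem?_replicate, List.getElem?_eq_none (by omega)]
        split_ifs <;> rfl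
    have hdrop : (P ++ List.replicate c 1).drop 2 =
        P.drop 2 ++ List.replicate (c - (2 - P.length)) 1 := by
      rw [List.drop_append, List.drop_replicate]
    rw [kWord, kWord, hget, hget, hdrop, ih]

/-- The elements of the `1`-string through the image under `σ` of a classical highest weight element
with `m` columns of height `1`, the others having heights `G`. -/
def stepWord (G : List ℕ) (m j : ℕ) : List KRLetter :=
  List.replicate (m - (j - 2 * G.length)) (neg 1) ++
    (List.replicate (j - 2 * G.length) (neg 2) ++
      kWord G (List.replicate (min j (2 * G.length)) 2))

section Steps

variable {X : KRType} {n r m : ℕ} {G : List ℕ}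

/-- Every element of the `1`-string is of the form `sWord`. -/
theorem exists_config (hs : G.Pairwise (· ≥ ·)) (hb : ∀ g ∈ G, 3 ≤ g ∧ g ≤ r)
    (ho : ∀ g ∈ G, g % 2 = 1) {j : ℕ} (hj : j ≤ 2 * G.length + m) :
    ∃ Ft Gt Gl a b, Config r Ft Gt Gl b ∧ Ft ++ (Gt ++ Gl) = G ∧ a + b = m ∧
      sWord Ft Gt Gl a b = stepWord G m j := by
  rcases Nat.lt_or_ge j G.length with h | h
  · refine ⟨[], G.take (G.length - j), G.drop (G.length - j), m, 0, ⟨?_, ?_, ?_, ?_, ?_⟩, ?_, rfl,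
      ?_⟩
    · simpa using hs
    · simpa using hb
    · simpa using ho
    · right; simp
    · left; rfl
    · simp
    · have h1 : j - 2 * G.length = 0 := by omega
      have h2 : min j (2 * G.length) = j := by omega
      have h3 : G.length - (G.length - j) = j := by omega
      simp [sWord, stepWord, h1, h2, h3, kWord]
  · rcases Nat.lt_or_ge j (2 * G.length) with h' | h'
    · refine ⟨G.take (j - G.length), [], G.drop (j - G.length), m, 0, ⟨?_, ?_, ?_, ?_, ?_⟩, ?_, rfl,
        ?_⟩
      · simpa using hs
      · simpa using hb
      · simpa using ho
      · left; rfl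
      · left; rfl
      · simp
      · have h1 : j - 2 * G.length = 0 := by omega
        have h2 : min j (2 * G.length) = j := by omega
        have h4 : (G.take (j - G.length)).length = j - G.length := by
          rw [List.length_take]; omega
        have h5 := kWord_append (F := G.take (j - G.length)) (G := G.drop (j - G.length))
          (P := List.replicate (2 * (j - G.length)) 2)
          (Q := List.replicate (G.length - (j - G.length)) 2) (by simp [h4])
        rw [List.take_append_drop, List.replicate_append_replicate,
          show 2 * (j - G.length) + (G.length - (j - G.length)) = j by omega] at h5
        simp only [sWord, stepWord, h1, h2, h4, h5, List.nil_append, List.length_drop,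
          List.replicate_zero, Nat.sub_zero, List.append_assoc]
    · refine ⟨G, [], [], m - (j - 2 * G.length), j - 2 * G.length, ⟨?_, ?_, ?_, ?_, ?_⟩, ?_, ?_,
        ?_⟩
      · simpa using hs
      · simpa using hb
      · simpa using ho
      · left; rfl
      · right; rfl
      · simp
      · omega
      · have h2 : min j (2 * G.length) = 2 * G.length := by omega
        simp [sWord, stepWord, h2, kWord]

theorem eWd_replicate_neg_one (hn : 1 < n) (a : ℕ) :
    eWd X n 1 (List.replicate (a + 1) (neg 1)) = some (List.replicate a (neg 1) ++ [neg 2]) := by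
  have h1 : phiWord X n 1 (List.replicate a (neg 1)) = 0 := phiWord_eq_zero_of_letters (by
    intro x hx
    obtain ⟨_, rfl⟩ := List.mem_replicate.mp hx
    rw [phiLetter_neg le_rfl hn, if_neg (by omega)])
  rw [List.replicate_succ', eWd_append, h1, epsWord_singleton, epsLetter_neg le_rfl hn,
    if_pos rfl, if_neg (by omega)]
  simp [eWd, epsWord, eLetter_neg le_rfl hn]

/-- The words `stepWord G m j` form a `1`-string. -/
theorem eWd_stepWord (hn : 1 < n) (hG : ∀ g ∈ G, 3 ≤ g ∧ g ≤ n) {j : ℕ}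
    (hj : j < 2 * G.length + m) :
    eWd X n 1 (stepWord G m j) = some (stepWord G m (j + 1)) := by
  have hG' : ∀ g ∈ G, 1 < g ∧ g ≤ n := fun g hg => by have := hG g hg; omega
  have h1 : ∀ a, phiWord X n 1 (List.replicate a (neg 1)) = 0 := fun a =>
    phiWord_eq_zero_of_letters (by
      intro x hx
      obtain ⟨_, rfl⟩ := List.mem_replicate.mp hx
      rw [phiLetter_neg le_rfl hn, if_neg (by omega)])
  rcases Nat.lt_or_ge j (2 * G.length) with h | h
  · obtain ⟨e1, _, e3⟩ := kWord_move (X := X) le_rfl hn hG' (Q := List.replicate j 2)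
      (by intro q hq; have := (List.mem_replicate.mp hq).2; omega) (s := 2 * G.length - j)
      (by simp; omega) (by simp; omega)
    have e3 := e3 (2 * G.length - (j + 1)) (by omega)
    have hl : List.replicate j 2 ++ (1 + 1) :: List.replicate (2 * G.length - (j + 1)) 1 =
        List.replicate (j + 1) 2 ++ List.replicate (2 * G.length - (j + 1)) 1 := by
      rw [List.replicate_succ', List.append_assoc]; rfl
    rw [hl, kWord_pad, kWord_pad] at e3
    rw [kWord_pad] at e1
    have h2 : j - 2 * G.length = 0 := by omega
    have h3 : j + 1 - 2 * G.length = 0 := by omega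
    have h4 : min j (2 * G.length) = j := by omega
    have h5 : min (j + 1) (2 * G.length) = j + 1 := by omega
    rw [stepWord, stepWord, h2, h3, h4, h5, List.replicate_zero, List.nil_append, List.nil_append,
      eWd_append, h1, e1, if_neg (by omega), e3]
    rfl
  · obtain ⟨e1, _, _⟩ := kWord_move (X := X) le_rfl hn hG' (Q := List.replicate (2 * G.length) 2)
      (by intro q hq; have := (List.mem_replicate.mp hq).2; omega) (s := 0)
      (by simp) (by simp)
    rw [List.replicate_zero, List.append_nil] at e1
    have h4 : min j (2 * G.length) = 2 * G.length := by omega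
    have h5 : min (j + 1) (2 * G.length) = 2 * G.length := by omega
    obtain ⟨a, ha⟩ : ∃ a, m - (j - 2 * G.length) = a + 1 :=
      ⟨m - (j - 2 * G.length) - 1, by omega⟩
    have h2 : epsWord X n 1 (List.replicate (j - 2 * G.length) (neg 2)) = 0 :=
      epsWord_eq_zero_of_letters (by
        intro x hx
        obtain ⟨_, rfl⟩ := List.mem_replicate.mp hx
        rw [epsLetter_neg le_rfl hn, if_neg (by omega)])
    rw [stepWord, stepWord, h4, h5, ha, show m - (j + 1 - 2 * G.length) = a by omega,
      show j + 1 - 2 * G.length = (j - 2 * G.length) + 1 by omega, eWd_append, epsWord_append,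
      h2, e1, if_pos (by omega), eWd_replicate_neg_one hn]
    simp [List.replicate_succ]

/-- The `1`-string of the words `stepWord` begins at `j = 0`, whence `f_0` kills the highest weight
element. -/
theorem phiWord_stepWord_zero (hn : 1 < n) (hG : ∀ g ∈ G, 3 ≤ g ∧ g ≤ n) :
    phiWord X n 1 (stepWord G m 0) = 0 := by
  have hG' : ∀ g ∈ G, 1 < g ∧ g ≤ n := fun g hg => by have := hG g hg; omega
  obtain ⟨_, e2, _⟩ := kWord_move (X := X) le_rfl hn hG' (Q := []) (by simp)
    (s := 2 * G.length) (by simp) (by simp)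
  rw [kWord_pad] at e2
  have h1 : phiWord X n 1 (List.replicate m (neg 1)) = 0 :=
    phiWord_eq_zero_of_letters (by
      intro x hx
      obtain ⟨_, rfl⟩ := List.mem_replicate.mp hx
      rw [phiLetter_neg le_rfl hn, if_neg (by omega)])
  simp [stepWord, phiWord_append, h1, e2]

/-- The tableau at the end of the `0`-string through a highest weight element. -/
def endTab (G : List ℕ) (m : ℕ) : Tab := ⟨rHeights G [] [] 0 m, rWord G [] [] 0 m⟩

/-- The classical highest weight tableau with `m` columns of height `1`, the heights of the others
being, from left to right, the elements of `G`. -/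
def topTab (G : List ℕ) (m : ℕ) : Tab :=
  ⟨List.replicate m 1 ++ G.reverse, List.replicate m (pos 1) ++ colWord (seg 1) G⟩

theorem topTab_eq (G : List ℕ) (m : ℕ) :
    topTab G m = ⟨rHeights [] G [] m 0, rWord [] G [] m 0⟩ := by
  rw [topTab, Tab.mk.injEq]
  constructor
  · simp [rHeights, rColumns, Function.comp_def]
  · have : ∀ f a, a ≤ f → colWord dotStart (dotFill f (List.replicate a 3)) =
        List.replicate a (pos 1) := by
      intro f a
      induction a generalizing f with
      | zero => intro _; rfl
      | succ a ih =>
        intro hf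
        rw [List.replicate_succ, dotFill, colWord, ih _ (by omega), if_pos (by omega),
          List.replicate_succ']
        rfl
    simp [rWord, rDots, this, freeFill, colWord]

/-- The `0`-string through a highest weight element. -/
theorem exists_zeroString {k : ℕ} (hn : InRange X n r) (hr : 3 ≤ r) (hodd : Odd r)
    (hs : G.Pairwise (· ≥ ·)) (hb : ∀ g ∈ G, 3 ≤ g ∧ g ≤ r) (ho : ∀ g ∈ G, g % 2 = 1)
    (hk : G.length + m = k) :
    partialIter ((crystal X n r k).e 0) (2 * k - m) (topTab G m) = some (endTab G m) ∧
    (crystal X n r k).f 0 (topTab G m) = none := by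
  have hrn := le_of_inRange hn
  have hG : ∀ g ∈ G, 3 ≤ g ∧ g ≤ n := fun g hg => by have := hb g hg; omega
  have hsig : ∀ j, j ≤ 2 * G.length + m → ∃ R, sigma X n r k R =
      some ⟨sHeights G [] [] m, stepWord G m j⟩ ∧
      sigma X n r k ⟨sHeights G [] [] m, stepWord G m j⟩ = some R := by
    intro j hj
    obtain ⟨Ft, Gt, Gl, a, b, hc, hcat, hab, hw⟩ := exists_config hs hb ho hj
    have hlen : (Ft ++ (Gt ++ Gl)).length + (a + b) = k := by rw [hcat, hab, hk]
    have hh : sHeights Ft Gt Gl (a + b) = sHeights G [] [] m := by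
      rw [sHeights, sHeights, hcat, hab]
      simp
    have h1 := sigma_sWord hn hr hodd hc hlen
    have h2 := sigma_rWord hn hr hodd hc hlen
    rw [hh, hw] at h1 h2
    exact ⟨_, h2, h1⟩
  have hc0 : Config r [] G [] 0 := ⟨by simpa using hs, by simpa using hb, by simpa using ho,
    Or.inr ⟨rfl, rfl⟩, Or.inl rfl⟩
  have h0 : sigma X n r k (topTab G m) = some ⟨sHeights G [] [] m, stepWord G m 0⟩ := by
    have := sigma_rWord (a := m) (k := k) hn hr hodd hc0 (by simpa using hk)
    rw [← topTab_eq] at this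
    rw [this]
    simp [sHeights, sWord, stepWord, kWord]
  have hc1 : Config r G [] [] m := ⟨by simpa using hs, by simpa using hb, by simpa using ho,
    Or.inl rfl, Or.inr rfl⟩
  have h1 : sigma X n r k ⟨sHeights G [] [] m, stepWord G m (2 * G.length + m)⟩ =
      some (endTab G m) := by
    have := sigma_sWord (a := 0) (k := k) hn hr hodd hc1 (by simpa using hk)
    rw [endTab, ← this]
    simp [sWord, stepWord, kWord]
  -- As `e_0 = σ e_1 σ`, the `1`-string of the words `stepWord` becomes the `0`-string.
  have hstep : ∀ d j, j + d = 2 * G.length + m → ∀ R, sigma X n r k R =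
      some ⟨sHeights G [] [] m, stepWord G m j⟩ →
      sigma X n r k ⟨sHeights G [] [] m, stepWord G m j⟩ = some R →
      partialIter ((crystal X n r k).e 0) d R = some (endTab G m) := by
    intro d
    induction d with
    | zero =>
      intro j hj R _ hR
      obtain rfl : j = 2 * G.length + m := by omega
      rw [h1] at hR
      exact hR.symm
    | succ d ih =>
      intro j hj R hR _
      obtain ⟨R', h3, h4⟩ := hsig (j + 1) (by omega)
      have he : (crystal X n r k).e 0 R = some R' := by
        simp only [crystal, if_true]
        rw [hR, Option.bind_some, eTab, eWd_stepWord (by omega) hG (by omega)]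
        exact h4
      rw [partialIter, he, Option.bind_some]
      exact ih (j + 1) (by omega) R' h3 h4
  refine ⟨?_, ?_⟩
  · refine hstep (2 * k - m) 0 (by omega) _ h0 ?_
    have := sigma_sWord (a := m) (k := k) hn hr hodd hc0 (by simpa using hk)
    rw [← topTab_eq] at this
    rw [← this]
    simp [sHeights, sWord, stepWord, kWord]
  · simp only [crystal, if_true]
    rw [h0, Option.bind_some, fTab, (fWd_eq_none le_rfl _).mpr
      (phiWord_stepWord_zero (by omega) hG)]
    rfl

end Steps

/-! ### One-row tableaux -/

/-- Move `t` units from coordinate `a` to coordinate `b`. -/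
def moveRow (y : Coord) (a b : KRLetter) (t : ℕ) : Coord :=
  fun c => if c = a then y c - t else if c = b then y c + t else y c

theorem moveUnit_eq (y : Coord) (a b : KRLetter) :
    moveUnit y a b = if y a = 0 then none else some (moveRow y a b 1) := rfl

/-- The coordinates are supported on the letters of rank `n`. -/
def Supported (n : ℕ) (y : Coord) : Prop :=
  ∀ c, (y (pos c) ≠ 0 → 1 ≤ c ∧ c ≤ n) ∧ (y (neg c) ≠ 0 → 1 ≤ c ∧ c ≤ n)

theorem Supported.moveRow {n : ℕ} {y : Coord} (h : Supported n y) {a b : KRLetter} {t : ℕ}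
    (hb : ∀ c, (b = pos c ∨ b = neg c) → 1 ≤ c ∧ c ≤ n) : Supported n (moveRow y a b t) := by
  intro c
  have h1 := h c
  have h2 := hb c
  clear h hb
  simp only [KR.moveRow]
  constructor
  · intro h3
    by_cases hc : b = pos c
    · exact h2 (Or.inl hc)
    · have hc' : pos c ≠ b := fun e => hc e.symm
      refine h1.1 fun h4 => h3 ?_
      simp [h4, hc']
  · intro h3
    by_cases hc : b = neg c
    · exact h2 (Or.inr hc)
    · have hc' : neg c ≠ b := fun e => hc e.symm
      refine h1.2 fun h4 => h3 ?_
      simp [h4, hc']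

section RowWord

variable {X : KRType} {n l i : ℕ}

theorem count_flatMap_replicate {β : Type} [DecidableEq β] {f : ℕ → β}
    (hf : Function.Injective f) (g : ℕ → ℕ) {L : List ℕ} (hL : L.Nodup) (c : ℕ) :
    (L.flatMap fun i => List.replicate (g i) (f i)).count (f c) = if c ∈ L then g c else 0 := by
  induction L with
  | nil => simp
  | cons a L ih =>
    rw [List.nodup_cons] at hL
    rw [List.flatMap_cons, List.count_append, ih hL.2, List.count_replicate]
    by_cases h : a = c
    · subst h; simp [hL.1]
    · have h' : ¬ c = a := fun e => h e.symm
      simp [hf.eq_iff, h, h']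

theorem coordOf_rowWord {y : Coord} (hy : Supported n y) : coordOf (rowWord n y) = y := by
  have hp : Function.Injective pos := fun a b h => by simpa using h
  have hq : Function.Injective neg := fun a b h => by simpa using h
  funext a
  have h0 : ∀ (f : ℕ → KRLetter) (g : ℕ → ℕ) (L : List ℕ), (∀ i, f i ≠ a) →
      (L.flatMap fun i => List.replicate (g i) (f i)).count a = 0 := by
    intro f g L hf
    rw [List.count_eq_zero]
    intro h
    obtain ⟨i, _, hi⟩ := List.mem_flatMap.mp h
    exact hf i (List.mem_replicate.mp hi).2.symm
  rw [coordOf, rowWord, List.count_append, List.count_append, List.count_replicate]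
  cases a with
  | pos c =>
    rw [h0 neg _ _ (by simp), count_flatMap_replicate hp (fun i => y (pos i))
      (List.nodup_reverse.mpr List.nodup_range')]
    have := (hy c).1
    simp only [List.mem_reverse, List.mem_range'_1]
    simp only [beq_iff_eq, reduceCtorEq, if_false, zero_add]
    split_ifs with h
    · rfl
    · by_contra h'
      exact h ⟨(this (Ne.symm h')).1, by have := (this (Ne.symm h')).2; omega⟩
  | zero => simp [h0]
  | neg c =>
    rw [h0 pos _ _ (by simp), count_flatMap_replicate hq (fun i => y (neg i)) List.nodup_range']
    have := (hy c).2
    simp only [List.mem_range'_1]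
    simp only [beq_iff_eq, reduceCtorEq, if_false, add_zero]
    split_ifs with h
    · rfl
    · by_contra h'
      exact h ⟨(this (Ne.symm h')).1, by have := (this (Ne.symm h')).2; omega⟩

theorem eLetter_ne {a b : KRLetter} (h : eLetter X n i a = some b) : a ≠ b := by
  rintro rfl
  unfold eLetter at h
  cases X <;> grind

/-- An operator `e_i` replaces one letter `a` by `e_i a`. -/
theorem coordOf_eWd {w v : List KRLetter} (h : eWd X n i w = some v) :
    ∃ a b, a ∈ w ∧ eLetter X n i a = some b ∧
      ∀ u t, coordOf (u ++ (v ++ t)) = moveRow (coordOf (u ++ (w ++ t))) a b 1 := by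
  induction w generalizing v with
  | nil => simp [eWd] at h
  | cons x w ih =>
    simp only [eWd] at h
    split_ifs at h with hc
    · rw [Option.map_eq_some_iff] at h
      obtain ⟨b, hb, rfl⟩ := h
      have hne := eLetter_ne hb
      refine ⟨x, b, by simp, hb, fun u t => ?_⟩
      funext c
      simp only [coordOf, moveRow, List.count_append, List.cons_append, List.count_cons,
        beq_iff_eq]
      grind
    · rw [Option.map_eq_some_iff] at h
      obtain ⟨w', hw, rfl⟩ := h
      obtain ⟨a, b, h1, h2, h3⟩ := ih hw
      refine ⟨a, b, by simp [h1], h2, fun u t => ?_⟩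
      have := h3 (u ++ [x]) t
      simpa using this

theorem signature_replicate {x : KRLetter} {e p : ℕ} (he : epsLetter X n i x = e)
    (hp : phiLetter X n i x = p) (h : e = 0 ∨ p = 0) (a : ℕ) :
    epsWord X n i (List.replicate a x) = a * e ∧ phiWord X n i (List.replicate a x) = a * p := by
  induction a with
  | zero => simp [epsWord, phiWord]
  | succ a ih =>
    rw [List.replicate_succ]
    simp only [epsWord, phiWord, ih, he, hp, Nat.add_mul, Nat.one_mul]
    rcases h with rfl | rfl
    · simp
    · simp; omega

/-- The letters with a bar of a row, in the order of the reading word. -/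
theorem signature_negs (h1 : 1 ≤ i) (h2 : i < n) (g : ℕ → ℕ) (s len : ℕ) :
    epsWord X n i ((List.range' s len).flatMap fun c => List.replicate (g c) (neg c)) =
      (if s ≤ i ∧ i < s + len then g i else 0) ∧
    phiWord X n i ((List.range' s len).flatMap fun c => List.replicate (g c) (neg c)) =
      if s ≤ i + 1 ∧ i + 1 < s + len then g (i + 1) else 0 := by
  induction len generalizing s with
  | zero =>
    simp only [List.range'_zero, List.flatMap_nil, epsWord, phiWord]
    constructor <;> rw [if_neg (by omega)]
  | succ len ih =>
    obtain ⟨e1, e2⟩ := ih (s + 1)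
    obtain ⟨e3, e4⟩ := signature_replicate (epsLetter_neg (X := X) h1 h2 s)
      (phiLetter_neg (X := X) h1 h2 s) (by split_ifs <;> omega) (g s)
    rw [List.range'_succ, List.flatMap_cons, epsWord_append, phiWord_append, e1, e2, e3, e4]
    grind

/-- The letters without a bar of a row, in the order of the reading word. -/
theorem signature_poss (h1 : 1 ≤ i) (h2 : i < n) (g : ℕ → ℕ) (s len : ℕ) :
    epsWord X n i ((List.range' s len).reverse.flatMap fun c => List.replicate (g c) (pos c)) =
      (if s ≤ i + 1 ∧ i + 1 < s + len then g (i + 1) else 0) ∧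
    phiWord X n i ((List.range' s len).reverse.flatMap fun c => List.replicate (g c) (pos c)) =
      if s ≤ i ∧ i < s + len then g i else 0 := by
  induction len generalizing s with
  | zero =>
    simp only [List.range'_zero, List.reverse_nil, List.flatMap_nil, epsWord, phiWord]
    constructor <;> rw [if_neg (by omega)]
  | succ len ih =>
    obtain ⟨e1, e2⟩ := ih (s + 1)
    obtain ⟨e3, e4⟩ := signature_replicate (epsLetter_pos (X := X) h1 h2 s)
      (phiLetter_pos (X := X) h1 h2 s) (by split_ifs <;> omega) (g s)
    rw [List.range'_succ, List.reverse_cons, List.flatMap_append, List.flatMap_singleton,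
      epsWord_append, phiWord_append, e1, e2, e3, e4]
    grind

theorem mem_rowWord {y : Coord} {a : KRLetter} (h : a ∈ rowWord n y) : y a ≠ 0 := by
  simp only [rowWord, List.mem_append, List.mem_flatMap, List.mem_replicate] at h
  rcases h with (⟨_, _, h, rfl⟩ | ⟨h, rfl⟩) | ⟨_, _, h, rfl⟩ <;> exact h

/-- `e_i`, `1 ≤ i < n`, in coordinates. -/
theorem rowCrystal_e (h1 : 1 ≤ i) (h2 : i < n) {y : Coord} (hy : Supported n y) :
    (rowCrystal X n l).e i y = if y (neg (i + 1)) < y (pos (i + 1)) then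
      moveUnit y (pos (i + 1)) (pos i) else moveUnit y (neg i) (neg (i + 1)) := by
  have hc := coordOf_rowWord hy
  have h0 : i ≠ 0 := by omega
  simp only [rowCrystal, h0, if_false]
  obtain ⟨a1, a2⟩ := signature_negs (X := X) h1 h2 (fun c => y (neg c)) 1 n
  obtain ⟨b1, b2⟩ := signature_poss (X := X) h1 h2 (fun c => y (pos c)) 1 n
  obtain ⟨c1, c2⟩ := signature_replicate (X := X) (n := n) (epsLetter_zero h1 h2)
    (phiLetter_zero h1 h2) (Or.inl rfl) (y zero)
  rw [if_pos (by omega)] at a1 a2 b1 b2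
  simp only [Nat.mul_zero] at c1 c2
  have hphi : phiWord X n i ((List.range' 1 n).flatMap (fun i => List.replicate (y (neg i)) (neg i)) ++
      List.replicate (y zero) zero) = y (neg (i + 1)) := by
    rw [phiWord_append, a2, c1, c2]; omega
  have heps : epsWord X n i ((List.range' 1 n).flatMap (fun i => List.replicate (y (neg i)) (neg i)) ++
      List.replicate (y zero) zero) = y (neg i) := by
    rw [epsWord_append, a1, c1]; omega
  have hsplit : rowWord n y = ((List.range' 1 n).flatMap (fun i => List.replicate (y (neg i)) (neg i)) ++
    List.replicate (y zero) zero) ++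
    (List.range' 1 n).reverse.flatMap (fun i => List.replicate (y (pos i)) (pos i)) := rfl
  have hu : ∀ a ∈ (List.range' 1 n).flatMap (fun i => List.replicate (y (neg i)) (neg i)) ++
      List.replicate (y zero) zero, a = zero ∨ ∃ c, a = neg c := by
    intro a ha
    simp only [List.mem_append, List.mem_flatMap, List.mem_replicate] at ha
    rcases ha with ⟨c, _, _, rfl⟩ | ⟨_, rfl⟩
    · exact Or.inr ⟨c, rfl⟩
    · exact Or.inl rfl
  have hv : ∀ a ∈ (List.range' 1 n).reverse.flatMap (fun i => List.replicate (y (pos i)) (pos i)),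
      ∃ c, a = pos c := by
    intro a ha
    simp only [List.mem_flatMap, List.mem_replicate] at ha
    obtain ⟨c, _, _, rfl⟩ := ha
    exact ⟨c, rfl⟩
  revert hsplit hu hv hphi heps b1
  generalize (List.range' 1 n).flatMap (fun i => List.replicate (y (neg i)) (neg i)) ++
      List.replicate (y zero) zero = u
  generalize (List.range' 1 n).reverse.flatMap (fun i => List.replicate (y (pos i)) (pos i)) = v
  intro b1 hphi heps hsplit hu hv
  rw [hsplit] at hc ⊢
  rw [eWd_append, b1, hphi]
  by_cases hlt : y (neg (i + 1)) < y (pos (i + 1))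
  · rw [if_neg (by omega), if_pos hlt, moveUnit_eq, if_neg (by omega)]
    cases hw : eWd X n i v with
    | none =>
      rw [eWd_eq_none h1, b1] at hw
      omega
    | some w =>
      obtain ⟨a, b, k1, k2, k3⟩ := coordOf_eWd hw
      obtain ⟨c, rfl⟩ := hv a k1
      rw [eLetter_pos h1 h2] at k2
      have k3 := k3 u []
      rw [List.append_nil, List.append_nil, hc] at k3
      split_ifs at k2 with h3
      simp only [Option.some.injEq] at k2
      rw [h3, ← k2] at k3
      simp [k3]
  · rw [if_pos (by omega), if_neg hlt, moveUnit_eq]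
    cases hw : eWd X n i u with
    | none =>
      rw [eWd_eq_none h1, heps] at hw
      rw [if_pos hw]
      rfl
    | some w =>
      have hne : y (neg i) ≠ 0 := by
        rw [← heps]
        intro h
        rw [← eWd_eq_none h1, hw] at h
        simp at h
      obtain ⟨a, b, k1, k2, k3⟩ := coordOf_eWd hw
      have k3 := k3 [] v
      simp only [List.nil_append, hc] at k3
      rcases hu a k1 with rfl | ⟨c, rfl⟩
      · rw [eLetter_zero h1 h2] at k2
        simp at k2
      · rw [eLetter_neg h1 h2] at k2
        split_ifs at k2 with h3
        simp only [Option.some.injEq] at k2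
        rw [h3, ← k2] at k3
        simp [k3, hne]

end RowWord

section Iterate

/-- The effect of moving as many units as possible from `p` to `p'` as long as `y p` exceeds `y q'`,
and from `q` to `q'` afterwards. -/
def raisedRow (y : Coord) (p p' q q' : KRLetter) : Coord := fun c =>
  if c = p then min (y p) (y q') else if c = p' then y p' + (y p - y q')
  else if c = q then 0 else if c = q' then y q' + y q else y c

theorem raisedRow_of_eq_zero {y : Coord} {p p' q q' : KRLetter} (h1 : y p ≤ y q') (h2 : y q = 0) :
    raisedRow y p p' q q' = y := by
  funext c
  simp only [raisedRow]
  split_ifs <;> subst_vars <;> omega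

theorem raisedRow_moveRow_left {y : Coord} {p p' q q' : KRLetter}
    (hd : p ≠ p' ∧ p ≠ q ∧ p ≠ q' ∧ p' ≠ q ∧ p' ≠ q' ∧ q ≠ q') (h : y q' < y p) :
    raisedRow (moveRow y p p' 1) p p' q q' = raisedRow y p p' q q' ∧
    moveRow y p p' 1 p - moveRow y p p' 1 q' + moveRow y p p' 1 q + 1 = y p - y q' + y q := by
  obtain ⟨d1, d2, d3, d4, d5, d6⟩ := hd
  constructor
  · funext c
    simp only [raisedRow, moveRow, d1.symm, d2.symm, d3.symm, d4.symm, d5.symm, if_true, if_false]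
    split_ifs <;> omega
  · simp only [moveRow, d2.symm, d3.symm, d4.symm, d5.symm, if_true, if_false]
    omega

theorem raisedRow_moveRow_right {y : Coord} {p p' q q' : KRLetter}
    (hd : p ≠ p' ∧ p ≠ q ∧ p ≠ q' ∧ p' ≠ q ∧ p' ≠ q' ∧ q ≠ q') (h : y p ≤ y q') (h0 : y q ≠ 0) :
    raisedRow (moveRow y q q' 1) p p' q q' = raisedRow y p p' q q' ∧
    moveRow y q q' 1 p - moveRow y q q' 1 q' + moveRow y q q' 1 q + 1 = y p - y q' + y q := by
  obtain ⟨d1, d2, d3, d4, d5, d6⟩ := hd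
  constructor
  · funext c
    simp only [raisedRow, moveRow, d2, d3, d4, d5, d6.symm, if_true, if_false]
    split_ifs <;> omega
  · simp only [moveRow, d2, d3, d6.symm, if_true, if_false]
    omega

theorem iter_raisedRow {e : Coord → Option Coord} {P : Coord → Prop} {p p' q q' : KRLetter}
    (hd : p ≠ p' ∧ p ≠ q ∧ p ≠ q' ∧ p' ≠ q ∧ p' ≠ q' ∧ q ≠ q')
    (he : ∀ y, P y → e y = if y q' < y p then moveUnit y p p' else moveUnit y q q')
    (hP : ∀ y, P y → P (moveRow y p p' 1) ∧ P (moveRow y q q' 1)) (N : ℕ) {y : Coord}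
    (hy : P y) (hN : y p - y q' + y q = N) :
    partialIter e N y = some (raisedRow y p p' q q') ∧ e (raisedRow y p p' q q') = none := by
  induction N generalizing y with
  | zero =>
    rw [raisedRow_of_eq_zero (by omega) (by omega)]
    refine ⟨rfl, ?_⟩
    rw [he y hy, if_neg (by omega), moveUnit_eq, if_pos (by omega)]
  | succ N ih =>
    rw [partialIter, he y hy]
    by_cases hlt : y q' < y p
    · rw [if_pos hlt, moveUnit_eq, if_neg (by omega), Option.bind_some]
      obtain ⟨hr, hm⟩ := raisedRow_moveRow_left hd hlt
      rw [← hr]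
      exact ih (hP y hy).1 (by omega)
    · rw [if_neg hlt, moveUnit_eq, if_neg (by omega), Option.bind_some]
      obtain ⟨hr, hm⟩ := raisedRow_moveRow_right hd (Nat.le_of_not_lt hlt) (by omega)
      rw [← hr]
      exact ih (hP y hy).2 (by omega)

variable {X : KRType} {n l i : ℕ}

/-- Raising a row as much as possible at a node `1 ≤ i < n`. -/
theorem iter_rowCrystal (h1 : 1 ≤ i) (h2 : i < n) {y : Coord} (hy : Supported n y) {N : ℕ}
    (hN : y (pos (i + 1)) - y (neg (i + 1)) + y (neg i) = N) :
    partialIter ((rowCrystal X n l).e i) N y =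
      some (raisedRow y (pos (i + 1)) (pos i) (neg i) (neg (i + 1))) ∧
    (rowCrystal X n l).e i (raisedRow y (pos (i + 1)) (pos i) (neg i) (neg (i + 1))) = none := by
  refine iter_raisedRow (P := Supported n) (by simp) (fun y hy => rowCrystal_e h1 h2 hy)
    (fun y hy => ⟨hy.moveRow ?_, hy.moveRow ?_⟩) N hy hN
  · intro c hc
    simp at hc
    omega
  · intro c hc
    simp at hc
    omega

/-- Raising a row as much as possible at the node `0`. -/
theorem iter_rowCrystal_zero {y : Coord} {N : ℕ}
    (hN : y (pos 2) - y (neg 2) + y (pos 1) = N) :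
    partialIter ((rowCrystal X n l).e 0) N y =
      some (raisedRow y (pos 2) (neg 1) (pos 1) (neg 2)) ∧
    (rowCrystal X n l).e 0 (raisedRow y (pos 2) (neg 1) (pos 1) (neg 2)) = none :=
  iter_raisedRow (P := fun _ => True) (by simp) (fun y _ => rfl)
    (fun _ _ => ⟨trivial, trivial⟩) N trivial hN

/-- Rows on which `e_n` acts by changing `n` with a bar to `turn X n`, possibly in two steps. -/
structure LastRow (X : KRType) (n : ℕ) (y : Coord) : Prop where
  supp : Supported n y
  zero_le : y zero ≤ 1
  zero : X ≠ KRType.typeB → y zero = 0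
  typeD : X = KRType.typeD → y (neg (n - 1)) = 0 ∧ y (pos n) = 0

theorem epsWord_ne_zero_of_mem {u : List KRLetter} {a : KRLetter} (ha : a ∈ u)
    (he : epsLetter X n i a ≠ 0) (hp : ∀ b ∈ u, phiLetter X n i b = 0) :
    epsWord X n i u ≠ 0 := by
  obtain ⟨s, t, rfl⟩ := List.append_of_mem ha
  rw [epsWord_append, phiWord_eq_zero_of_letters fun b hb => hp b (by simp [hb]), epsWord]
  omega

theorem phiLetter_last_neg (c : ℕ) : phiLetter X n n (neg c) = 0 := by
  cases X <;> simp [phiLetter, fLetter]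

theorem epsLetter_last_neg : epsLetter X n n (neg n) ≠ 0 := by
  cases X <;> simp [epsLetter, eLetter]

/-- `e_n` in coordinates. -/
theorem rowCrystal_e_last (hn : 3 ≤ n) {y : Coord} (hy : LastRow X n y) :
    (rowCrystal X n l).e n y = if y zero = 0 then
      moveUnit y (neg n) (if X = KRType.typeB then zero else pos (turn X n))
      else moveUnit y zero (pos n) := by
  have hc := coordOf_rowWord hy.supp
  have h0 : n ≠ 0 := by omega
  simp only [rowCrystal, h0, if_false]
  have hu : ∀ a ∈ (List.range' 1 n).flatMap (fun i => List.replicate (y (neg i)) (neg i)),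
      phiLetter X n n a = 0 := by
    intro a ha
    simp only [List.mem_flatMap, List.mem_replicate] at ha
    obtain ⟨c, _, _, rfl⟩ := ha
    exact phiLetter_last_neg c
  have hmem : y (neg n) ≠ 0 →
      neg n ∈ (List.range' 1 n).flatMap (fun i => List.replicate (y (neg i)) (neg i)) := by
    intro h
    simp only [List.mem_flatMap, List.mem_replicate, List.mem_range'_1]
    exact ⟨n, by omega, h, rfl⟩
  by_cases hz : y zero = 0
  · rw [if_pos hz]
    cases hw : eWd X n n (rowWord n y) with
    | none =>
      rw [eWd_eq_none (by omega)] at hw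
      rw [moveUnit_eq, if_pos]
      · rfl
      · by_contra h
        rw [rowWord, List.append_assoc, epsWord_append] at hw
        exact epsWord_ne_zero_of_mem (hmem h) epsLetter_last_neg hu (by omega)
    | some w =>
      obtain ⟨a, b, k1, k2, k3⟩ := coordOf_eWd hw
      have k1 := mem_rowWord k1
      have k3 := k3 [] []
      simp only [List.append_nil, List.nil_append, hc] at k3
      have ha : a = neg n ∧ b = if X = KRType.typeB then zero else pos (turn X n) := by
        have h4 := hy.typeD
        cases X <;> simp [eLetter, turn] at k2 ⊢ <;> grind
      rw [ha.1] at k1 k3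
      rw [moveUnit_eq, if_neg k1, ← ha.2]
      simp [k3]
  · have hX : X = KRType.typeB := by
      by_contra h
      exact hz (hy.zero h)
    subst hX
    rw [if_neg hz, moveUnit_eq, if_neg hz]
    have hsplit : rowWord n y = (List.range' 1 n).flatMap (fun i => List.replicate (y (neg i)) (neg i)) ++
      (List.replicate (y zero) zero ++
      (List.range' 1 n).reverse.flatMap (fun i => List.replicate (y (pos i)) (pos i))) := by
      rw [rowWord, List.append_assoc]
    have hv : ∀ a ∈ List.replicate (y zero) zero ++
        (List.range' 1 n).reverse.flatMap (fun i => List.replicate (y (pos i)) (pos i)),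
        a ≠ neg n := by
      rintro a ha rfl
      simp at ha
    have hz1 : y zero = 1 := by have := hy.zero_le; omega
    have heps : epsWord KRType.typeB n n (List.replicate (y zero) zero ++
        (List.range' 1 n).reverse.flatMap (fun i => List.replicate (y (pos i)) (pos i))) ≠ 0 := by
      rw [hz1, List.replicate_one, List.singleton_append, epsWord]
      simp [epsLetter, eLetter]
    revert hsplit hu hv heps
    generalize (List.range' 1 n).flatMap (fun i => List.replicate (y (neg i)) (neg i)) = u
    generalize List.replicate (y zero) zero ++
      (List.range' 1 n).reverse.flatMap (fun i => List.replicate (y (pos i)) (pos i)) = v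
    intro hu hsplit hv heps
    rw [hsplit] at hc ⊢
    rw [eWd_append, phiWord_eq_zero_of_letters hu, if_neg (by omega)]
    cases hw : eWd KRType.typeB n n v with
    | none =>
      rw [eWd_eq_none (by omega)] at hw
      exact absurd hw heps
    | some w =>
      obtain ⟨a, b, k1, k2, k3⟩ := coordOf_eWd hw
      have k3 := k3 u []
      rw [List.append_nil, List.append_nil, hc] at k3
      have k1 := hv a k1
      have ha : a = zero ∧ b = pos n := by
        simp [eLetter] at k2
        grind
      rw [ha.1, ha.2] at k3
      simp [k3]

/-- Rows with no letter `n` with a bar and no `0`. -/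
def lastRaised (X : KRType) (n : ℕ) (y : Coord) : Coord := fun c =>
  if c = neg n then 0 else if c = zero then 0
  else if c = pos (turn X n) then y c + (y (neg n) + y zero) else y c

/-- Raising a row as much as possible at the node `n`. -/
theorem iter_rowCrystal_last (hn : 3 ≤ n) (N : ℕ) {y : Coord} (hy : LastRow X n y)
    (hN : turnLength X * y (neg n) + y zero = N) :
    partialIter ((rowCrystal X n l).e n) N y = some (lastRaised X n y) ∧
    (rowCrystal X n l).e n (lastRaised X n y) = none := by
  induction N generalizing y with
  | zero =>
    have h1 : y (neg n) = 0 := by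
      have : turnLength X ≠ 0 := by unfold turnLength; split_ifs <;> simp
      have h2 : turnLength X * y (neg n) = 0 := by omega
      rcases Nat.mul_eq_zero.mp h2 with h | h
      · exact absurd h this
      · exact h
    have h2 : y zero = 0 := by omega
    have h3 : lastRaised X n y = y := by
      funext c
      simp only [lastRaised]
      split_ifs <;> subst_vars <;> omega
    rw [h3]
    refine ⟨rfl, ?_⟩
    rw [rowCrystal_e_last hn hy, if_pos h2, moveUnit_eq, if_pos h1]
  | succ N ih =>
    have ht := hy.typeD
    have h5 := hy.zero
    have h6 := hy.zero_le
    rw [partialIter, rowCrystal_e_last hn hy]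
    by_cases hz : y zero = 0
    · have hb : y (neg n) ≠ 0 := by
        intro h
        rw [h, hz] at hN
        simp at hN
      rw [if_pos hz, moveUnit_eq, if_neg hb, Option.bind_some]
      have hr : lastRaised X n (moveRow y (neg n)
          (if X = KRType.typeB then zero else pos (turn X n)) 1) = lastRaised X n y := by
        funext c
        clear ih hN
        cases X <;> simp [lastRaised, moveRow, turn] <;> grind
      rw [← hr]
      refine ih ⟨hy.supp.moveRow ?_, ?_, ?_, ?_⟩ ?_
      · intro c hc
        cases X <;> simp [turn] at hc <;> omega
      all_goals
        clear ih hr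
        cases X <;> simp [moveRow, turn, turnLength] at * <;> first | omega | grind
    · have hX : X = KRType.typeB := by
        by_contra h
        exact hz (hy.zero h)
      subst hX
      rw [if_neg hz, moveUnit_eq, if_neg hz, Option.bind_some]
      have hr : lastRaised KRType.typeB n (moveRow y zero (pos n) 1) =
          lastRaised KRType.typeB n y := by
        funext c
        clear ih hN
        simp [lastRaised, moveRow, turn]
        grind
      rw [← hr]
      refine ih ⟨hy.supp.moveRow ?_, ?_, ?_, ?_⟩ ?_
      · intro c hc
        simp at hc
        omega
      all_goals
        clear ih hr
        simp [moveRow, turnLength] at * <;> omega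

end Iterate

/-! ### Strings in a tensor product -/

section Strings

variable {β γ : Type}

theorem partialIter_isSome_of_le {g : β → Option β} {a b : ℕ} (h : a ≤ b) {y z : β}
    (hb : partialIter g b y = some z) : ∃ w, partialIter g a y = some w ∧
      partialIter g (b - a) w = some z := by
  obtain ⟨c, rfl⟩ := Nat.exists_eq_add_of_le h
  rw [partialIter_add, Option.bind_eq_some_iff] at hb
  rw [Nat.add_sub_cancel_left]
  exact hb

theorem partialIter_ne_none_iff {g : β → Option β} {q : ℕ} {y z : β}
    (h : partialIter g q y = some z) (h' : g z = none) (m : ℕ) :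
    partialIter g m y ≠ none ↔ m ≤ q := by
  constructor
  · intro hm
    by_contra hlt
    obtain ⟨w, hw⟩ := Option.ne_none_iff_exists'.mp hm
    obtain ⟨v, h1, -⟩ := partialIter_isSome_of_le (by omega : q + 1 ≤ m) hw
    rw [partialIter_succ', h, Option.bind_some, h'] at h1
    simp at h1
  · intro hm
    obtain ⟨w, hw, -⟩ := partialIter_isSome_of_le hm h
    simp [hw]

theorem sSup_partialIter {g : β → Option β} {q : ℕ} {y z : β}
    (h : partialIter g q y = some z) (h' : g z = none) :
    sSup {m | partialIter g m y ≠ none} = q := by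
  have : {m | partialIter g m y ≠ none} = Set.Iic q := by
    ext m
    exact partialIter_ne_none_iff h h' m
  rw [this, csSup_Iic]

theorem eps_eq {C : Crystal β} {i q : ℕ} {y z : β} (h : partialIter (C.e i) q y = some z)
    (h' : C.e i z = none) : C.eps i y = q := sSup_partialIter h h'

theorem phi_eq {C : Crystal β} {i q : ℕ} {y z : β} (h : partialIter (C.f i) q y = some z)
    (h' : C.f i z = none) : C.phi i y = q := sSup_partialIter h h'

variable {C : Crystal β} {D : Crystal γ} {i : ℕ}

/-- If `φ_i(T) = 0`, then `e_i` acts on the right factor as long as possible. -/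
theorem tensor_iter_right {T : β} (hT : C.phi i T = 0) {q : ℕ} {y z : γ}
    (h : partialIter (D.e i) q y = some z) (h' : D.e i z = none) :
    partialIter ((C.tensor D).e i) q (T, y) = some (T, z) := by
  induction q generalizing y with
  | zero => simp_all [partialIter]
  | succ q ih =>
    have he := eps_eq h h'
    rw [partialIter, Option.bind_eq_some_iff] at h
    obtain ⟨w, hw, h⟩ := h
    rw [partialIter]
    simp only [Crystal.tensor, he, hT, hw]
    rw [if_neg (by omega)]
    exact ih h

/-- As long as `ε_i` of the right factor does not exceed `φ_i` of the left one, only the left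
factor moves. -/
theorem tensor_iter_left {y : γ} {p : ℕ} {T T' : β} (h : partialIter (C.e i) p T = some T')
    (hphi : ∀ j < p, ∀ S, partialIter (C.e i) j T = some S → D.eps i y ≤ C.phi i S) :
    partialIter ((C.tensor D).e i) p (T, y) = some (T', y) := by
  induction p generalizing T with
  | zero => simp_all [partialIter]
  | succ p ih =>
    have h0 := hphi 0 (by omega) T rfl
    rw [partialIter, Option.bind_eq_some_iff] at h
    obtain ⟨w, hw, h⟩ := h
    rw [partialIter]
    simp only [Crystal.tensor, h0, if_true, hw]
    refine ih h fun j hj S hS => hphi (j + 1) (by omega) S ?_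
    rw [partialIter, hw]
    exact hS

/-- If `φ_i(T) = 0`, then `e_i` acts on the right factor first. -/
theorem tensor_iter {T T' : β} (hT : C.phi i T = 0) {p q : ℕ} {y z : γ}
    (h : partialIter (D.e i) q y = some z) (h' : D.e i z = none)
    (h2 : partialIter (C.e i) p T = some T') :
    partialIter ((C.tensor D).e i) (p + q) (T, y) = some (T', z) := by
  rw [Nat.add_comm, partialIter_add, tensor_iter_right hT h h', Option.bind_some]
  refine tensor_iter_left h2 fun j _ S _ => ?_
  rw [eps_eq (q := 0) rfl h']
  exact Nat.zero_le _

theorem eWord_append (u v : List ℕ) (b : β) :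
    C.eWord (u ++ v) b = (C.eWord u b).bind (C.eWord v) := by
  induction u generalizing b with
  | nil => rfl
  | cons a u ih =>
    simp only [List.cons_append, Crystal.eWord]
    cases C.e a b with
    | none => rfl
    | some c => exact ih c

theorem eWord_replicate (m : ℕ) (b : β) :
    C.eWord (List.replicate m i) b = partialIter (C.e i) m b := by
  induction m generalizing b with
  | zero => rfl
  | succ m ih =>
    simp only [List.replicate_succ, Crystal.eWord, partialIter]
    congr 1
    funext c
    exact ih c

end Strings

section TabStrings

variable {X : KRType} {n r k i : ℕ}

theorem crystal_e (hi : 1 ≤ i) : (crystal X n r k).e i = eTab X n i := by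
  funext T
  simp only [crystal]
  rw [if_neg (by omega)]

theorem crystal_f (hi : 1 ≤ i) : (crystal X n r k).f i = fTab X n i := by
  funext T
  simp only [crystal]
  rw [if_neg (by omega)]

theorem exists_partialIter_fWd (hi : 1 ≤ i) (p : ℕ) {u : List KRLetter}
    (h : phiWord X n i u = p) :
    ∃ v, partialIter (fWd X n i) p u = some v ∧ fWd X n i v = none := by
  induction p generalizing u with
  | zero => exact ⟨u, rfl, (fWd_eq_none hi u).mpr h⟩
  | succ p ih =>
    cases hw : fWd X n i u with
    | none => rw [fWd_eq_none hi] at hw; omega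
    | some w =>
      have := epsWord_fWd hi hw
      obtain ⟨v, hv, hv'⟩ := ih (u := w) (by omega)
      exact ⟨v, by simp [partialIter, hw, hv], hv'⟩

theorem crystal_phi (hi : 1 ≤ i) (T : Tab) :
    (crystal X n r k).phi i T = phiWord X n i T.word := by
  obtain ⟨v, hv, hv'⟩ := exists_partialIter_fWd hi _ (rfl : phiWord X n i T.word = _)
  refine phi_eq (z := ⟨T.heights, v⟩) ?_ ?_
  · rw [crystal_f hi]
    exact partialIter_fTab hv T.heights
  · rw [crystal_f hi, fTab, hv']
    rfl

theorem crystal_iter (hi : 1 ≤ i) {m : ℕ} {u v : List KRLetter}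
    (h : partialIter (eWd X n i) m u = some v) (hts : List ℕ) :
    partialIter ((crystal X n r k).e i) m ⟨hts, u⟩ = some ⟨hts, v⟩ := by
  rw [crystal_e hi]
  exact partialIter_eTab h hts

end TabStrings

/-- `RowRaises X n l js g y z`: the row `z` is obtained from `y` by applying, for the nodes `j` of the
list `js` in this order, `e_j` as often as possible, namely `g j` times. -/
def RowRaises (X : KRType) (n l : ℕ) : List ℕ → (ℕ → ℕ) → Coord → Coord → Prop
  | [], _, y, z => y = z
  | j :: js, g, y, z => ∃ w, (partialIter ((rowCrystal X n l).e j) (g j) y = some w ∧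
      (rowCrystal X n l).e j w = none) ∧ RowRaises X n l js g w z

section RowRaises

variable {X : KRType} {n r k l : ℕ} {g : ℕ → ℕ}

theorem RowRaises.append {L L' : List ℕ} {u v w : Coord} (h : RowRaises X n l L g u v)
    (h' : RowRaises X n l L' g v w) : RowRaises X n l (L ++ L') g u w := by
  induction L generalizing u with
  | nil => simp only [RowRaises] at h; subst h; simpa using h'
  | cons a L ih =>
    obtain ⟨w, hw, h⟩ := h
    exact ⟨w, hw, ih h⟩

theorem RowRaises.up {a len : ℕ} {s : ℕ → Coord}
    (h : ∀ i, a ≤ i → i < a + len → partialIter ((rowCrystal X n l).e i) (g i) (s i) =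
      some (s (i + 1)) ∧ (rowCrystal X n l).e i (s (i + 1)) = none) :
    RowRaises X n l (List.range' a len) g (s a) (s (a + len)) := by
  induction len generalizing a with
  | zero => simp [RowRaises]
  | succ len ih =>
    rw [List.range'_succ]
    refine ⟨s (a + 1), h a le_rfl (by omega), ?_⟩
    have := ih (a := a + 1) (fun i h1 h2 => h i (by omega) (by omega))
    rwa [show a + 1 + len = a + (len + 1) by omega] at this

theorem RowRaises.down {a len : ℕ} {s : ℕ → Coord}
    (h : ∀ i, a ≤ i → i < a + len → partialIter ((rowCrystal X n l).e i) (g i) (s (i + 1)) =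
      some (s i) ∧ (rowCrystal X n l).e i (s i) = none) :
    RowRaises X n l (List.range' a len).reverse g (s (a + len)) (s a) := by
  induction len with
  | zero => simp [RowRaises]
  | succ len ih =>
    rw [List.range'_concat, List.reverse_append, Nat.one_mul]
    exact ⟨s (a + len), h (a + len) (by omega) (by omega),
      ih fun i h1 h2 => h i h1 (by omega)⟩

theorem powerWord_congr {js : List ℕ} {g g' : ℕ → ℕ} (h : ∀ j ∈ js, g j = g' j) :
    powerWord js g = powerWord js g' := by
  rw [powerWord, powerWord]
  exact List.flatMap_congr fun j hj => by rw [h j hj]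

/-- Both factors are raised along the same nodes if `φ_i` of the left one always vanishes. -/
theorem eWord_tensor {js : List ℕ} (hjs : ∀ j ∈ js, 1 ≤ j) {gT gR g : ℕ → ℕ}
    {u v : List KRLetter} {y z : Coord}
    (hT : Raises X n True (js.map fun j => (j, gT j)) u v) (hR : RowRaises X n l js gR y z)
    (hg : ∀ j ∈ js, g j = gT j + gR j) (hts : List ℕ) :
    ((crystal X n r k).tensor (rowCrystal X n l)).eWord (powerWord js g)
      (⟨hts, u⟩, y) = some (⟨hts, v⟩, z) := by
  induction js generalizing u y with
  | nil =>
    simp only [List.map_nil, Raises, RowRaises] at hT hR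
    subst hT hR
    rfl
  | cons j js ih =>
    obtain ⟨w, ⟨p, h1, h2⟩, h3⟩ := hT
    obtain ⟨t, ⟨h4, h5⟩, h6⟩ := hR
    have hj : 1 ≤ j := hjs j (by simp)
    have h2 := h2 trivial
    subst h2
    have h7 : powerWord (j :: js) g = List.replicate (g j) j ++ powerWord js g := rfl
    rw [h7, eWord_append, eWord_replicate, hg j (by simp),
      tensor_iter ((crystal_phi hj _).trans h1.phi) h4 h5 (crystal_iter hj h1.iter hts),
      Option.bind_some]
    exact ih (fun a ha => hjs a (by simp [ha])) h3 h6 (fun a ha => hg a (by simp [ha]))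

end RowRaises

/-! ### The path of the row -/

section OddSum

theorem oddSum_succ (g : ℕ → ℕ) {a b : ℕ} (h : a ≤ b + 1) :
    oddSum g a (b + 1) = oddSum g a b + if (b + 1) % 2 = 1 then g (b + 1) else 0 := by
  have h1 : Finset.Icc a (b + 1) = insert (b + 1) (Finset.Icc a b) := by
    ext t
    simp only [Finset.mem_Icc, Finset.mem_insert]
    omega
  rw [oddSum, oddSum, h1, Finset.filter_insert]
  split_ifs with h2
  · rw [Finset.sum_insert (by simp), Nat.add_comm]
  · rfl

theorem oddSum_of_lt (g : ℕ → ℕ) {a b : ℕ} (h : b < a) : oddSum g a b = 0 := by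
  rw [oddSum, Finset.Icc_eq_empty (by omega)]
  rfl

theorem oddSum_add (g : ℕ → ℕ) {a b c : ℕ} (h1 : a ≤ b + 1) (h2 : b ≤ c) :
    oddSum g a c = oddSum g a b + oddSum g (b + 1) c := by
  induction c with
  | zero =>
    have : b = 0 := by omega
    subst this
    rw [oddSum_of_lt g (a := 0 + 1) (by omega), Nat.add_zero]
  | succ c ih =>
    rcases Nat.lt_or_ge c b with h | h
    · have : b = c + 1 := by omega
      subst this
      rw [oddSum_of_lt g (a := c + 1 + 1) (b := c + 1) (by omega)]
      rfl
    · rw [oddSum_succ g (by omega), oddSum_succ g (by omega), ih h, Nat.add_assoc]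

theorem oddSum_congr {g g' : ℕ → ℕ} {a b : ℕ} (h : ∀ j, a ≤ j → j ≤ b → j % 2 = 1 → g j = g' j) :
    oddSum g a b = oddSum g' a b := by
  refine Finset.sum_congr rfl fun j hj => ?_
  rw [Finset.mem_filter, Finset.mem_Icc] at hj
  exact h j hj.1.1 hj.1.2 hj.2

theorem oddSum_one_one (g : ℕ → ℕ) : oddSum g 1 1 = g 1 := by
  rw [oddSum_succ g (by omega), oddSum_of_lt g (by omega)]
  simp

/-- The next odd number after `j` may be replaced by `j + 1` as a lower bound. -/
theorem oddSum_round (g : ℕ → ℕ) (j b : ℕ) :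
    oddSum g (2 * ((j + 1) / 2) + 1) b = oddSum g (j + 1) b := by
  rw [oddSum, oddSum]
  congr 1
  ext t
  simp only [Finset.mem_filter, Finset.mem_Icc]
  omega

end OddSum

/-- The conditions on a row `x` which are forced by a highest weight element `μ ⊗ x`. -/
structure HighestRow (X : KRType) (n r : ℕ) (x : Coord) : Prop where
  supp : Supported n x
  zero : x zero = 0
  neg_even : ∀ c, c % 2 = 0 → x (neg c) = 0
  neg_gt : ∀ c, r < c → x (neg c) = 0
  pos_gt : ∀ c, r + 2 ≤ c → x (pos c) = 0
  pos_le : ∀ c, 3 ≤ c → c % 2 = 1 → x (pos c) ≤ x (neg c)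

section RowPath

variable {X : KRType} {n r l : ℕ} {x : Coord}

/-- The number `x_j + x_{j+1} + ⋯ + x_{r+1}`. -/
def tailSum (r : ℕ) (x : Coord) (j : ℕ) : ℕ := ∑ t ∈ Finset.Icc j (r + 1), x (pos t)

theorem tailSum_eq (h : HighestRow X n r x) (j : ℕ) :
    tailSum r x j = x (pos j) + tailSum r x (j + 1) := by
  rcases Nat.lt_or_ge (r + 1) j with hj | hj
  · rw [tailSum, tailSum, Finset.Icc_eq_empty (by omega), Finset.Icc_eq_empty (by omega),
      h.pos_gt j (by omega)]
    rfl
  · have h1 : Finset.Icc j (r + 1) = insert j (Finset.Icc (j + 1) (r + 1)) := by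
      ext t
      simp only [Finset.mem_Icc, Finset.mem_insert]
      omega
    rw [tailSum, h1, Finset.sum_insert (by simp)]
    rfl

theorem tailSum_zero {j : ℕ} (hj : r + 1 < j) : tailSum r x j = 0 := by
  rw [tailSum, Finset.Icc_eq_empty (by omega)]
  rfl

/-- The number of letters `i` with a bar before `e_i` is applied on the way up. -/
def upCount (x : Coord) (i : ℕ) : ℕ := x (pos 1) + oddSum (fun j => x (neg j)) 3 i

/-- The row before `e_i` is applied on the way up. -/
def upRow (x : Coord) (i : ℕ) : Coord
  | pos c => if c < 3 then 0 else if c % 2 = 1 then (if c < i then x (pos c) + x (pos (c + 1))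
      else x (pos c)) else if c ≤ i then 0 else x (pos c)
  | zero => 0
  | neg c => if c = 1 then x (pos 2) + x (neg 1) else if c < i then 0
      else if c = i then upCount x i else x (neg c)

/-- The number of letters `i` after `e_i` has been applied on the way down. -/
def downCount (r : ℕ) (x : Coord) (i : ℕ) : ℕ :=
  x (pos 1) + oddSum (fun j => x (neg j)) 3 r + tailSum r x (2 * (i / 2) + 1)

/-- The row after `e_i` has been applied on the way down. -/
def downRow (r : ℕ) (x : Coord) (i : ℕ) : Coord
  | pos c => if c = i then downCount r x i
      else if 3 ≤ c ∧ c < i ∧ c % 2 = 1 then x (pos c) + x (pos (c + 1)) else 0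
  | zero => 0
  | neg c => if c = 1 then x (pos 2) + x (neg 1) else 0

theorem upCount_succ (h : HighestRow X n r x) {i : ℕ} (hi : 2 ≤ i) :
    upCount x (i + 1) = upCount x i + x (neg (i + 1)) := by
  rw [upCount, upCount, oddSum_succ _ (by omega)]
  split_ifs with h1
  · omega
  · rw [h.neg_even (i + 1) (by omega)]
    rfl

/-- The effect of `e_0`, applied `x_1 + x_2` times, on the row. -/
theorem raisedRow_start (h : HighestRow X n r x) :
    x (pos 2) - x (neg 2) + x (pos 1) = x (pos 1) + x (pos 2) ∧
    raisedRow x (pos 2) (neg 1) (pos 1) (neg 2) = upRow x 2 := by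
  have h2 := h.neg_even 2 rfl
  have hs := h.supp 0
  refine ⟨by omega, ?_⟩
  funext c
  cases c with
  | pos c =>
    simp only [raisedRow, upRow, pos.injEq, reduceCtorEq, if_false, h2]
    split_ifs <;> first | omega | skip
    all_goals
      have : c = 0 := by omega
      subst this
      omega
  | zero => simp [raisedRow, upRow, h.zero]
  | neg c =>
    simp only [raisedRow, upRow, neg.injEq, reduceCtorEq, if_false, h2, upCount,
      oddSum_of_lt (fun j => x (neg j)) (by omega : 2 < 3)]
    have : c = 0 → x (neg c) = 0 := fun e => h.neg_even c (by omega)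
    split_ifs <;> omega

/-- One step of the row on the way up. -/
theorem raisedRow_upRow (h : HighestRow X n r x) {i : ℕ} (hi : 2 ≤ i) :
    upRow x i (pos (i + 1)) - upRow x i (neg (i + 1)) + upRow x i (neg i) =
      upCount x i + (if i % 2 = 1 then x (pos (i + 1)) else 0) ∧
    raisedRow (upRow x i) (pos (i + 1)) (pos i) (neg i) (neg (i + 1)) = upRow x (i + 1) := by
  have h1 := upCount_succ h hi
  have h2 := h.neg_even (i + 1)
  have h3 := h.pos_le (i + 1) (by omega)
  have e1 : upRow x i (pos (i + 1)) = x (pos (i + 1)) := by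
    simp only [upRow]; split_ifs <;> omega
  have e2 : upRow x i (neg (i + 1)) = x (neg (i + 1)) := by
    simp only [upRow]; split_ifs <;> omega
  have e3 : upRow x i (neg i) = upCount x i := by
    simp only [upRow]; split_ifs <;> omega
  refine ⟨by rw [e1, e2, e3]; split_ifs <;> omega, ?_⟩
  funext c
  cases c with
  | pos c =>
    simp only [raisedRow, e1, e2, e3, pos.injEq, reduceCtorEq, if_false]
    by_cases c1 : c = i + 1
    · subst c1
      simp only [upRow, if_true]
      split_ifs <;> omega
    · by_cases c2 : c = i
      · subst c2
        simp only [upRow, if_true]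
        split_ifs <;> omega
      · simp only [upRow, if_neg c1, if_neg c2]
        split_ifs <;> omega
  | zero => rfl
  | neg c =>
    simp only [raisedRow, e1, e2, e3, neg.injEq, reduceCtorEq, if_false]
    simp only [upRow]
    by_cases c1 : c = i + 1
    · subst c1
      split_ifs <;> omega
    · split_ifs <;> omega

/-- One step of the row on the way down. -/
theorem raisedRow_downRow (h : HighestRow X n r x) {i : ℕ} (hi : 2 ≤ i) :
    downRow r x (i + 1) (pos (i + 1)) - downRow r x (i + 1) (neg (i + 1)) +
      downRow r x (i + 1) (neg i) = downCount r x (i + 1) ∧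
    raisedRow (downRow r x (i + 1)) (pos (i + 1)) (pos i) (neg i) (neg (i + 1)) =
      downRow r x i := by
  have e1 : downRow r x (i + 1) (pos (i + 1)) = downCount r x (i + 1) := by
    simp only [downRow, if_true]
  have e2 : downRow r x (i + 1) (neg (i + 1)) = 0 := by
    simp only [downRow]; rw [if_neg (by omega)]
  have e3 : downRow r x (i + 1) (neg i) = 0 := by
    simp only [downRow]; rw [if_neg (by omega)]
  have h1 := tailSum_eq h i
  have h2 := tailSum_eq h (i + 1)
  have e4 : (if 3 ≤ i ∧ i % 2 = 1 then x (pos i) + x (pos (i + 1)) else 0) +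
      downCount r x (i + 1) = downCount r x i := by
    simp only [downCount]
    split_ifs with h3
    · rw [show 2 * ((i + 1) / 2) + 1 = i + 1 + 1 by omega, show 2 * (i / 2) + 1 = i by omega]
      omega
    · rw [show 2 * ((i + 1) / 2) + 1 = 2 * (i / 2) + 1 by omega]
      omega
  refine ⟨by rw [e1, e2, e3]; omega, ?_⟩
  funext c
  cases c with
  | pos c =>
    simp only [raisedRow, e1, e2, e3, pos.injEq, reduceCtorEq, if_false]
    by_cases c1 : c = i + 1
    · subst c1
      simp only [downRow, if_true]
      split_ifs <;> omega
    · by_cases c2 : c = i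
      · subst c2
        simp only [downRow, if_true]
        rw [if_neg c1, if_neg c1, ← e4]
        split_ifs <;> omega
      · simp only [downRow, if_neg c1, if_neg c2]
        split_ifs <;> omega
  | zero => rfl
  | neg c =>
    simp only [raisedRow, e1, e2, e3, neg.injEq, reduceCtorEq, if_false]
    simp only [downRow]
    split_ifs <;> omega

theorem supported_upRow (h : HighestRow X n r x) (hn : 3 ≤ n) {i : ℕ} (hi : 1 ≤ i) (hin : i ≤ n) :
    Supported n (upRow x i) := by
  intro c
  have h1 := h.supp c
  have h2 := h.supp (c + 1)
  constructor
  · intro h3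
    simp only [upRow] at h3
    split_ifs at h3 <;> omega
  · intro h3
    simp only [upRow] at h3
    split_ifs at h3 <;> omega

theorem supported_downRow {i : ℕ} (hi : 1 ≤ i) (hin : i ≤ n) : Supported n (downRow r x i) := by
  intro c
  constructor
  · intro h3
    simp only [downRow] at h3
    split_ifs at h3 <;> omega
  · intro h3
    simp only [downRow] at h3
    split_ifs at h3 <;> omega

theorem upCount_of_le (h : HighestRow X n r x) (hr : 3 ≤ r) {j : ℕ} (hj : r ≤ j) :
    upCount x j = x (pos 1) + oddSum (fun j => x (neg j)) 3 r := by
  rw [upCount, oddSum_add (fun j => x (neg j)) (b := r) (c := j) (by omega) hj]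
  have : oddSum (fun j => x (neg j)) (r + 1) j = 0 :=
    (oddSum_congr (g' := fun _ => 0) fun j h1 _ _ => h.neg_gt j (by omega)).trans (by simp [oddSum])
  rw [this]
  rfl

theorem lastRow_upRow (h : HighestRow X n r x) (hn : InRange X n r) (hr : 3 ≤ r) :
    LastRow X n (upRow x n) := by
  have hrn := le_of_inRange hn
  refine ⟨supported_upRow h (by omega) (by omega) le_rfl, Nat.zero_le _, fun _ => rfl, ?_⟩
  rintro rfl
  have hn : r + 2 ≤ n := hn
  constructor
  · simp only [upRow]
    rw [if_neg (by omega), if_pos (by omega)]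
  · have := h.pos_gt n hn
    simp only [upRow]
    split_ifs <;> omega

/-- The step of the row at the node `n`, where the way down begins. -/
theorem lastRaised_upRow (h : HighestRow X n r x) (hn : InRange X n r) (hr : 3 ≤ r)
    (hodd : r % 2 = 1) :
    lastRaised X n (upRow x n) = downRow r x (turn X n) := by
  have hrn := le_of_inRange hn
  have htb := turn_bounds hn
  have h0 := upCount_of_le h hr hrn
  have e1 : upRow x n (neg n) = upCount x n := by
    simp only [upRow]; split_ifs <;> omega
  have e2 : upRow x n zero = 0 := rfl
  have e3 : upRow x n (pos (turn X n)) = tailSum r x (2 * (turn X n / 2) + 1) := by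
    have h1 := tailSum_eq h n
    have h2 := tailSum_eq h (n + 1)
    have h3 : x (pos (n + 1)) = 0 := by
      by_contra h3
      have := (h.supp (n + 1)).1 h3
      omega
    have h4 : tailSum r x (n + 1 + 1) = 0 := tailSum_zero (by omega)
    cases X with
    | typeD =>
      have hn : r + 2 ≤ n := hn
      have h5 := h.pos_gt n hn
      have h6 : tailSum r x (2 * ((n - 1) / 2) + 1) = 0 := tailSum_zero (by omega)
      have h7 := h.pos_gt (n - 1)
      simp only [turn, if_true, upRow, h6, show n - 1 + 1 = n by omega, h5]
      split_ifs <;> omega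
    | typeB =>
      have hn : r + 1 ≤ n := hn
      have h7 := h.pos_gt n
      simp only [turn, reduceCtorEq, if_false, upRow]
      by_cases hp : n % 2 = 1
      · rw [show 2 * (n / 2) + 1 = n by omega]
        split_ifs <;> omega
      · rw [show 2 * (n / 2) + 1 = n + 1 by omega]
        split_ifs <;> omega
    | typeA =>
      simp only [turn, reduceCtorEq, if_false, upRow]
      by_cases hp : n % 2 = 1
      · rw [show 2 * (n / 2) + 1 = n by omega]
        split_ifs <;> omega
      · rw [show 2 * (n / 2) + 1 = n + 1 by omega]
        split_ifs <;> omega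
  have h8 := h.pos_gt n
  have h9 : turn X n < n → r + 2 ≤ n := by
    cases X with
    | typeD => exact fun _ => hn
    | typeB => simp [turn]
    | typeA => simp [turn]
  funext c
  cases c with
  | pos c =>
    have h5 := (h.supp c).1
    have h6 := (h.supp (c + 1)).1
    simp only [lastRaised, reduceCtorEq, if_false, pos.injEq, e1, e2]
    by_cases hc : c = turn X n
    · subst hc
      rw [e3]
      simp only [if_true, downRow, downCount]
      omega
    · have h10 : turn X n = n ∨ turn X n + 1 = n := by
        cases X <;> simp [turn]
        omega
      rw [if_neg hc]
      simp only [upRow, downRow]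
      rw [if_neg hc]
      by_cases hcn : c = n
      · subst hcn
        split_ifs <;> omega
      · split_ifs <;> omega
  | zero => rfl
  | neg c =>
    have h5 := (h.supp c).2
    simp only [lastRaised, reduceCtorEq, if_false, neg.injEq]
    simp only [upRow, downRow]
    split_ifs <;> omega

/-- The number of times `e_i` acts on the row on the way up. -/
def upExp (X : KRType) (n : ℕ) (x : Coord) (i : ℕ) : ℕ :=
  if i = n then turnLength X * upCount x n
  else upCount x i + if i % 2 = 1 then x (pos (i + 1)) else 0

theorem rowRaises_up (h : HighestRow X n r x) (hn : InRange X n r) (hr : 3 ≤ r)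
    (hodd : r % 2 = 1) :
    RowRaises X n l (nodesUp n 2) (upExp X n x) (upRow x 2) (downRow r x (turn X n)) := by
  have hrn := le_of_inRange hn
  have h1 : nodesUp n 2 = List.range' 2 (n - 2) ++ [n] := by
    rw [nodesUp, show n + 1 - 2 = (n - 2) + 1 by omega, List.range'_concat]
    congr 2
    omega
  rw [h1]
  refine RowRaises.append (v := upRow x n) ?_ ?_
  · have := RowRaises.up (X := X) (n := n) (l := l) (g := upExp X n x) (a := 2) (len := n - 2)
      (s := upRow x) (fun i hi hin => by
        obtain ⟨h2, h3⟩ := raisedRow_upRow h hi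
        rw [← h3]
        refine iter_rowCrystal (by omega) (by omega)
          (supported_upRow h (by omega) (by omega) (by omega)) ?_
        rw [h2, upExp, if_neg (show ¬i = n by omega)])
    rwa [show 2 + (n - 2) = n by omega] at this
  · refine ⟨_, ?_, rfl⟩
    rw [← lastRaised_upRow h hn hr hodd]
    refine iter_rowCrystal_last (by omega) _ (lastRow_upRow h hn hr) ?_
    have e1 : upRow x n (neg n) = upCount x n := by
      simp only [upRow]; split_ifs <;> omega
    rw [e1, upExp, if_pos rfl]
    rfl

theorem rowRaises_down (h : HighestRow X n r x) (hn : InRange X n r) (hr : 3 ≤ r) :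
    RowRaises X n l (nodesDown X n 2) (fun i => downCount r x (i + 1))
      (downRow r x (turn X n)) (downRow r x 2) := by
  have hrn := le_of_inRange hn
  have htb := turn_bounds hn
  rw [nodesDown_eq]
  have := RowRaises.down (X := X) (n := n) (l := l) (g := fun i => downCount r x (i + 1)) (a := 2)
    (len := turn X n - 2) (s := downRow r x) (fun i hi hin => by
      obtain ⟨h2, h3⟩ := raisedRow_downRow h hi
      rw [← h3]
      exact iter_rowCrystal (by omega) (by omega)
        (supported_downRow (by omega) (by omega)) h2)
  rwa [show 2 + (turn X n - 2) = turn X n by omega] at this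

end RowPath

/-! ### The path of the tableau -/

section TabPath

variable {X : KRType} {n r m : ℕ}

/-- The exponents of `middlePath` on the way up. -/
def midUp (X : KRType) (n : ℕ) (H : List ℕ) (j : ℕ) : ℕ :=
  if j = n then turnLength X * H.length else H.countP (j < ·) + H.length

theorem nodesUp_three (hn : 3 ≤ n) : nodesUp n 3 = List.range' 3 (n - 3) ++ [n] := by
  rw [nodesUp, show n + 1 - 3 = (n - 3) + 1 by omega, List.range'_concat]
  congr 2
  omega

theorem nodesUp_two (hn : 3 ≤ n) : nodesUp n 2 = 2 :: nodesUp n 3 := by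
  rw [nodesUp, nodesUp, show n + 1 - 2 = (n + 1 - 3) + 1 by omega, List.range'_succ]

theorem nodesDown_two (hn : InRange X n r) (hr : 3 ≤ r) :
    nodesDown X n 2 = nodesDown X n 3 ++ [2] := by
  have htb := turn_bounds hn
  rw [nodesDown_eq, nodesDown_eq, show turn X n - 2 = (turn X n - 3) + 1 by omega,
    List.range'_succ, List.reverse_cons]

theorem middlePath_eq (hn : 3 ≤ n) (H : List ℕ) :
    middlePath X n [] H = (nodesUp n 3).map (fun j => (j, midUp X n H j)) ++
      (nodesDown X n 3).map (fun j => (j, H.countP (· ≤ j))) := by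
  rw [middlePath, nodesUp_three hn, nodesDown_eq, List.map_append]
  congr 2
  · refine List.map_congr_left fun i hi => ?_
    rw [List.mem_range'_1] at hi
    rw [midUp, if_neg (by omega)]
    simp
  · simp [midUp]

theorem Raises.append_iff {z : Prop} {L L' : List (ℕ × ℕ)} {u w : List KRLetter} :
    Raises X n z (L ++ L') u w ↔ ∃ v, Raises X n z L u v ∧ Raises X n z L' v w := by
  constructor
  · intro h
    induction L generalizing u with
    | nil => exact ⟨u, rfl, h⟩
    | cons a L ih =>
      obtain ⟨v, hv, h⟩ := h
      obtain ⟨t, h1, h2⟩ := ih h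
      exact ⟨t, ⟨v, hv, h1⟩, h2⟩
  · rintro ⟨v, h1, h2⟩
    exact h1.append h2

/-- The heights of the columns of `endTab G m`, from left to right. -/
def barHeights (G : List ℕ) (m : ℕ) : List ℕ := G ++ List.replicate m 3

theorem barHeights_bounds {G : List ℕ} (hr : 3 ≤ r) (hb : ∀ g ∈ G, 3 ≤ g ∧ g ≤ r) :
    ∀ g ∈ barHeights G m, 3 ≤ g ∧ g ≤ r := by
  intro g hg
  rcases List.mem_append.mp hg with h | h
  · exact hb g h
  · have := (List.mem_replicate.mp h).2
    omega

theorem length_barHeights (G : List ℕ) : (barHeights G m).length = G.length + m := by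
  simp [barHeights]

/-- The exponents for the tableau in the first half of the word, on the way up. -/
def tabUp (X : KRType) (n : ℕ) (G : List ℕ) (m j : ℕ) : ℕ :=
  if j = 2 then m + 2 * G.length else midUp X n (barHeights G m) j

/-- The exponents for the tableau in the first half of the word, on the way down. -/
def tabDown (G : List ℕ) (m j : ℕ) : ℕ :=
  if j = 2 then m else (barHeights G m).countP (· ≤ j)

theorem config_tall {G : List ℕ} (hs : G.Pairwise (· ≥ ·)) (hb : ∀ g ∈ G, 3 ≤ g ∧ g ≤ r)
    (ho : ∀ g ∈ G, g % 2 = 1) : Config r G [] [] m :=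
  ⟨by simpa using hs, by simpa using hb, by simpa using ho, Or.inl rfl, Or.inr rfl⟩

theorem topPath_eq (hn : InRange X n r) (hr : 3 ≤ r) (G : List ℕ) :
    topPath X n G [] m = (nodesUp n 2).map (fun j => (j, tabUp X n G m j)) ++
      (nodesDown X n 2).map (fun j => (j, tabDown G m j)) := by
  have hrn := le_of_inRange hn
  rw [topPath, nodesUp_two (by omega), nodesDown_two hn hr, List.map_cons, List.map_append,
    List.cons_append, ← List.append_assoc, show G ++ List.replicate m 3 = barHeights G m from rfl,
    middlePath_eq (by omega)]
  have h0 : ((2, ([] : List ℕ).length + (m + 2 * G.length)) : ℕ × ℕ) =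
      (2, tabUp X n G m 2) := by
    simp [tabUp]
  rw [h0]
  congr 2
  congr 1
  · refine List.map_congr_left fun j hj => ?_
    rw [nodesUp, List.mem_range'_1] at hj
    rw [tabUp, if_neg (show ¬j = 2 by omega)]
  · refine List.map_congr_left fun j hj => ?_
    rw [nodesDown_eq, List.mem_reverse, List.mem_range'_1] at hj
    rw [tabDown, if_neg (show ¬j = 2 by omega)]

/-- The first half of the path of the tableau. -/
theorem raises_endTab (hn : InRange X n r) (hr : 3 ≤ r) {G : List ℕ}
    (hs : G.Pairwise (· ≥ ·)) (hb : ∀ g ∈ G, 3 ≤ g ∧ g ≤ r) (ho : ∀ g ∈ G, g % 2 = 1) :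
    ∃ v, Raises X n True ((nodesUp n 2).map fun j => (j, tabUp X n G m j))
        (rWord G [] [] 0 m) v ∧
      Raises X n True ((nodesDown X n 2).map fun j => (j, tabDown G m j)) v
        (kWord (barHeights G m) (List.replicate m 3)) := by
  have h := raises_rWord (z := True) (a := 0) hn hr (config_tall (m := m) hs hb ho)
    (fun _ => ⟨rfl, rfl, rfl⟩)
  rw [topPath_eq hn hr, Raises.append_iff] at h
  have h1 : rTop n G [] [] 0 m = kWord (barHeights G m) (List.replicate m 3) := by
    have h2 : min (0 + m) (2 * (barHeights G m).length) - m = 0 := by omega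
    rw [rTop, show G ++ List.replicate m 3 = barHeights G m from rfl, h2]
    simp [rDots, dotFill, colWord]
  rwa [h1] at h

/-- The barred letters and holes with the value `1` change to `2` one by one. -/
theorem iter_one (hn : 3 ≤ n) {H : List ℕ} (hb : ∀ g ∈ H, 3 ≤ g ∧ g ≤ n)
    (hm : m ≤ 2 * H.length) :
    phiWord X n 1 (kWord H (List.replicate m 3)) = 0 ∧
    partialIter (eWd X n 1) (2 * H.length - m) (kWord H (List.replicate m 3)) =
      some (kWord H (List.replicate m 3 ++ List.replicate (2 * H.length - m) 2)) := by
  have hG : ∀ g ∈ H, 1 < g ∧ g ≤ n := fun g hg => by have := hb g hg; omega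
  have hQ : ∀ q ∈ List.replicate m 3, 1 < q ∧ q ≤ n := fun q hq => by
    have := (List.mem_replicate.mp hq).2
    omega
  have h1 := (kWord_move (X := X) le_rfl (by omega) hG hQ (s := 2 * H.length - m)
    (by simp; omega) (by simp; omega)).2.1
  have h2 := kWord_move_iter (X := X) le_rfl (by omega) hG hQ (s := 0) (t := 2 * H.length - m)
    (by simp; omega) (by simp; omega)
  rw [kWord_pad] at h1
  rw [kWord_pad, List.replicate_zero, List.append_nil] at h2
  exact ⟨by rw [h1]; simp [List.count_replicate], h2⟩

/-- The barred letters and holes with the value `2` change to `3` one by one. -/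
theorem iter_two {H : List ℕ} (hb : ∀ g ∈ H, 3 ≤ g ∧ g ≤ n)
    (hn3 : 2 < n) (hm : m ≤ 2 * H.length) :
    phiWord X n 2 (kWord H (List.replicate m 3 ++ List.replicate (2 * H.length - m) 2)) = m ∧
    partialIter (eWd X n 2) (2 * H.length - m)
      (kWord H (List.replicate m 3 ++ List.replicate (2 * H.length - m) 2)) =
      some (colWord (fun g => kCol g 3 3) H) := by
  have hG : ∀ g ∈ H, 2 < g ∧ g ≤ n := fun g hg => by have := hb g hg; omega
  have hQ : ∀ q ∈ List.replicate m 3, 2 < q ∧ q ≤ n := fun q hq => by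
    have := (List.mem_replicate.mp hq).2
    omega
  have h1 := (kWord_move (X := X) (i := 2) (by omega) hn3 hG hQ (s := 2 * H.length - m)
    (by simp; omega) (by simp)).2.1
  have h2 := kWord_move_iter (X := X) (i := 2) (by omega) hn3 hG hQ (s := 0)
    (t := 2 * H.length - m) (by simp; omega) (by simp)
  rw [List.replicate_zero, List.append_nil, ← List.replicate_add,
    show m + (2 * H.length - m) = 2 * H.length by omega, kWord_replicate] at h2
  exact ⟨by rw [h1]; simp, h2⟩

/-- The letters `3` with a bar go up to `n`, turn into unbarred letters and fill the holes
of their columns. -/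
theorem raises_columns (hn : InRange X n r) (hr : 3 ≤ r) {H : List ℕ}
    (hb : ∀ g ∈ H, 3 ≤ g ∧ g ≤ r) :
    ∃ v, Raises X n True ((nodesUp n 3).map fun j => (j, midUp X n H j))
        (colWord (fun g => kCol g 3 3) H) v ∧
      Raises X n True ((nodesDown X n 3).map fun j => (j, H.countP (· ≤ j))) v
        (colWord (seg 1) H) := by
  have hrn := le_of_inRange hn
  have hF : ∀ t ∈ H.map (fun g => (([pos 1, pos 2], g, []) : List KRLetter × ℕ × List KRLetter)),
      FreeData r t := by
    intro t ht
    obtain ⟨g, hg, rfl⟩ := List.mem_map.mp ht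
    have := hb g hg
    refine ⟨this.1, this.2, ?_, by simp⟩
    intro a ha
    simp only [List.mem_cons, List.not_mem_nil, or_false] at ha
    rcases ha with rfl | rfl
    · exact ⟨1, by omega, rfl⟩
    · exact ⟨2, by omega, rfl⟩
  have h := raises_middlePath (X := X) (n := n) (z := True) hn hr (D := []) hF
    (pre := fun _ => []) (suf := [])
    (fun _ _ _ => ⟨0, Raise.nil, Or.inr rfl, fun _ => rfl⟩)
    ⟨0, Raise.nil, Or.inr rfl, fun _ => rfl⟩
    (fun _ _ _ => ⟨0, Raise.nil, Or.inr rfl, fun _ => rfl⟩)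
    (fun _ _ _ => rfl) (fun _ => rfl)
  have h1 : ∀ (c : List KRLetter × ℕ × List KRLetter → List KRLetter) (d : ℕ → List KRLetter),
      (∀ g ∈ H, c ([pos 1, pos 2], g, []) = d g) →
      colWord c (H.map fun g => ([pos 1, pos 2], g, [])) = colWord d H := fun c d hcd => by
    rw [colWord_map]
    exact colWord_congr hcd
  have hs : seg 1 2 = [pos 1, pos 2] := rfl
  rw [List.map_map, show ((fun t : List KRLetter × ℕ × List KRLetter => t.2.1) ∘ fun g =>
    (([pos 1, pos 2], g, []) : List KRLetter × ℕ × List KRLetter)) = id from rfl, List.map_id,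
    middlePath_eq (by omega), Raises.append_iff] at h
  simp only [List.nil_append, List.append_nil] at h
  rw [h1 (freeCol 3) (fun g => kCol g 3 3), h1 (turnedCol 3) (seg 1)] at h
  · exact h
  · intro g hg
    have := hb g hg
    rw [turnedCol, max_eq_right this.1, ← seg_self g, ← hs, List.append_nil]
    have e1 := seg_append (a := 3) (b := g - 1) (c := g) (by omega) (by omega)
    rw [show g - 1 + 1 = g by omega] at e1
    have e2 := seg_append (a := 1) (b := 2) (c := g) (by omega) (by omega)
    rw [← e2, ← e1]
  · intro g hg
    have := hb g hg
    rw [freeCol, min_eq_left this.1, kCol, holeSeg, holeSeg, ← hs]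
    simp [seg_of_lt]

end TabPath

/-! ### Weights and highest weight tableaux -/

section Weights

variable {X : KRType} {n r k : ℕ} {μ : ℕ → ℕ}

/-- The word of a highest weight tableau bounds `φ_i` by the number of columns of height `i`. -/
theorem phiWord_segs_le (hn : InRange X n r) (hr : 3 ≤ r) {i : ℕ} (hi : 1 ≤ i) (hin : i ≤ n)
    {H : List ℕ} (hH : ∀ g ∈ H, g ≤ r) : phiWord X n i (colWord (seg 1) H) ≤ H.count i := by
  have hrn := le_of_inRange hn
  have h1 : ∀ g ≤ r, phiWord X n i (seg 1 g) ≤ if g = i then 1 else 0 := by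
    intro g hg
    have hs : Standard X n i → phiWord X n i (seg 1 g) ≤ if g = i then 1 else 0 := by
      intro hs
      rw [(epsWord_seg hs (by omega)).2]
      split_ifs <;> omega
    rcases Nat.lt_or_ge i n with h | h
    · exact hs (standard_of_lt hi h)
    · obtain rfl : i = n := by omega
      rcases standard_or_inert hn hr with h | ⟨_, h⟩
      · exact hs h
      · rw [phiWord_eq_zero_of_letters fun a ha => ?_]
        · exact Nat.zero_le _
        · obtain ⟨c, _, hc, rfl⟩ := mem_seg.mp ha
          exact (h c (by omega)).1.2
  induction H with
  | nil => simp [colWord, phiWord]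
  | cons g H ih =>
    have h2 := h1 g (hH g (by simp))
    have h3 := ih fun a ha => hH a (by simp [ha])
    rw [colWord, phiWord_append, List.count_cons]
    simp only [beq_iff_eq]
    omega

/-- The heights at least `3` of the columns of the weight `μ`, from left to right. -/
def tallHeights (r : ℕ) (μ : ℕ → ℕ) : List ℕ :=
  ((List.range' 3 (r - 2)).flatMap fun i => List.replicate (μ i) i).reverse

theorem weight_even (hμ : IsWeight r k μ) (hodd : r % 2 = 1) {i : ℕ} (hi : i % 2 = 0) :
    μ i = 0 := by
  by_contra h
  have := (hμ.1 i h).2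
  omega

theorem weight_gt (hμ : IsWeight r k μ) {i : ℕ} (hi : r < i) : μ i = 0 := by
  by_contra h
  have := (hμ.1 i h).1
  omega

theorem weight_sum (hμ : IsWeight r k μ) (hodd : r % 2 = 1) : oddSum μ 1 r = k := by
  rw [← hμ.2, oddSum]
  refine Finset.sum_subset (fun i hi => ?_) (fun i hi hi' => ?_)
  · rw [Finset.mem_filter, Finset.mem_Icc] at hi
    rw [Finset.mem_range]
    omega
  · rw [Finset.mem_filter, Finset.mem_Icc] at hi'
    rw [Finset.mem_range] at hi
    exact weight_even hμ hodd (by omega)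

theorem weight_one (hμ : IsWeight r k μ) (hodd : r % 2 = 1) (hr : 3 ≤ r) :
    μ 1 + oddSum μ 3 r = k := by
  have h1 : oddSum μ 1 2 = μ 1 := by
    rw [oddSum_succ μ (by omega), oddSum_succ μ (by omega), oddSum_of_lt μ (by omega)]
    simp
  have h2 := oddSum_add μ (a := 1) (b := 2) (c := r) (by omega) (by omega)
  rw [h1, weight_sum hμ hodd] at h2
  exact h2.symm

theorem length_flatMap_weight (hμ : IsWeight r k μ) (hodd : r % 2 = 1) {a : ℕ} (ha : 1 ≤ a)
    (len : ℕ) : ((List.range' a len).flatMap fun i => List.replicate (μ i) i).length =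
      oddSum μ a (a + len - 1) := by
  induction len with
  | zero => rw [oddSum_of_lt μ (by omega)]; rfl
  | succ len ih =>
    rw [List.range'_concat, List.flatMap_append, List.length_append, ih,
      show a + (len + 1) - 1 = (a + len - 1) + 1 by omega, oddSum_succ μ (by omega)]
    simp only [List.flatMap_singleton, List.length_replicate, Nat.one_mul]
    rw [show a + len - 1 + 1 = a + len by omega]
    split_ifs with h
    · rfl
    · rw [weight_even hμ hodd (by omega)]

theorem countP_tallHeights (hμ : IsWeight r k μ) (hodd : r % 2 = 1) (hr : 3 ≤ r) {j : ℕ}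
    (h2 : 2 ≤ j) (hj : j ≤ r) :
    (tallHeights r μ).countP (· ≤ j) = oddSum μ 3 j ∧
    (tallHeights r μ).countP (j < ·) = oddSum μ (j + 1) r := by
  have h1 : List.range' 3 (r - 2) = List.range' 3 (j - 2) ++ List.range' (j + 1) (r - j) := by
    rw [show r - 2 = (j - 2) + (r - j) by omega, ← List.range'_append]
    congr 2
    omega
  have h3 : ∀ (a len : ℕ), ∀ g ∈ (List.range' a len).flatMap fun i => List.replicate (μ i) i,
      a ≤ g ∧ g < a + len := by
    intro a len g hg
    obtain ⟨i, hi, hg⟩ := List.mem_flatMap.mp hg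
    rw [List.mem_range'_1] at hi
    have := (List.mem_replicate.mp hg).2
    omega
  rw [tallHeights, List.countP_reverse, List.countP_reverse, h1, List.flatMap_append,
    List.countP_append, List.countP_append]
  constructor
  · rw [List.countP_eq_length.mpr, List.countP_eq_zero.mpr, length_flatMap_weight hμ hodd (by omega)]
    · rw [show 3 + (j - 2) - 1 = j by omega, Nat.add_zero]
    · intro g hg
      have := h3 _ _ g hg
      simp
      omega
    · intro g hg
      have := h3 _ _ g hg
      simp
      omega
  · rw [List.countP_eq_zero.mpr, List.countP_eq_length.mpr, length_flatMap_weight hμ hodd (by omega)]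
    · rw [Nat.zero_add]
      congr 1
      omega
    · intro g hg
      have := h3 _ _ g hg
      simp
      omega
    · intro g hg
      have := h3 _ _ g hg
      simp
      omega

theorem length_tallHeights (hμ : IsWeight r k μ) (hodd : r % 2 = 1) (hr : 3 ≤ r) :
    (tallHeights r μ).length + μ 1 = k := by
  rw [tallHeights, List.length_reverse, length_flatMap_weight hμ hodd (by omega),
    show 3 + (r - 2) - 1 = r by omega, Nat.add_comm]
  exact weight_one hμ hodd hr

theorem tallHeights_mem (hμ : IsWeight r k μ) {g : ℕ} (hg : g ∈ tallHeights r μ) :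
    (3 ≤ g ∧ g ≤ r) ∧ g % 2 = r % 2 := by
  rw [tallHeights, List.mem_reverse, List.mem_flatMap] at hg
  obtain ⟨i, hi, hg⟩ := hg
  rw [List.mem_range'_1] at hi
  obtain ⟨h1, rfl⟩ := List.mem_replicate.mp hg
  have := hμ.1 g h1
  exact ⟨⟨hi.1, this.1⟩, this.2⟩

theorem tallHeights_sorted : (tallHeights r μ).Pairwise (· ≥ ·) := by
  rw [tallHeights, List.pairwise_reverse, List.pairwise_flatMap]
  constructor
  · intro i _
    rw [List.pairwise_replicate]
    exact Or.inr le_rfl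
  · refine (List.pairwise_lt_range' (s := 3) (n := r - 2)).imp ?_
    intro a b hab x hx y hy
    have h1 := (List.mem_replicate.mp hx).2
    have h2 := (List.mem_replicate.mp hy).2
    show y ≥ x
    omega

/-- The tableau all of whose columns are of the form `1 2 ⋯ h`, with the given heights from left to
right. -/
def segTab (H : List ℕ) : Tab := ⟨H.reverse, colWord (seg 1) H⟩

theorem highestTab_eq_segTab {H : List ℕ}
    (h : (List.range (r + 1)).flatMap (fun i => List.replicate (μ i) i) = H.reverse) :
    highestTab r μ = segTab H := by
  rw [highestTab, segTab, h, colWord_eq_flatten, ← List.map_reverse, List.flatMap_def]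

theorem topTab_eq_segTab (G : List ℕ) (m : ℕ) : topTab G m = segTab (G ++ List.replicate m 1) := by
  rw [topTab, segTab, colWord_append, List.reverse_append, List.reverse_replicate]
  congr 2
  induction m with
  | zero => rfl
  | succ m ih =>
    rw [List.replicate_succ, List.replicate_succ, colWord, ← ih, seg_self, ← List.replicate_succ,
      List.replicate_succ']

theorem range_heights (hr : 3 ≤ r) :
    List.range (r + 1) = 0 :: 1 :: 2 :: List.range' 3 (r - 2) := by
  rw [List.range_eq_range', show r + 1 = (r - 2) + 1 + 1 + 1 by omega, List.range'_succ,
    List.range'_succ, List.range'_succ]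

theorem highestTab_eq (hμ : IsWeight r k μ) (hodd : r % 2 = 1) (hr : 3 ≤ r) :
    highestTab r μ = topTab (tallHeights r μ) (μ 1) := by
  rw [topTab_eq_segTab]
  apply highestTab_eq_segTab
  rw [range_heights hr, List.flatMap_cons, List.flatMap_cons, List.flatMap_cons,
    weight_even hμ hodd (i := 0) rfl, weight_even hμ hodd (i := 2) rfl, List.reverse_append,
    tallHeights, List.reverse_reverse]
  simp

theorem highestTab_barWeight (hμ : IsWeight r k μ) (hodd : r % 2 = 1) (hr : 3 ≤ r) :
    highestTab r (barWeight μ) = segTab (barHeights (tallHeights r μ) (μ 1)) := by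
  apply highestTab_eq_segTab
  have h0 : barWeight μ 0 = 0 := weight_even hμ hodd rfl
  have h2 : barWeight μ 2 = 0 := weight_even hμ hodd rfl
  have h3 : barWeight μ 3 = μ 1 + μ 3 := Nat.add_comm _ _
  have h4 : List.range' 3 (r - 2) = 3 :: List.range' 4 (r - 3) := by
    rw [show r - 2 = (r - 3) + 1 by omega, List.range'_succ]
  have h5 : (List.range' 4 (r - 3)).flatMap (fun i => List.replicate (barWeight μ i) i) =
      (List.range' 4 (r - 3)).flatMap fun i => List.replicate (μ i) i := by
    refine List.flatMap_congr fun i hi => ?_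
    rw [List.mem_range'_1] at hi
    simp only [barWeight]
    rw [if_neg (by omega), if_neg (by omega)]
  rw [range_heights hr, List.flatMap_cons, List.flatMap_cons, List.flatMap_cons, h0, h2,
    barHeights, List.reverse_append, tallHeights, List.reverse_reverse, h4, List.flatMap_cons,
    List.flatMap_cons, h3, h5, List.replicate_add]
  simp [barWeight, -List.replicate_append_replicate]

theorem isWeight_barWeight (hμ : IsWeight r k μ) (hodd : r % 2 = 1) (hr : 3 ≤ r) :
    IsWeight r k (barWeight μ) := by
  constructor
  · intro i hi
    have h1 := hμ.1 i
    simp only [barWeight] at hi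
    split_ifs at hi with h2 h3
    · exact absurd rfl hi
    · omega
    · exact h1 hi
  · have h1 : ∀ i, barWeight μ i + (if i = 1 then μ 1 else 0) =
        μ i + if i = 3 then μ 1 else 0 := by
      intro i
      simp only [barWeight]
      split_ifs <;> subst_vars <;> omega
    have h2 := Finset.sum_congr (rfl : Finset.range (r + 1) = _) fun i _ => h1 i
    rw [Finset.sum_add_distrib, Finset.sum_add_distrib, Finset.sum_ite_eq', Finset.sum_ite_eq',
      if_pos (Finset.mem_range.mpr (by omega)), if_pos (Finset.mem_range.mpr (by omega)), hμ.2] at h2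
    omega

end Weights

/-! ### Highest weight elements of the tensor product -/

section Highest

variable {X : KRType} {n r k l : ℕ} {μ : ℕ → ℕ} {x : Coord}

/-- In a tensor product element killed by `e_i`, the left factor pairs off all of `ε_i` of the right
one. -/
theorem eps_le_of_tensor {β γ : Type} {C : Crystal β} {D : Crystal γ} {i : ℕ} {T : β} {y : γ}
    (h : (C.tensor D).e i (T, y) = none) : D.eps i y ≤ C.phi i T := by
  by_contra hlt
  simp only [Crystal.tensor, hlt, if_false, Option.map_eq_none_iff] at h
  rw [eps_eq (q := 0) rfl h] at hlt
  omega

theorem IsRow.supported (hx : IsRow X n l x) : Supported n x := fun c =>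
  ⟨fun h => hx.1 (pos c) h, fun h => hx.1 (neg c) h⟩

/-- The string lengths of a row for a highest weight element are bounded by the multiplicities
of the weight. -/
theorem row_bounds (hodd : r % 2 = 1) (hr : 3 ≤ r) (hn : InRange X n r) (hμ : IsWeight r k μ)
    (hx : IsRow X n l x) (hhigh : ∀ i, 1 ≤ i → i ≤ n →
      ((crystal X n r k).tensor (rowCrystal X n l)).e i (highestTab r μ, x) = none) :
    (∀ i, 1 ≤ i → i < n → x (pos (i + 1)) - x (neg (i + 1)) + x (neg i) ≤ μ i) ∧
    (r < n → x (neg n) = 0 ∧ x zero = 0) := by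
  have hrn := le_of_inRange hn
  have hb : ∀ g ∈ tallHeights r μ ++ List.replicate (μ 1) 1, g ≤ r := by
    intro g hg
    rcases List.mem_append.mp hg with h | h
    · exact (tallHeights_mem hμ h).1.2
    · have := (List.mem_replicate.mp h).2
      omega
  have hcount : ∀ i, 1 ≤ i → (tallHeights r μ ++ List.replicate (μ 1) 1).count i ≤ μ i := by
    intro i hi
    rw [List.count_append, tallHeights, List.count_reverse, List.count_replicate]
    have h1 : ((List.range' 3 (r - 2)).flatMap fun i => List.replicate (μ i) i).count i =
        if i ∈ List.range' 3 (r - 2) then μ i else 0 :=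
      count_flatMap_replicate Function.injective_id μ List.nodup_range' i
    rw [h1]
    simp only [List.mem_range'_1, beq_iff_eq]
    split_ifs <;> subst_vars <;> omega
  have h0 : ∀ i, 1 ≤ i → i ≤ n → (rowCrystal X n l).eps i x ≤ μ i := by
    intro i h1 h2
    have h3 := eps_le_of_tensor (hhigh i h1 h2)
    rw [crystal_phi h1, highestTab_eq hμ hodd hr, topTab_eq_segTab] at h3
    exact h3.trans ((phiWord_segs_le hn hr h1 h2 hb).trans (hcount i h1))
  have hs := hx.supported
  have h1 : ∀ i, 1 ≤ i → i < n → x (pos (i + 1)) - x (neg (i + 1)) + x (neg i) ≤ μ i := by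
    intro i hi hin
    obtain ⟨h2, h3⟩ := iter_rowCrystal (X := X) (l := l) hi hin hs rfl
    have := h0 i hi hin.le
    rwa [eps_eq h2 h3] at this
  refine ⟨h1, fun hlt => ?_⟩
  have hlast : LastRow X n x := by
    refine ⟨hs, hx.2.2.1, fun hX => ?_, ?_⟩
    · by_contra h
      exact hX (hx.1 zero h)
    · rintro rfl
      have hn : r + 2 ≤ n := hn
      have h2 := h1 (n - 1) (by omega) (by omega)
      rw [weight_gt hμ (by omega), show n - 1 + 1 = n by omega] at h2
      have := hx.2.2.2 rfl
      omega
  obtain ⟨h2, h3⟩ := iter_rowCrystal_last (l := l) (by omega) _ hlast rfl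
  have h4 := h0 n (by omega) le_rfl
  rw [eps_eq h2 h3, weight_gt hμ hlt] at h4
  have h5 : 1 ≤ turnLength X := by unfold turnLength; split_ifs <;> omega
  have h6 := Nat.mul_le_mul_right (x (neg n)) h5
  omega

/-- The shape of the rows `x` for which `μ ⊗ x` is highest; the bound `x_2 + x̄_1 ≤ μ_1` says that
`e_2` acts on the tableau only, in the second half of the word. -/
theorem highestRow (hodd : r % 2 = 1) (hr : 3 ≤ r) (hn : InRange X n r) (hμ : IsWeight r k μ)
    (hx : IsRow X n l x) (hhigh : ∀ i, 1 ≤ i → i ≤ n →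
      ((crystal X n r k).tensor (rowCrystal X n l)).e i (highestTab r μ, x) = none) :
    HighestRow X n r x ∧ x (pos 2) + x (neg 1) ≤ μ 1 := by
  obtain ⟨h1, h2⟩ := row_bounds hodd hr hn hμ hx hhigh
  have hrn := le_of_inRange hn
  have hs := hx.supported
  have hneg : ∀ c, c % 2 = 0 ∨ r < c → x (neg c) = 0 := by
    intro c hc
    by_contra h
    have h3 := (hs c).2 h
    have h5 : μ c = 0 := hc.elim (weight_even hμ hodd) (weight_gt hμ)
    rcases Nat.lt_or_ge c n with h4 | h4
    · have := h1 c h3.1 h4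
      omega
    · obtain rfl : c = n := by omega
      rcases Nat.lt_or_ge r c with h6 | h6
      · exact h (h2 h6).1
      · omega
  have hpos : ∀ c, 2 ≤ c → μ (c - 1) = 0 → x (pos c) ≤ x (neg c) := by
    intro c hc h0
    by_cases h : x (pos c) = 0
    · omega
    · have h3 := (hs c).1 h
      have := h1 (c - 1) (by omega) (by omega)
      rw [h0, show c - 1 + 1 = c by omega] at this
      omega
  refine ⟨⟨hs, ?_, fun c hc => hneg c (Or.inl hc), fun c hc => hneg c (Or.inr hc), ?_, ?_⟩, ?_⟩
  · by_contra h
    have hX : X = KRType.typeB := hx.1 zero h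
    subst hX
    have hn : r + 1 ≤ n := hn
    exact h (h2 (by omega)).2
  · intro c hc
    have := hpos c (by omega) (weight_gt hμ (by omega))
    rw [hneg c (Or.inr (by omega))] at this
    omega
  · exact fun c hc hc' => hpos c (by omega) (weight_even hμ hodd (by omega))
  · have := h1 1 le_rfl (by omega)
    rw [hneg (1 + 1) (Or.inl rfl)] at this
    exact this

/-- The length of the row. -/
theorem row_length (h : HighestRow X n r x) (hx : IsRow X n l x) (hr : 3 ≤ r) (hrn : r ≤ n) :
    x (pos 1) + x (pos 2) + tailSum r x 3 + (x (neg 1) + oddSum (fun j => x (neg j)) 3 r) = l := by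
  have h1 : ∑ i ∈ Finset.Icc 1 n, x (pos i) = tailSum r x 1 := by
    have e1 : ∑ i ∈ Finset.Icc 1 n, x (pos i) = ∑ i ∈ Finset.Icc 1 (n + 1), x (pos i) := by
      refine Finset.sum_subset (Finset.Icc_subset_Icc_right (by omega)) fun i hi hi' => ?_
      rw [Finset.mem_Icc] at hi hi'
      by_contra hne
      have := (h.supp i).1 hne
      omega
    have e2 : tailSum r x 1 = ∑ i ∈ Finset.Icc 1 (n + 1), x (pos i) := by
      refine Finset.sum_subset (Finset.Icc_subset_Icc_right (by omega)) fun i hi hi' => ?_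
      rw [Finset.mem_Icc] at hi hi'
      exact h.pos_gt i (by omega)
    rw [e1, e2]
  have h2 : ∑ i ∈ Finset.Icc 1 n, x (neg i) = oddSum (fun j => x (neg j)) 1 r := by
    refine (Finset.sum_subset (fun i hi => ?_) fun i hi hi' => ?_).symm
    · rw [Finset.mem_filter, Finset.mem_Icc] at hi
      rw [Finset.mem_Icc]
      omega
    · rw [Finset.mem_filter, Finset.mem_Icc] at hi'
      rw [Finset.mem_Icc] at hi
      rcases Nat.lt_or_ge r i with h3 | h3
      · exact h.neg_gt i h3
      · exact h.neg_even i (by omega)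
  have h3 := hx.2.1
  have h4 : oddSum (fun j => x (neg j)) 1 2 = x (neg 1) := by
    rw [oddSum_succ _ (by omega), oddSum_succ _ (by omega), oddSum_of_lt _ (by omega)]
    simp
  rw [Finset.sum_add_distrib, h1, h2, h.zero, tailSum_eq h, tailSum_eq h,
    oddSum_add (fun j => x (neg j)) (b := 2) (by omega) (by omega), h4] at h3
  simp only [Nat.reduceAdd] at h3
  omega

end Highest

/-! ### The exponents -/

section Exponents

variable {X : KRType} {n r k l : ℕ} {μ : ℕ → ℕ} {x : Coord}

theorem countP_barHeights (hμ : IsWeight r k μ) (hodd : r % 2 = 1) (hr : 3 ≤ r) {j : ℕ}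
    (h3 : 3 ≤ j) (hj : j ≤ r) :
    (barHeights (tallHeights r μ) (μ 1)).countP (· ≤ j) = μ 1 + oddSum μ 3 j ∧
    (barHeights (tallHeights r μ) (μ 1)).countP (j < ·) = oddSum μ (j + 1) r := by
  obtain ⟨h1, h2⟩ := countP_tallHeights hμ hodd hr (by omega : 2 ≤ j) hj
  rw [barHeights, List.countP_append, List.countP_append, h1, h2, List.countP_replicate,
    List.countP_replicate, if_pos (by simpa using h3), if_neg (by simpa using h3)]
  exact ⟨Nat.add_comm _ _, rfl⟩

theorem countP_barHeights_of_le (hμ : IsWeight r k μ) (hodd : r % 2 = 1) (hr : 3 ≤ r) {j : ℕ}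
    (hj : r ≤ j) :
    (barHeights (tallHeights r μ) (μ 1)).countP (· ≤ j) = k ∧
    (barHeights (tallHeights r μ) (μ 1)).countP (j < ·) = 0 := by
  have hb := barHeights_bounds (m := μ 1) hr fun g hg => (tallHeights_mem hμ hg).1
  constructor
  · rw [List.countP_eq_length.mpr, length_barHeights]
    · exact length_tallHeights hμ hodd hr
    · intro g hg
      have := hb g hg
      simp
      omega
  · rw [List.countP_eq_zero]
    intro g hg
    have := hb g hg
    simp
    omega

theorem midUp_of_le (hμ : IsWeight r k μ) (hodd : r % 2 = 1) (hr : 3 ≤ r) {j : ℕ}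
    (hj : r ≤ j) :
    midUp X n (barHeights (tallHeights r μ) (μ 1)) j =
      if X = KRType.typeB ∧ j = n then 2 * k else k := by
  rw [midUp, (countP_barHeights_of_le hμ hodd hr hj).2, length_barHeights,
    length_tallHeights hμ hodd hr, turnLength]
  by_cases h1 : j = n <;> by_cases h2 : X = KRType.typeB <;> simp [h1, h2]

theorem midUp_of_ne (hμ : IsWeight r k μ) (hodd : r % 2 = 1) (hr : 3 ≤ r) {j : ℕ}
    (h3 : 3 ≤ j) (hj : j ≤ r) (hjn : j ≠ n) :
    midUp X n (barHeights (tallHeights r μ) (μ 1)) j = oddSum μ (j + 1) r + k := by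
  rw [midUp, if_neg hjn, (countP_barHeights hμ hodd hr h3 hj).2, length_barHeights,
    length_tallHeights hμ hodd hr]

/-- The exponents of `b_{1,1}` on the way up are the sums of those of the two factors. -/
theorem exponent_up (h : HighestRow X n r x) (hn : InRange X n r) (hμ : IsWeight r k μ)
    (hodd : r % 2 = 1) (hr : 3 ≤ r) {j : ℕ} (h2 : 2 ≤ j) (hj : j ≤ n) :
    tabUp X n (tallHeights r μ) (μ 1) j + upExp X n x j =
      if j ≤ r then expS k μ x j
      else if X = KRType.typeB ∧ j = n then 2 * expAlpha r k x else expAlpha r k x := by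
  have hrn := le_of_inRange hn
  have hk := weight_one hμ hodd hr
  have hl := length_tallHeights hμ hodd hr
  have hs := weight_sum hμ hodd
  have h11 := oddSum_one_one μ
  by_cases hjr : j ≤ r
  · rw [if_pos hjr]
    by_cases hj2 : j = 2
    · subst hj2
      rw [tabUp, if_pos rfl, upExp, if_neg (by omega), upCount, oddSum_of_lt _ (by omega), expS]
      simp only [Nat.reduceMod, Nat.reduceSub, h11, zero_ne_one, if_false,
        oddSum_of_lt (fun t => x (neg t)) (by omega : 1 < 3)]
      omega
    · rw [tabUp, if_neg hj2]
      by_cases hjn : j = n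
      · have hX : X = KRType.typeA := by
          cases X with
          | typeA => rfl
          | typeB => have : r + 1 ≤ n := hn; omega
          | typeD => have : r + 2 ≤ n := hn; omega
        have hjr' : j = r := by omega
        subst hX
        rw [midUp, if_pos hjn, upExp, if_pos hjn, ← hjn, hjr', length_barHeights, hl, upCount,
          turnLength, expS, if_pos hodd, hs]
        have : x (pos (r + 1)) = 0 := by
          by_contra h3
          have := (h.supp _).1 h3
          omega
        simp only [reduceCtorEq, if_false]
        omega
      · have h5 := oddSum_add μ (a := 1) (b := j) (c := r) (by omega) hjr
        have h6 : oddSum μ 1 (j - 1 + 1) = oddSum μ 1 (j - 1) + _ := oddSum_succ μ (by omega)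
        have h7 : oddSum (fun t => x (neg t)) 3 (j - 1 + 1) =
          oddSum (fun t => x (neg t)) 3 (j - 1) + _ := oddSum_succ _ (by omega)
        rw [show j - 1 + 1 = j by omega] at h6 h7
        rw [midUp_of_ne hμ hodd hr (by omega) hjr hjn, upExp, if_neg hjn, upCount, expS]
        split_ifs at h6 h7 ⊢ <;> omega
  · rw [if_neg hjr, tabUp, if_neg (by omega), midUp_of_le hμ hodd hr (by omega), upExp,
      upCount_of_le h hr hrn, upCount_of_le h hr (show r ≤ j by omega), expAlpha, turnLength]
    have h5 : j % 2 = 1 → x (pos (j + 1)) = 0 := fun _ => h.pos_gt _ (by omega)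
    by_cases h6 : j = n
    · by_cases h7 : X = KRType.typeB
      · rw [if_pos ⟨h7, h6⟩, if_pos h6, if_pos h7, if_pos ⟨h7, h6⟩]
        omega
      · rw [if_neg (fun e => h7 e.1), if_pos h6, if_neg h7, if_neg (fun e => h7 e.1)]
        omega
    · simp only [h6, and_false, if_false]
      split_ifs with h7
      · rw [h5 h7]
        omega
      · omega

/-- The exponents of `b_{1,1}` on the way down are the sums of those of the two factors. -/
theorem exponent_down (hμ : IsWeight r k μ) (hodd : r % 2 = 1) (hr : 3 ≤ r) {j : ℕ}
    (h2 : 2 ≤ j) :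
    tabDown (tallHeights r μ) (μ 1) j + downCount r x (j + 1) =
      if j < r then expS1 r k μ x j else expAlpha r k x := by
  have hk := weight_one hμ hodd hr
  rw [downCount]
  by_cases hjr : j < r
  · rw [if_pos hjr, expS1, tailSum, expAlpha]
    have h5 := oddSum_round μ j r
    rw [h5]
    by_cases hj2 : j = 2
    · subst hj2
      have h6 : oddSum μ (2 + 1) r = oddSum μ 3 r := rfl
      rw [tabDown, if_pos rfl]
      omega
    · have h6 := oddSum_add μ (a := 3) (b := j) (c := r) (by omega) hjr.le
      rw [tabDown, if_neg hj2, (countP_barHeights hμ hodd hr (by omega) hjr.le).1]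
      omega
  · rw [if_neg hjr, tabDown, if_neg (by omega),
      (countP_barHeights_of_le hμ hodd hr (by omega)).1, tailSum_zero (by omega), expAlpha]
    omega

/-- The exponents of `b_{1,2}` at the nodes `3, …, n`. -/
theorem exponent_mid_up (hn : InRange X n r) (hμ : IsWeight r k μ) (hodd : r % 2 = 1)
    (hr : 3 ≤ r) {j : ℕ} (h3 : 3 ≤ j) :
    midUp X n (barHeights (tallHeights r μ) (μ 1)) j =
      if j < r then expS2 k l μ j
      else if X = KRType.typeB ∧ j = n then 2 * k else k := by
  have hrn := le_of_inRange hn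
  by_cases hjr : j < r
  · have h5 := oddSum_add μ (a := 1) (b := j) (c := r) (by omega) hjr.le
    have hs := weight_sum hμ hodd
    have h6 : oddSum μ 1 (2 * ((j + 1) / 2) - 1) = oddSum μ 1 j := by
      rcases Nat.mod_two_eq_zero_or_one j with hj | hj
      · have h6 : oddSum μ 1 (j - 1 + 1) = oddSum μ 1 (j - 1) + _ := oddSum_succ μ (by omega)
        rw [if_neg (by omega), show j - 1 + 1 = j by omega] at h6
        rw [h6, show 2 * ((j + 1) / 2) - 1 = j - 1 by omega, Nat.add_zero]
      · congr 1
        omega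
    rw [if_pos hjr, midUp_of_ne hμ hodd hr h3 hjr.le (by omega), expS2, if_neg (by omega), h6]
    omega
  · rw [if_neg hjr, midUp_of_le hμ hodd hr (by omega)]

/-- The exponents of `b_{1,2}` at the nodes after `n`, down to `3`. -/
theorem exponent_mid_down (hμ : IsWeight r k μ) (hodd : r % 2 = 1) (hr : 3 ≤ r) {j : ℕ}
    (h3 : 3 ≤ j) :
    (barHeights (tallHeights r μ) (μ 1)).countP (· ≤ j) =
      if j < r then expS3 r k μ x j else k := by
  have hk := weight_one hμ hodd hr
  by_cases hjr : j < r
  · have h5 := oddSum_round μ j r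
    have h6 := oddSum_add μ (a := 3) (b := j) (c := r) (by omega) hjr.le
    rw [if_pos hjr, (countP_barHeights hμ hodd hr h3 hjr.le).1, expS3, if_neg (by omega),
      if_neg (by omega), h5]
    omega
  · rw [if_neg hjr, (countP_barHeights_of_le hμ hodd hr (by omega)).1]

theorem powerWord_append (L L' : List ℕ) (g : ℕ → ℕ) :
    powerWord (L ++ L') g = powerWord L g ++ powerWord L' g := by
  rw [powerWord, powerWord, powerWord, List.flatMap_append]

theorem nodesUp_split {a : ℕ} (h : a ≤ r) (hrn : r ≤ n + 1) :
    nodesUp n a = List.range' a (r - a) ++ nodesUp n r := by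
  rw [nodesUp, nodesUp, show n + 1 - a = (r - a) + (n + 1 - r) by omega, ← List.range'_append]
  congr 2
  omega

theorem nodesDown_split {a : ℕ} (h : a ≤ r) (hn : InRange X n r) :
    nodesDown X n a = nodesDown X n r ++ (List.range' a (r - a)).reverse := by
  have htb := turn_bounds hn
  rw [nodesDown_eq, nodesDown_eq, show turn X n - a = (r - a) + (turn X n - r) by omega,
    ← List.range'_append, List.reverse_append]
  congr 3
  omega

theorem wordB11_eq (h : HighestRow X n r x) (hn : InRange X n r) (hμ : IsWeight r k μ)
    (hodd : r % 2 = 1) (hr : 3 ≤ r) :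
    wordB11 X n r k μ x =
      powerWord (nodesUp n 2) (fun j => tabUp X n (tallHeights r μ) (μ 1) j + upExp X n x j) ++
      powerWord (nodesDown X n 2)
        (fun j => tabDown (tallHeights r μ) (μ 1) j + downCount r x (j + 1)) := by
  have hrn := le_of_inRange hn
  have htb := turn_bounds hn
  rw [wordB11, ascending, descending, nodesUp_split (r := r + 1) (a := 2) (by omega) (by omega),
    nodesDown_split (a := 2) (by omega) hn, powerWord_append, powerWord_append,
    show r + 1 - 2 = r - 1 by omega, ← List.append_assoc]
  refine congrArg₂ _ (congrArg₂ _ (congrArg₂ _ ?_ ?_) ?_) ?_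
  · refine powerWord_congr fun j hj => ?_
    rw [List.mem_range'_1] at hj
    rw [exponent_up h hn hμ hodd hr (by omega) (by omega), if_pos (by omega)]
  · refine powerWord_congr fun j hj => ?_
    rw [nodesUp, List.mem_range'_1] at hj
    rw [exponent_up h hn hμ hodd hr (by omega) (by omega), if_neg (show ¬j ≤ r by omega)]
  · refine powerWord_congr fun j hj => ?_
    rw [nodesDown_eq, List.mem_reverse, List.mem_range'_1] at hj
    rw [exponent_down hμ hodd hr (by omega), if_neg (by omega)]
  · refine powerWord_congr fun j hj => ?_
    rw [List.mem_reverse, List.mem_range'_1] at hj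
    rw [exponent_down hμ hodd hr (by omega), if_pos (by omega)]

theorem wordB12_eq (hn : InRange X n r) (hμ : IsWeight r k μ) (hodd : r % 2 = 1) (hr : 3 ≤ r) :
    wordB12 X n r k l μ x = List.replicate (2 * k - μ 1 + l) 1 ++
      (List.replicate (2 * k - μ 1) 2 ++
        (powerWord (nodesUp n 3) (midUp X n (barHeights (tallHeights r μ) (μ 1))) ++
          (powerWord (nodesDown X n 3)
            (fun j => (barHeights (tallHeights r μ) (μ 1)).countP (· ≤ j)) ++
            List.replicate (x (pos 2) + x (neg 1)) 2))) := by
  have hrn := le_of_inRange hn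
  have htb := turn_bounds hn
  have hk := weight_one hμ hodd hr
  have h11 := oddSum_one_one μ
  have hrange : List.range' 1 (r - 1) = [1] ++ ([2] ++ List.range' 3 (r - 3)) := by
    rw [show r - 1 = (r - 3) + 1 + 1 by omega, List.range'_succ, List.range'_succ]
    rfl
  have hsing : ∀ (a : ℕ) (g : ℕ → ℕ), powerWord [a] g = List.replicate (g a) a := fun a g => by
    simp [powerWord]
  have e1 : expS2 k l μ 1 = 2 * k - μ 1 + l := by
    rw [expS2, if_pos rfl]
    omega
  have e2 : expS2 k l μ 2 = 2 * k - μ 1 := by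
    rw [expS2, if_neg (by omega)]
    simp only [Nat.reduceAdd, Nat.reduceDiv, Nat.reduceMul, Nat.reduceSub, h11]
  have e3 : expS3 r k μ x 1 = 0 := rfl
  have e4 : expS3 r k μ x 2 = x (pos 2) + x (neg 1) := rfl
  rw [wordB12, ascending, descending, nodesUp_split (a := 3) hr (by omega),
    nodesDown_split (a := 3) hr hn, hrange]
  simp only [List.reverse_append, List.reverse_singleton, powerWord_append, hsing, e1, e2, e3, e4,
    List.append_assoc, List.replicate_zero, List.append_nil]
  congr 3
  · refine powerWord_congr fun j hj => ?_
    rw [List.mem_range'_1] at hj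
    rw [exponent_mid_up (l := l) hn hμ hodd hr (by omega), if_pos (by omega)]
  congr 1
  · refine powerWord_congr fun j hj => ?_
    rw [nodesUp, List.mem_range'_1] at hj
    rw [exponent_mid_up (l := l) hn hμ hodd hr (by omega), if_neg (show ¬j < r by omega)]
  congr 1
  · refine powerWord_congr fun j hj => ?_
    rw [nodesDown_eq, List.mem_reverse, List.mem_range'_1] at hj
    rw [exponent_mid_down (x := x) hμ hodd hr (by omega), if_neg (by omega)]
  congr 1
  · refine powerWord_congr fun j hj => ?_
    rw [List.mem_reverse, List.mem_range'_1] at hj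
    rw [exponent_mid_down (x := x) hμ hodd hr (by omega), if_pos (by omega)]

end Exponents

/-! ### The action of the word -/

section Main

variable {X : KRType} {n r k l : ℕ} {μ : ℕ → ℕ} {x : Coord}

theorem iter_zero (hn : InRange X n r) (hodd : r % 2 = 1) (hr : 3 ≤ r) (hμ : IsWeight r k μ)
    (h : HighestRow X n r x) :
    partialIter (((crystal X n r k).tensor (rowCrystal X n l)).e 0)
        (2 * k - μ 1 + x (pos 1) + x (pos 2)) (highestTab r μ, x) =
      some (endTab (tallHeights r μ) (μ 1), upRow x 2) := by
  obtain ⟨h1, h2⟩ := exists_zeroString (X := X) (n := n) (m := μ 1) hn hr (Nat.odd_iff.mpr hodd)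
    tallHeights_sorted (fun g hg => (tallHeights_mem hμ hg).1)
    (fun g hg => (tallHeights_mem hμ hg).2.trans hodd) (length_tallHeights hμ hodd hr)
  obtain ⟨h3, h4⟩ := raisedRow_start h
  obtain ⟨h5, h6⟩ := iter_rowCrystal_zero (X := X) (n := n) (l := l) h3
  rw [h4] at h5 h6
  rw [Nat.add_assoc, highestTab_eq hμ hodd hr]
  exact tensor_iter (phi_eq (q := 0) rfl h2) h5 h6 h1

theorem eWord_wordB11 (hn : InRange X n r) (hodd : r % 2 = 1) (hr : 3 ≤ r)
    (hμ : IsWeight r k μ) (h : HighestRow X n r x) :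
    ((crystal X n r k).tensor (rowCrystal X n l)).eWord (wordB11 X n r k μ x)
        (endTab (tallHeights r μ) (μ 1), upRow x 2) =
      some (⟨(barHeights (tallHeights r μ) (μ 1)).reverse,
        kWord (barHeights (tallHeights r μ) (μ 1)) (List.replicate (μ 1) 3)⟩, downRow r x 2) := by
  have hheights : rHeights (tallHeights r μ) [] [] 0 (μ 1) =
      (barHeights (tallHeights r μ) (μ 1)).reverse := by
    simp [rHeights, rColumns, barHeights, Function.comp_def]
  obtain ⟨v, h1, h2⟩ := raises_endTab (X := X) (n := n) (m := μ 1) hn hr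
    tallHeights_sorted (fun g hg => (tallHeights_mem hμ hg).1)
    (fun g hg => (tallHeights_mem hμ hg).2.trans hodd)
  rw [wordB11_eq h hn hμ hodd hr, eWord_append, endTab, hheights,
    eWord_tensor ?_ h1 (rowRaises_up h hn hr hodd) (fun _ _ => rfl), Option.bind_some,
    eWord_tensor ?_ h2 (rowRaises_down h hn hr) (fun _ _ => rfl)]
  · intro j hj
    rw [nodesDown_eq, List.mem_reverse, List.mem_range'_1] at hj
    omega
  · intro j hj
    rw [nodesUp, List.mem_range'_1] at hj
    omega

/-- The row with `m` letters `2` with a bar and `l - m` letters `1`. -/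
def middleRow (l m : ℕ) : Coord :=
  fun a => if a = neg 2 then m else if a = pos 1 then l - m else 0

/-- The effect of the first letters `1` of `b_{1,2}` on the row. -/
theorem raisedRow_downRow_two (h : HighestRow X n r x) (hx : IsRow X n l x) (hr : 3 ≤ r)
    (hrn : r ≤ n) :
    downRow r x 2 (pos 2) - downRow r x 2 (neg 2) + downRow r x 2 (neg 1) = l ∧
    raisedRow (downRow r x 2) (pos 2) (pos 1) (neg 1) (neg 2) =
      middleRow l (x (pos 2) + x (neg 1)) := by
  have h1 := row_length h hx hr hrn
  have e1 : downRow r x 2 (pos 2) = l - (x (pos 2) + x (neg 1)) := by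
    have : downRow r x 2 (pos 2) =
      x (pos 1) + oddSum (fun j => x (neg j)) 3 r + tailSum r x 3 := rfl
    omega
  have e2 : downRow r x 2 (neg 2) = 0 := rfl
  have e3 : downRow r x 2 (neg 1) = x (pos 2) + x (neg 1) := rfl
  refine ⟨by rw [e1, e2, e3]; omega, ?_⟩
  funext c
  cases c with
  | pos c =>
    simp only [raisedRow, e1, e2, e3, pos.injEq, reduceCtorEq, if_false, middleRow]
    simp only [downRow]
    split_ifs <;> omega
  | zero => rfl
  | neg c =>
    simp only [raisedRow, e1, e2, e3, neg.injEq, reduceCtorEq, if_false, middleRow]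
    simp only [downRow]
    split_ifs <;> omega

theorem supported_middleRow (hn : 3 ≤ n) (m : ℕ) : Supported n (middleRow l m) := by
  intro c
  constructor
  · intro h
    simp only [middleRow, pos.injEq, reduceCtorEq, if_false] at h
    split_ifs at h <;> omega
  · intro h
    simp only [middleRow, neg.injEq, reduceCtorEq, if_false] at h
    split_ifs at h <;> omega

/-- The nodes `3, …, n` do not act on `middleRow`. -/
theorem middleRow_inert (hn : InRange X n r) (hr : 3 ≤ r) (m : ℕ) {i : ℕ} (hi : 3 ≤ i)
    (hin : i ≤ n) : (rowCrystal X n l).e i (middleRow l m) = none := by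
  have hs := supported_middleRow (n := n) (l := l) (by omega) m
  have h0 : ∀ c, 3 ≤ c → middleRow l m (pos c) = 0 ∧ middleRow l m (neg c) = 0 := by
    intro c hc
    simp only [middleRow, pos.injEq, neg.injEq, reduceCtorEq, if_false]
    exact ⟨if_neg (by omega), if_neg (by omega)⟩
  rcases Nat.lt_or_ge i n with h | h
  · rw [rowCrystal_e (by omega) h hs, (h0 (i + 1) (by omega)).1, if_neg (by omega), moveUnit_eq,
      if_pos (h0 i hi).2]
  · obtain rfl : i = n := by omega
    have hlast : LastRow X i (middleRow l m) := by
      refine ⟨hs, Nat.zero_le _, fun _ => rfl, ?_⟩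
      rintro rfl
      have hn : r + 2 ≤ i := hn
      exact ⟨(h0 (i - 1) (by omega)).2, (h0 i hi).1⟩
    rw [rowCrystal_e_last hi hlast, if_pos (show middleRow l m zero = 0 from rfl), moveUnit_eq, if_pos (h0 i hi).2]

theorem rowRaises_inert {y : Coord} {js : List ℕ}
    (h : ∀ j ∈ js, (rowCrystal X n l).e j y = none) :
    RowRaises X n l js (fun _ => 0) y y := by
  induction js with
  | nil => rfl
  | cons j js ih => exact ⟨y, ⟨rfl, h j (by simp)⟩, ih fun a ha => h a (by simp [ha])⟩

/-- The effect of the last letters `2` of `b_{1,2}` on the row. -/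
theorem raisedRow_middleRow (m : ℕ) :
    middleRow l m (pos 3) - middleRow l m (neg 3) + middleRow l m (neg 2) = m ∧
    raisedRow (middleRow l m) (pos 3) (pos 2) (neg 2) (neg 3) = targetRow l m := by
  have e1 : middleRow l m (pos 3) = 0 := rfl
  have e2 : middleRow l m (neg 3) = 0 := rfl
  have e3 : middleRow l m (neg 2) = m := rfl
  refine ⟨by rw [e1, e2, e3]; omega, ?_⟩
  funext c
  cases c with
  | pos c =>
    simp only [raisedRow, e1, e2, e3, pos.injEq, reduceCtorEq, if_false, targetRow]
    simp only [middleRow, pos.injEq, reduceCtorEq, if_false]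
    split_ifs <;> omega
  | zero => rfl
  | neg c =>
    simp only [raisedRow, e1, e2, e3, neg.injEq, reduceCtorEq, if_false, targetRow]
    simp only [middleRow, neg.injEq, reduceCtorEq, if_false]
    split_ifs <;> omega

theorem eWord_wordB12 (hn : InRange X n r) (hodd : r % 2 = 1) (hr : 3 ≤ r)
    (hμ : IsWeight r k μ) (h : HighestRow X n r x) (hx : IsRow X n l x)
    (hm : x (pos 2) + x (neg 1) ≤ μ 1) :
    ((crystal X n r k).tensor (rowCrystal X n l)).eWord (wordB12 X n r k l μ x)
        (⟨(barHeights (tallHeights r μ) (μ 1)).reverse,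
          kWord (barHeights (tallHeights r μ) (μ 1)) (List.replicate (μ 1) 3)⟩, downRow r x 2) =
      some (highestTab r (barWeight μ), targetRow l (x (pos 2) + x (neg 1))) := by
  have hrn := le_of_inRange hn
  have htb := turn_bounds hn
  have hb := barHeights_bounds (m := μ 1) hr fun g hg => (tallHeights_mem hμ hg).1
  have hlen : (barHeights (tallHeights r μ) (μ 1)).length = k := by
    rw [length_barHeights, length_tallHeights hμ hodd hr]
  have hk := length_tallHeights hμ hodd hr
  rw [wordB12_eq hn hμ hodd hr, highestTab_barWeight hμ hodd hr, segTab]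
  generalize barHeights (tallHeights r μ) (μ 1) = H at hb hlen ⊢
  have hbn : ∀ g ∈ H, 3 ≤ g ∧ g ≤ n := fun g hg => by have := hb g hg; omega
  obtain ⟨a1, a2⟩ := iter_one (X := X) (m := μ 1) (by omega : 3 ≤ n) hbn (by omega)
  obtain ⟨b1, b2⟩ := iter_two (X := X) (m := μ 1) hbn (by omega) (by omega)
  obtain ⟨v, c1, c2⟩ := raises_columns (X := X) (n := n) hn hr hb
  rw [hlen] at a2 b1 b2
  -- the node `1`
  obtain ⟨d1, d2⟩ := raisedRow_downRow_two h hx hr hrn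
  obtain ⟨d3, d4⟩ := iter_rowCrystal (X := X) (l := l) le_rfl (by omega : 1 < n)
    (supported_downRow (r := r) (x := x) (i := 2) (by omega) (by omega)) d1
  rw [show 1 + 1 = 2 from rfl, d2] at d3 d4
  rw [eWord_append, eWord_replicate, tensor_iter ((crystal_phi le_rfl _).trans a1) d3 d4
    (crystal_iter le_rfl a2 _), Option.bind_some]
  -- the node `2`, acting on the tableau only
  obtain ⟨f1, f2⟩ := raisedRow_middleRow (l := l) (x (pos 2) + x (neg 1))
  obtain ⟨f3, f4⟩ := iter_rowCrystal (X := X) (l := l) (i := 2) (by omega) (by omega : 2 < n)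
    (supported_middleRow (by omega) _) f1
  rw [show 2 + 1 = 3 from rfl, f2] at f3 f4
  have hphi : ∀ j < 2 * k - μ 1, ∀ S, partialIter ((crystal X n r k).e 2) j
      ⟨H.reverse, kWord H (List.replicate (μ 1) 3 ++ List.replicate (2 * k - μ 1) 2)⟩ = some S →
      (rowCrystal X n l).eps 2 (middleRow l (x (pos 2) + x (neg 1))) ≤
        (crystal X n r k).phi 2 S := by
    intro j hj S hS
    obtain ⟨w, hw, -⟩ := partialIter_isSome_of_le hj.le b2
    rw [crystal_iter (by omega) hw, Option.some.injEq] at hS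
    subst hS
    rw [eps_eq f3 f4, crystal_phi (by omega)]
    have := (partialIter_eWd (by omega) hw).2.1
    show _ ≤ phiWord X n 2 w
    omega
  rw [eWord_append, eWord_replicate, tensor_iter_left (crystal_iter (by omega) b2 _) hphi,
    Option.bind_some]
  -- the nodes `3, …, n, …, 3`, acting on the tableau only
  have hup : ∀ j ∈ nodesUp n 3, 3 ≤ j ∧ j ≤ n := by
    intro j hj
    rw [nodesUp, List.mem_range'_1] at hj
    omega
  have hdown : ∀ j ∈ nodesDown X n 3, 3 ≤ j ∧ j ≤ n := by
    intro j hj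
    rw [nodesDown_eq, List.mem_reverse, List.mem_range'_1] at hj
    omega
  have hinert : ∀ js : List ℕ, (∀ j ∈ js, 3 ≤ j ∧ j ≤ n) →
      RowRaises X n l js (fun _ => 0) (middleRow l (x (pos 2) + x (neg 1)))
        (middleRow l (x (pos 2) + x (neg 1))) := fun js hjs =>
    rowRaises_inert fun j hj => middleRow_inert hn hr _ (hjs j hj).1 (hjs j hj).2
  rw [eWord_append, eWord_tensor (fun j hj => by have := hup j hj; omega) c1 (hinert _ hup)
      (g := midUp X n H) (fun _ _ => rfl), Option.bind_some, eWord_append,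
    eWord_tensor (fun j hj => by have := hdown j hj; omega) c2 (hinert _ hdown)
      (g := fun j => H.countP (· ≤ j)) (fun _ _ => rfl), Option.bind_some, eWord_replicate]
  -- the node `2`, acting on the row only
  have hphi : phiWord X n 2 (colWord (seg 1) H) = 0 := by
    have h1 := phiWord_segs_le hn hr (i := 2) (by omega) (by omega) fun g hg => (hb g hg).2
    have h2 : H.count 2 = 0 := List.count_eq_zero.mpr fun h2 => by have := hb 2 h2; omega
    omega
  exact tensor_iter_right ((crystal_phi (by omega) _).trans hphi) f3 f4

theorem isRow_targetRow (hn : 3 ≤ n) {m : ℕ} (hm : m ≤ l) : IsRow X n l (targetRow l m) := by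
  refine ⟨fun a ha => ?_, ?_, Nat.zero_le _, fun _ => Or.inl ?_⟩
  · simp only [targetRow] at ha
    split_ifs at ha with h1 h2
    · subst h1
      exact ⟨by omega, hn⟩
    · subst h2
      exact ⟨le_rfl, by omega⟩
    · exact absurd rfl ha
  · have h1 : ∀ i, targetRow l m (pos i) + targetRow l m (neg i) =
        (if i = 1 then l - m else 0) + if i = 3 then m else 0 := by
      intro i
      simp [targetRow]
    have h2 : targetRow l m zero = 0 := rfl
    rw [Finset.sum_congr rfl fun i _ => h1 i, Finset.sum_add_distrib, Finset.sum_ite_eq',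
      Finset.sum_ite_eq', if_pos (Finset.mem_Icc.mpr ⟨le_rfl, by omega⟩),
      if_pos (Finset.mem_Icc.mpr ⟨by omega, hn⟩), h2]
    omega
  · simp only [targetRow, pos.injEq, reduceCtorEq, if_false]
    exact if_neg (by omega)

end Main

end KR

theorem proposition6p1 (X : KRType) (n r k l : ℕ) (hodd : Odd r) (hr : 3 ≤ r)
    (hn : KR.InRange X n r) (hk : 1 ≤ k) (hl : 1 ≤ l)
    (μ : ℕ → ℕ) (hμ : KR.IsWeight r k μ) (x : KR.Coord)
    (hmem : (KR.highestTab r μ, x) ∈ ((KR.crystal X n r k).tensor (KR.rowCrystal X n l)).elts)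
    (hhigh : ∀ i, 1 ≤ i → i ≤ n →
      ((KR.crystal X n r k).tensor (KR.rowCrystal X n l)).e i (KR.highestTab r μ, x) = none) :
    x (KRLetter.pos 2) + x (KRLetter.neg 1) ≤ l ∧
    (KR.highestTab r (KR.barWeight μ),
        KR.targetRow l (x (KRLetter.pos 2) + x (KRLetter.neg 1))) ∈
      ((KR.crystal X n r k).tensor (KR.rowCrystal X n l)).elts ∧
    (partialIter (((KR.crystal X n r k).tensor (KR.rowCrystal X n l)).e 0)
        (2 * k - μ 1 + x (KRLetter.pos 1) + x (KRLetter.pos 2)) (KR.highestTab r μ, x)).bind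
      (((KR.crystal X n r k).tensor (KR.rowCrystal X n l)).eWord (KR.wordB1 X n r k l μ x)) =
    some (KR.highestTab r (KR.barWeight μ),
      KR.targetRow l (x (KRLetter.pos 2) + x (KRLetter.neg 1))) := by
  have hodd' := Nat.odd_iff.mp hodd
  have hrn := KR.le_of_inRange hn
  have hx : KR.IsRow X n l x := hmem.2
  obtain ⟨h, hm⟩ := KR.highestRow hodd' hr hn hμ hx hhigh
  have hsum := KR.row_length h hx hr hrn
  have hle : x (KRLetter.pos 2) + x (KRLetter.neg 1) ≤ l := by omega
  refine ⟨hle, ⟨⟨KR.barWeight μ, KR.isWeight_barWeight hμ hodd' hr, Relation.ReflTransGen.refl⟩,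
    KR.isRow_targetRow (by omega) hle⟩, ?_⟩
  rw [KR.iter_zero hn hodd' hr hμ h, Option.bind_some, KR.wordB1, KR.eWord_append,
    KR.eWord_wordB11 hn hodd' hr hμ h, Option.bind_some, KR.eWord_wordB12 hn hodd' hr hμ h hx hm]
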